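/- **Setting.** Let $d_s,d_u\ge 1$, $d=d_s+d_u$, $\mathbb R^d=\mathbb R^{d_s}\times\mathbb R^{d_u}$ with its Euclidean structure, and let $\pi_-:\mathbb R^d\to\mathbb R^{d_s}$ be the orthogonal projection. Put $\mathbb F\varphi(\xi)=\int e^{-ix\xi}\varphi(x)\,dx$, and let $\mathbb F^{-1}$ be its inverse. Fix a $C^\infty$ function $\chi:\mathbb R_+\to[0,1]$ with $\chi=1$ on $[0,1]$ and $\chi=0$ on $[2,\infty)$; on $\mathbb R^n$ let $\psi_0(\xi)=\chi(\|\xi\|)$, $\psi_\ell(\xi)=\chi(2^{-\ell}\|\xi\|)-\chi(2^{-\ell+1}\|\xi\|)$ for $\ell\ge1$ (written $\psi_\ell^{(d_s)}$ when $n=d_s$), and on $\mathbb R^d$ let $\psi_\ell^{Op}\varphi=\mathbb F^{-1}(\psi_\ell\cdot\mathbb F\varphi)$. A *cone* is a subset of $\mathbb R^d$ invariant under scalar multiplication; its dimension is the largest dimension of a linear subspace contained in it. Fix a pair $\mathbf C_\pm=(\mathbf C_+,\mathbf C_-)$ of closed cones with nonempty interiors, of dimensions $d_u$ and $d_s$,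 with $\mathbf C_+\cap\mathbf C_-=\{0\}$ and $\mathbb R^{d_s}\times\{0\}\subset\mathbf C_-$. Fix real numbers $r>1$, $C_{\mathcal F}\ge1$, and $1\le p\le\infty$. Let $\mathcal F$ be the set of all $d_s$-dimensional $C^r$ embedded submanifolds $\Gamma\subset\mathbb R^d$ such that around each point of $\Gamma$ there is a submanifold chart (a local $C^r$ diffeomorphism of $\mathbb R^d$ mapping $\Gamma$ to $\mathbb R^{d_s}\times\{0\}$) which, together with its inverse, has $C^r$ norm at most $C_{\mathcal F}$ (derivatives of positive order only, so that $\mathcal F$ is invariant under translations), and such that the straight line through any two distinct points of $\Gamma$ is normal to a $d_u$-dimensional subspace contained in $\mathbf C_+$. Then $\pi_\Gamma:=\pi_-|_\Gamma$ is injective. For $\Gamma\in\mathcal F$ and $w\in\Gamma$ put $$\psi_{\ell}^{Op(\Gamma)}(f)(w)=\frac1{(2\pi)^{d_s}}\int_{\pi_-(\Gamma)}\int_{\mathbb R^{d_s}}e^{i(\pi_\Gamma(w)-z)\eta}\,\psi_{\ell}^{(d_s)}(\eta)\,f(\pi_\Gamma^{-1}(z))\,d\eta\,dz,$$ $$\|f\|^s_{p,\Gamma}=\sup_{\ell\ge0}2^{\ell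 s}\|\psi_{\ell}^{Op(\Gamma)}(f)\|_{L_p(\mu_\Gamma)},$$ where $\mu_\Gamma$ is the Riemannian volume of $\Gamma$. For a compact $K\subset\mathbb R^d$, let $C^\infty(K)$ be the space of complex-valued $C^\infty$ functions on $\mathbb R^d$ supported in $K$; for $\varphi\in C^\infty(K)$ let $$\|\varphi\|_{\mathcal U^{\mathbf C_\pm,t,s}_p}=\sup_{\Gamma\in\mathcal F}\ \sup_{\ell\ge0}\ 2^{\ell t}\,\|\psi_\ell^{Op}\varphi\|^s_{p,\Gamma},$$ and let $\mathcal U^{\mathbf C_\pm,t,s}_p(K)$ be the completion of $C^\infty(K)$ for this norm. For real $u\ge0$, $\|\cdot\|_{C^u}$ is the usual $C^u$ norm (with a Hölder condition of exponent $u-\lfloor u\rfloor$ on the derivatives of order $\lfloor u\rfloor$ if $u$ is not an integer). A distribution $T$ on $\mathbb R^d$ is *of order $u$* if for each compact $L$ there is $C_L$ with $|T(v)|\le C_L\|v\|_{C^u}$ for all $v\in C_c^\infty(\mathbb R^d)$ supported in $L$. **Lemma 3.6.** Assume $s<-t<0$. 1. For every $u>t$ there is a constant $C$ such that $\|\varphi\|_{\mathcal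 U^{\mathbf C_\pm,t,s}_p}\le C\|\varphi\|_{C^u}$ for all $\varphi\in C^\infty(K)$. In particular $\|\varphi\|_{\mathcal U^{\mathbf C_\pm,t,s}_p}<\infty$ for all $\varphi\in C^\infty(K)$. 2. For every $u>|t+s|$ the space $\mathcal U^{\mathbf C_\pm,t,s}_p(K)$ is contained in the space of distributions of order $u$ supported on $K$: there is an injective linear map $J$ from $\mathcal U^{\mathbf C_\pm,t,s}_p(K)$ to the distributions on $\mathbb R^d$ such that $J(\varphi)(v)=\int\varphi\,v\,dx$ for $\varphi\in C^\infty(K)$ and $v\in C^\infty_c(\mathbb R^d)$, each $J(x)$ is of order $u$ and supported on $K$, and, for some constant $C$, $|J(x)(v)|\le C\,\|x\|_{\mathcal U^{\mathbf C_\pm,t,s}_p}\|v\|_{C^u}$ for all $x\in\mathcal U^{\mathbf C_\pm,t,s}_p(K)$ and $v\in C^\infty_c(\mathbb R^d)$. -/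

import Mathlib

open MeasureTheory Distribution
open scoped ENNReal NNReal ContDiff Distributions

noncomputable section

namespace AnisotropicLeaf

/-- `ℝ^d = ℝ^{ds} × ℝ^{du}` with its Euclidean structure; the coordinates `Sum.inl i` are the
first `ds` (stable) ones, the coordinates `Sum.inr j` the last `du` (unstable) ones. -/
abbrev Space (ds du : ℕ) : Type := EuclideanSpace ℝ (Fin ds ⊕ Fin du)

/-- The orthogonal projection `π₋ : ℝ^d → ℝ^{ds}`. -/
def proj {ds du : ℕ} (x : Space ds du) : EuclideanSpace ℝ (Fin ds) :=
  WithLp.toLp 2 fun i => x (Sum.inl i)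

/-- The subspace `ℝ^{ds} × {0}` of `ℝ^d`. -/
def horizontal (ds du : ℕ) : Submodule ℝ (Space ds du) where
  carrier := {x | ∀ j : Fin du, x (Sum.inr j) = 0}
  add_mem' := by
    intro a b ha hb j
    simp only [Set.mem_ofPred_eq] at ha hb
    simp [ha j, hb j]
  zero_mem' := by intro j; simp
  smul_mem' := by
    intro c x hx j
    simp only [Set.mem_ofPred_eq] at hx
    simp [hx j]

/-! ### `C^r` norms for real `r` -/

/-- The part of the `C^r` norm (`r ≥ 0` real) of `f` on the open set `S` that involves the
derivatives of order at least `k₀`: the sum of the suprema over `S` of the derivatives of the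
orders `k₀, …, ⌊r⌋` and, when `r` is not an integer, of the Hölder seminorm of exponent `r - ⌊r⌋`
of the derivative of order `⌊r⌋`. -/
def derivNorm {E F : Type*} [NormedAddCommGroup E] [NormedSpace ℝ E]
    [NormedAddCommGroup F] [NormedSpace ℝ F] (k₀ : ℕ) (r : ℝ) (S : Set E) (f : E → F) : ℝ≥0∞ :=
  (∑ k ∈ Finset.Icc k₀ ⌊r⌋₊, ⨆ x ∈ S, ‖iteratedFDeriv ℝ k f x‖ₑ) +
    open Classical in
    if (⌊r⌋₊ : ℝ) = r then 0 else
      ⨆ x ∈ S, ⨆ y ∈ S, ⨆ _ : x ≠ y,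
        ‖iteratedFDeriv ℝ ⌊r⌋₊ f x - iteratedFDeriv ℝ ⌊r⌋₊ f y‖ₑ /
          ENNReal.ofReal (‖x - y‖ ^ (r - ⌊r⌋₊))

/-- The norm `‖f‖_{C^u}` of a smooth function on the whole space, for real `u ≥ 0`: the classical
one for integer `u`, the Hölder one otherwise. -/
def cNorm {E F : Type*} [NormedAddCommGroup E] [NormedSpace ℝ E]
    [NormedAddCommGroup F] [NormedSpace ℝ F] (u : ℝ) (f : E → F) : ℝ≥0∞ :=
  derivNorm 0 u Set.univ f

/-! ### Dyadic decomposition of frequencies -/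

/-- The function `χ : ℝ₊ → [0,1]`, smooth, equal to `1` on `[0,1]` and to `0` on `[2,∞)`
(extended by `1` to the negative numbers, where it is never evaluated). -/
structure Cutoff where
  /-- The underlying function. -/
  toFun : ℝ → ℝ
  smooth : ContDiff ℝ ∞ toFun
  mem_Icc : ∀ x, toFun x ∈ Set.Icc (0 : ℝ) 1
  eq_one : ∀ x, x ≤ 1 → toFun x = 1
  eq_zero : ∀ x, 2 ≤ x → toFun x = 0

/-- `ψ_0(ξ) = χ(‖ξ‖)` and `ψ_n(ξ) = χ(2^{-n}‖ξ‖) - χ(2^{-n+1}‖ξ‖)` for `n ≥ 1`. -/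
def Cutoff.dyadic (χ : Cutoff) {V : Type*} [NormedAddCommGroup V] : ℕ → V → ℝ
  | 0, ξ => χ.toFun ‖ξ‖
  | n + 1, ξ => χ.toFun (‖ξ‖ / 2 ^ (n + 1)) - χ.toFun (‖ξ‖ / 2 ^ n)

/-- The Fourier transform `𝔽 f(ξ) = ∫ e^{-i x ξ} f(x) dx`. -/
def fourierT {ι : Type*} [Fintype ι] (f : EuclideanSpace ℝ ι → ℂ) (ξ : EuclideanSpace ℝ ι) : ℂ :=
  ∫ y, Complex.exp (-Complex.I * (inner ℝ y ξ : ℝ)) * f y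

/-- The inverse Fourier transform `𝔽⁻¹ g(x) = (2π)^{-d} ∫ e^{i x ξ} g(ξ) dξ`. -/
def fourierTInv {ι : Type*} [Fintype ι] (g : EuclideanSpace ℝ ι → ℂ) (x : EuclideanSpace ℝ ι) :
    ℂ :=
  ((2 * Real.pi : ℝ) ^ Fintype.card ι : ℂ)⁻¹ *
    ∫ ξ, Complex.exp (Complex.I * (inner ℝ x ξ : ℝ)) * g ξ

/-- The operator `ψ_ℓ^{Op} f = 𝔽⁻¹(ψ_ℓ · 𝔽 f)` on `ℝ^d`. -/
def Cutoff.op (χ : Cutoff) {ι : Type*} [Fintype ι] (l : ℕ) (f : EuclideanSpace ℝ ι → ℂ) :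
    EuclideanSpace ℝ ι → ℂ :=
  fourierTInv fun ξ => (χ.dyadic l ξ : ℂ) * fourierT f ξ

/-! ### Cones and fake stable leaves -/

/-- A cone pair: two closed cones (sets invariant under scalar multiplication) of `ℝ^d` with
nonempty interiors, of dimensions `du` and `ds` (the dimension of a cone being the largest
dimension of a linear subspace that it contains), meeting only at `0`. -/
structure ConePair (ds du : ℕ) where
  /-- The cone `C₊`. -/
  plus : Set (Space ds du)
  /-- The cone `C₋`. -/
  minus : Set (Space ds du)
  smul_mem_plus : ∀ (c : ℝ), ∀ x ∈ plus, c • x ∈ plus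
  smul_mem_minus : ∀ (c : ℝ), ∀ x ∈ minus, c • x ∈ minus
  isClosed_plus : IsClosed plus
  isClosed_minus : IsClosed minus
  interior_plus : (interior plus).Nonempty
  interior_minus : (interior minus).Nonempty
  dim_plus : IsGreatest {n : ℕ | ∃ W : Submodule ℝ (Space ds du),
    (W : Set (Space ds du)) ⊆ plus ∧ Module.finrank ℝ W = n} du
  dim_minus : IsGreatest {n : ℕ | ∃ W : Submodule ℝ (Space ds du),
    (W : Set (Space ds du)) ⊆ minus ∧ Module.finrank ℝ W = n} ds
  inter_eq : plus ∩ minus = {0}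

/-- The set `F(C₊, C_F)` of fake stable leaves: `C^r` embedded submanifolds `Γ` of `ℝ^d` of
dimension `ds`, whose submanifold charts `κ` (local diffeomorphisms of `ℝ^d` mapping `Γ` to
`ℝ^{ds} × {0}`) have `C^r` norms, in both directions, bounded by `C_F` (the size of the values of
the charts, which is not invariant under translations of `Γ`, is not counted), and such that the
straight line through any two distinct points of `Γ` is normal to a `du`-dimensional subspace
contained in `C₊`. -/
structure IsFakeStableLeaf {ds du : ℕ} (r : ℝ) (Cplus : Set (Space ds du)) (CF : ℝ)
    (Γ : Set (Space ds du)) : Prop where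
  exists_chart : ∀ w ∈ Γ, ∃ κ : OpenPartialHomeomorph (Space ds du) (Space ds du),
    w ∈ κ.source ∧ ContDiffOn ℝ ⌊r⌋₊ κ κ.source ∧ ContDiffOn ℝ ⌊r⌋₊ κ.symm κ.target ∧
    (∀ x ∈ κ.source, x ∈ Γ ↔ κ x ∈ horizontal ds du) ∧
    derivNorm 1 r κ.source κ ≤ ENNReal.ofReal CF ∧
    derivNorm 1 r κ.target κ.symm ≤ ENNReal.ofReal CF
  secant : ∀ x ∈ Γ, ∀ y ∈ Γ, x ≠ y → ∃ W : Submodule ℝ (Space ds du),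
    (W : Set (Space ds du)) ⊆ Cplus ∧ Module.finrank ℝ W = du ∧ ∀ w ∈ W, inner ℝ (x - y) w = 0

/-- The inverse `π_Γ⁻¹ : π₋(Γ) → Γ` of the restriction `π_Γ` of `π₋` to `Γ`
(only used on `π₋(Γ)`). -/
def leafInv {ds du : ℕ} (Γ : Set (Space ds du)) : EuclideanSpace ℝ (Fin ds) → Space ds du :=
  Function.invFunOn proj Γ

/-- The operator `ψ_{ℓ}^{Op(Γ)}`,
`ψ_ℓ^{Op(Γ)}(f)(w) = (2π)^{-ds} ∫∫ e^{i(π_Γ(w) - z)η} ψ_ℓ(η) f(π_Γ⁻¹(z)) dη dz`,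
where `z` runs over the domain `π₋(Γ)` of `π_Γ⁻¹`. -/
def Cutoff.leafOp (χ : Cutoff) {ds du : ℕ} (Γ : Set (Space ds du)) (l : ℕ)
    (f : Space ds du → ℂ) (w : Space ds du) : ℂ :=
  ((2 * Real.pi : ℝ) ^ ds : ℂ)⁻¹ *
    ∫ z in proj '' Γ, ∫ η : EuclideanSpace ℝ (Fin ds),
      Complex.exp (Complex.I * (inner ℝ (proj w - z) η : ℝ)) * (χ.dyadic l η : ℂ) *
        f (leafInv Γ z)

/-- The Riemannian volume `μ_Γ` of a `ds`-dimensional submanifold `Γ` of `ℝ^d` for the metric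
induced by the standard one, that is, the (Euclidean-normalised) `ds`-dimensional Hausdorff
measure on `Γ`. -/
def leafVolume {ds du : ℕ} (Γ : Set (Space ds du)) : Measure (Space ds du) :=
  (μHE[ds] : Measure (Space ds du)).restrict Γ

/-- The isotropic norm `‖f‖^s_{p,Γ} = sup_ℓ 2^{ℓ s} ‖ψ_ℓ^{Op(Γ)} f‖_{L_p(μ_Γ)}`. -/
def isoNorm (χ : Cutoff) {ds du : ℕ} (p : ℝ≥0∞) (s : ℝ) (Γ : Set (Space ds du))
    (f : Space ds du → ℂ) : ℝ≥0∞ :=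
  ⨆ l : ℕ, ENNReal.ofReal ((2 : ℝ) ^ ((l : ℝ) * s)) *
    eLpNorm (χ.leafOp Γ l f) p (leafVolume Γ)

/-- The data on which the anisotropic norm depends. -/
structure Params (ds du : ℕ) where
  /-- The cutoff function `χ`. -/
  χ : Cutoff
  /-- The cone pair. -/
  cones : ConePair ds du
  horizontal_subset : (horizontal ds du : Set (Space ds du)) ⊆ cones.minus
  /-- The smoothness of the leaves. -/
  r : ℝ
  one_lt_r : 1 < r
  /-- The constant bounding the charts of the leaves. -/
  CF : ℝ
  one_le_CF : 1 ≤ CF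
  /-- The integrability exponent. -/
  p : ℝ≥0∞
  one_le_p : 1 ≤ p
  /-- The exponent of the ambient frequencies. -/
  t : ℝ
  /-- The exponent of the frequencies along the leaves. -/
  s : ℝ

variable {ds du : ℕ}

/-- The norm
`‖f‖_U = sup_{Γ ∈ F(C₊, C_F)} sup_ℓ 2^{ℓ t} ‖ψ_ℓ^{Op} f‖^s_{p,Γ}`, with values in `[0,∞]`. -/
def Params.uNorm (P : Params ds du) (f : Space ds du → ℂ) : ℝ≥0∞ :=
  ⨆ (Γ : Set (Space ds du)) (_ : IsFakeStableLeaf P.r P.cones.plus P.CF Γ) (l : ℕ),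
    ENNReal.ofReal ((2 : ℝ) ^ ((l : ℝ) * P.t)) * isoNorm P.χ P.p P.s Γ (P.χ.op l f)

/-! ### The norm is a seminorm -/

@[simp] lemma proj_apply (x : Space ds du) (i : Fin ds) : proj x i = x (Sum.inl i) := rfl

lemma proj_sub (x y : Space ds du) : proj (x - y) = proj x - proj y := by
  ext i; simp

lemma continuous_proj : Continuous (proj : Space ds du → _) := by
  unfold proj
  fun_prop

lemma norm_proj_le (x : Space ds du) : ‖proj x‖ ≤ ‖x‖ := by
  rw [EuclideanSpace.norm_eq, EuclideanSpace.norm_eq]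
  apply Real.sqrt_le_sqrt
  rw [Fintype.sum_sum_type]
  simp only [proj_apply]
  have : 0 ≤ ∑ j : Fin du, ‖x (Sum.inr j)‖ ^ 2 := by positivity
  linarith

lemma finrank_horizontal : Module.finrank ℝ (horizontal ds du) = ds := by
  let e : horizontal ds du ≃ₗ[ℝ] (Fin ds → ℝ) :=
    { toFun := fun x i => x.1 (Sum.inl i)
      map_add' := by intro x y; ext i; simp
      map_smul' := by intro c x; ext i; simp
      invFun := fun v => ⟨WithLp.toLp 2 (Sum.elim v 0), by intro j; simp⟩
      left_inv := by
        intro x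
        ext i
        rcases i with i | j
        · simp
        · simpa using (x.2 j).symm
      right_inv := by intro v; ext i; simp }
  rw [e.finrank_eq]; simp

lemma injOn_proj (P : Params ds du) {Γ : Set (Space ds du)}
    (hΓ : IsFakeStableLeaf P.r P.cones.plus P.CF Γ) : Set.InjOn proj Γ := by
  intro x hx y hy hxy
  by_contra hne
  obtain ⟨W, hW, hdim, horth⟩ := hΓ.secant x hx y hy hne
  have hinf : W ⊓ horizontal ds du = ⊥ := by
    rw [eq_bot_iff]
    intro v hv
    have : v ∈ P.cones.plus ∩ P.cones.minus := ⟨hW hv.1, P.horizontal_subset hv.2⟩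
    rw [P.cones.inter_eq] at this
    simpa using this
  have hsup : W ⊔ horizontal ds du = ⊤ := by
    apply Submodule.eq_top_of_finrank_eq
    have := Submodule.finrank_sup_add_finrank_inf_eq W (horizontal ds du)
    rw [hinf, finrank_bot, hdim, finrank_horizontal] at this
    rw [finrank_euclideanSpace]
    simp
    omega
  have hv : ∀ i, (x - y) (Sum.inl i) = 0 := by
    intro i
    have := congrArg (fun v => v i) hxy
    simp only [proj_apply] at this
    simp [this]
  have hall : ∀ v : Space ds du, inner ℝ (x - y) v = 0 := by
    intro v
    have hmem : v ∈ W ⊔ horizontal ds du := by rw [hsup]; trivial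
    obtain ⟨a, ha, b, hb, rfl⟩ := Submodule.mem_sup.mp hmem
    rw [inner_add_right, horth a ha, zero_add, PiLp.inner_apply, Fintype.sum_sum_type]
    have hb' : ∀ j : Fin du, b (Sum.inr j) = 0 := hb
    simp only [hv, hb', inner_zero_left, inner_zero_right, Finset.sum_const_zero, add_zero]
  have := hall (x - y)
  rw [inner_self_eq_zero, sub_eq_zero] at this
  exact hne this

lemma measurableSet_leaf {r CF : ℝ} {Cp Γ : Set (Space ds du)}
    (hΓ : IsFakeStableLeaf r Cp CF Γ) : MeasurableSet Γ := by
  have hloc : IsLocallyClosed Γ := by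
    refine ((isLocallyClosed_tfae Γ).out 0 3).mpr ?_
    intro w hw
    obtain ⟨κ, hws, -, -, hκ, -, -⟩ := hΓ.exists_chart w hw
    refine ⟨κ.source, hws, κ.open_source, ?_⟩
    rintro x ⟨hxs, hxc⟩
    rw [hκ x hxs]
    have hcl : IsClosed (horizontal ds du : Set (Space ds du)) :=
      (horizontal ds du).closed_of_finiteDimensional
    have hcont : ContinuousWithinAt κ (Γ ∩ κ.source) x :=
      (κ.continuousAt hxs).continuousWithinAt
    have hxc' : x ∈ closure (Γ ∩ κ.source) := by
      rw [Set.inter_comm]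
      exact κ.open_source.inter_closure ⟨hxs, hxc⟩
    have := hcont.mem_closure hxc' (t := (horizontal ds du : Set (Space ds du)))
      (fun y hy => (hκ y hy.2).mp hy.1)
    rwa [hcl.closure_eq] at this
  obtain ⟨U, Z, hU, hZ, rfl⟩ := hloc
  exact hU.measurableSet.inter hZ.measurableSet

lemma measurableSet_image {P : Params ds du} {Γ : Set (Space ds du)}
    (hΓ : IsFakeStableLeaf P.r P.cones.plus P.CF Γ) : MeasurableSet (proj '' Γ) :=
  (measurableSet_leaf hΓ).image_of_continuousOn_injOn continuous_proj.continuousOn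
    (injOn_proj P hΓ)

lemma proj_leafInv {Γ : Set (Space ds du)} {z : EuclideanSpace ℝ (Fin ds)}
    (hz : z ∈ proj '' Γ) : proj (leafInv Γ z) = z :=
  Function.invFunOn_eq hz

lemma leafInv_mem {Γ : Set (Space ds du)} {z : EuclideanSpace ℝ (Fin ds)}
    (hz : z ∈ proj '' Γ) : leafInv Γ z ∈ Γ :=
  Function.invFunOn_mem hz

lemma aemeasurable_leafInv {P : Params ds du} {Γ : Set (Space ds du)}
    (hΓ : IsFakeStableLeaf P.r P.cones.plus P.CF Γ) :
    AEMeasurable (leafInv Γ) (volume.restrict (proj '' Γ)) := by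
  refine aemeasurable_restrict_of_measurable_subtype (measurableSet_image hΓ) ?_
  intro B hB
  have hmeas : MeasurableSet (proj '' (Γ ∩ B)) :=
    ((measurableSet_leaf hΓ).inter hB).image_of_continuousOn_injOn continuous_proj.continuousOn
      ((injOn_proj P hΓ).mono Set.inter_subset_left)
  have : (fun z : (proj '' Γ : Set _) => leafInv Γ (z : EuclideanSpace ℝ (Fin ds))) ⁻¹' B =
      Subtype.val ⁻¹' (proj '' (Γ ∩ B)) := by
    ext ⟨z, hz⟩
    constructor
    · intro h
      exact ⟨leafInv Γ z, ⟨leafInv_mem hz, h⟩, proj_leafInv hz⟩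
    · rintro ⟨y, ⟨hy, hyB⟩, hyz⟩
      have : leafInv Γ z = y :=
        injOn_proj P hΓ (leafInv_mem hz) hy ((proj_leafInv hz).trans hyz.symm)
      simpa [this] using hyB
  rw [this]
  exact measurable_subtype_coe hmeas

/-- Continuous functions that decay faster than `‖x‖^{-ds}`. -/
def Decays (f : Space ds du → ℂ) : Prop :=
  Continuous f ∧ ∃ C : ℝ, ∀ x, ‖f x‖ ≤ C * (1 + ‖x‖) ^ (-((ds : ℝ) + 1))

lemma Decays.integrable_leaf {P : Params ds du} {Γ : Set (Space ds du)}
    (hΓ : IsFakeStableLeaf P.r P.cones.plus P.CF Γ) {f : Space ds du → ℂ} (hf : Decays f) :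
    Integrable (fun z => f (leafInv Γ z)) (volume.restrict (proj '' Γ)) := by
  obtain ⟨hc, C, hC⟩ := hf
  have hint : Integrable (fun z : EuclideanSpace ℝ (Fin ds) =>
      |C| * (1 + ‖z‖) ^ (-((ds : ℝ) + 1))) (volume.restrict (proj '' Γ)) := by
    refine ((integrable_one_add_norm ?_).const_mul _).restrict
    simp
  refine hint.mono' (hc.measurable.comp_aemeasurable
    (aemeasurable_leafInv hΓ)).aestronglyMeasurable ?_
  refine (ae_restrict_mem (measurableSet_image hΓ)).mono fun z hz => ?_
  have hz' : ‖z‖ ≤ ‖leafInv Γ z‖ := by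
    conv_lhs => rw [← proj_leafInv hz]
    exact norm_proj_le _
  refine (hC _).trans ?_
  have h1 : (1 + ‖leafInv Γ z‖) ^ (-((ds : ℝ) + 1)) ≤ (1 + ‖z‖) ^ (-((ds : ℝ) + 1)) := by
    apply Real.rpow_le_rpow_of_nonpos (by positivity) (by linarith)
    have : (0 : ℝ) ≤ ds := by positivity
    linarith
  calc C * (1 + ‖leafInv Γ z‖) ^ (-((ds : ℝ) + 1))
      ≤ |C| * (1 + ‖leafInv Γ z‖) ^ (-((ds : ℝ) + 1)) := by
        gcongr; exact le_abs_self C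
    _ ≤ _ := by gcongr

/-! Regularity of the dyadic functions. -/

lemma Cutoff.contDiff_norm (χ : Cutoff) {V : Type*} [NormedAddCommGroup V]
    [InnerProductSpace ℝ V] {c : ℝ} (hc : 0 < c) :
    ContDiff ℝ ∞ fun ξ : V => χ.toFun (‖ξ‖ / c) := by
  rw [contDiff_iff_contDiffAt]
  intro ξ
  by_cases h : ξ = 0
  · subst h
    have : (fun ξ : V => χ.toFun (‖ξ‖ / c)) =ᶠ[nhds 0] fun _ => 1 := by
      filter_upwards [Metric.ball_mem_nhds (0 : V) hc] with ξ hξ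
      apply χ.eq_one
      rw [div_le_one hc]
      simpa using (mem_ball_zero_iff.mp hξ).le
    exact contDiffAt_const.congr_of_eventuallyEq this
  · exact χ.smooth.contDiffAt.comp ξ ((contDiffAt_norm ℝ h).div_const c)

lemma Cutoff.contDiff_dyadic (χ : Cutoff) {V : Type*} [NormedAddCommGroup V]
    [InnerProductSpace ℝ V] (l : ℕ) : ContDiff ℝ ∞ (χ.dyadic l : V → ℝ) := by
  cases l with
  | zero =>
    have : (χ.dyadic 0 : V → ℝ) = fun ξ => χ.toFun (‖ξ‖ / 1) := by
      ext ξ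
      simp [Cutoff.dyadic]
    rw [this]
    exact χ.contDiff_norm one_pos
  | succ n =>
    exact (χ.contDiff_norm (V := V) (by positivity)).sub (χ.contDiff_norm (by positivity))

lemma Cutoff.hasCompactSupport_dyadic (χ : Cutoff) {V : Type*} [NormedAddCommGroup V]
    [ProperSpace V] (l : ℕ) : HasCompactSupport (χ.dyadic l : V → ℝ) := by
  refine HasCompactSupport.intro (isCompact_closedBall (0 : V) (2 * 2 ^ l)) ?_
  intro ξ hξ
  have h : 2 * 2 ^ l < ‖ξ‖ := by simpa using hξ
  cases l with
  | zero => exact χ.eq_zero _ (by simpa using h.le)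
  | succ n =>
    have h2 : (0 : ℝ) < 2 ^ n := by positivity
    rw [Cutoff.dyadic, χ.eq_zero, χ.eq_zero, sub_zero]
    · rw [le_div_iff₀ h2]
      rw [pow_succ] at h
      linarith
    · rw [le_div_iff₀ (by positivity)]
      exact h.le

lemma Cutoff.integrable_dyadic (χ : Cutoff) {ι : Type*} [Fintype ι] (l : ℕ) :
    Integrable (fun ξ : EuclideanSpace ℝ ι => (χ.dyadic l ξ : ℂ)) :=
  ((χ.contDiff_dyadic l).continuous.integrable_of_hasCompactSupport
    (χ.hasCompactSupport_dyadic l)).ofReal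

/-! The operators along the leaves. -/

/-- The convolution kernel of `ψ_ℓ^{Op(Γ)}`, up to the factor `(2π)^{-ds}`. -/
def Cutoff.kernel (χ : Cutoff) {n : ℕ} (l : ℕ) (x : EuclideanSpace ℝ (Fin n)) : ℂ :=
  ∫ η : EuclideanSpace ℝ (Fin n),
    Complex.exp (Complex.I * (inner ℝ x η : ℝ)) * (χ.dyadic l η : ℂ)

lemma norm_exp_I_mul (a : ℝ) : ‖Complex.exp (Complex.I * (a : ℂ))‖ = 1 := by
  rw [mul_comm]; exact Complex.norm_exp_ofReal_mul_I a

lemma Cutoff.continuous_kernel (χ : Cutoff) {n : ℕ} (l : ℕ) :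
    Continuous (χ.kernel l : EuclideanSpace ℝ (Fin n) → ℂ) := by
  refine continuous_of_dominated (bound := fun η => ‖(χ.dyadic l η : ℂ)‖) ?_ ?_
    (χ.integrable_dyadic l).norm ?_
  · intro x
    refine Continuous.aestronglyMeasurable ?_
    have := (χ.contDiff_dyadic (V := EuclideanSpace ℝ (Fin n)) l).continuous
    fun_prop
  · intro x
    exact .of_forall fun η => by rw [norm_mul, norm_exp_I_mul, one_mul]
  · exact .of_forall fun η => by fun_prop

lemma Cutoff.norm_kernel_le (χ : Cutoff) {n : ℕ} (l : ℕ) (x : EuclideanSpace ℝ (Fin n)) :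
    ‖χ.kernel l x‖ ≤ ∫ η : EuclideanSpace ℝ (Fin n), ‖(χ.dyadic l η : ℂ)‖ := by
  refine (norm_integral_le_integral_norm _).trans (le_of_eq ?_)
  congr 1
  ext η
  rw [norm_mul, norm_exp_I_mul, one_mul]

lemma Cutoff.leafOp_eq (χ : Cutoff) (Γ : Set (Space ds du)) (l : ℕ)
    (f : Space ds du → ℂ) (w : Space ds du) :
    χ.leafOp Γ l f w = ((2 * Real.pi : ℝ) ^ ds : ℂ)⁻¹ *
      ∫ z in proj '' Γ, χ.kernel l (proj w - z) * f (leafInv Γ z) := by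
  simp only [Cutoff.leafOp, Cutoff.kernel, integral_mul_const]

lemma Decays.integrable_kernel (χ : Cutoff) {P : Params ds du} {Γ : Set (Space ds du)}
    (hΓ : IsFakeStableLeaf P.r P.cones.plus P.CF Γ) {f : Space ds du → ℂ} (hf : Decays f)
    (l : ℕ) (w : Space ds du) :
    Integrable (fun z => χ.kernel l (proj w - z) * f (leafInv Γ z))
      (volume.restrict (proj '' Γ)) := by
  refine (hf.integrable_leaf hΓ).bdd_mul (c := ∫ η : EuclideanSpace ℝ (Fin ds),
    ‖(χ.dyadic l η : ℂ)‖) ?_ ?_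
  · have := χ.continuous_kernel (n := ds) l
    exact Continuous.aestronglyMeasurable (by fun_prop)
  · exact .of_forall fun z => χ.norm_kernel_le l _

lemma Decays.continuous_leafOp (χ : Cutoff) {P : Params ds du} {Γ : Set (Space ds du)}
    (hΓ : IsFakeStableLeaf P.r P.cones.plus P.CF Γ) {f : Space ds du → ℂ} (hf : Decays f)
    (l : ℕ) : Continuous (χ.leafOp Γ l f) := by
  have hk := χ.continuous_kernel (n := ds) l
  have hp := continuous_proj (ds := ds) (du := du)
  have : χ.leafOp Γ l f = fun w => ((2 * Real.pi : ℝ) ^ ds : ℂ)⁻¹ *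
      ∫ z in proj '' Γ, χ.kernel l (proj w - z) * f (leafInv Γ z) :=
    funext fun w => χ.leafOp_eq Γ l f w
  rw [this]
  refine continuous_const.mul (continuous_of_dominated (bound := fun z =>
    (∫ η : EuclideanSpace ℝ (Fin ds), ‖(χ.dyadic l η : ℂ)‖) * ‖f (leafInv Γ z)‖) ?_ ?_ ?_ ?_)
  · exact fun w => (hf.integrable_kernel χ hΓ l w).aestronglyMeasurable
  · intro w
    refine .of_forall fun z => ?_
    rw [norm_mul]
    gcongr
    exact χ.norm_kernel_le l _
  · exact (hf.integrable_leaf hΓ).norm.const_mul _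
  · exact .of_forall fun z => by fun_prop

lemma leafOp_add (χ : Cutoff) {P : Params ds du} {Γ : Set (Space ds du)}
    (hΓ : IsFakeStableLeaf P.r P.cones.plus P.CF Γ) {f g : Space ds du → ℂ} (hf : Decays f)
    (hg : Decays g) (l : ℕ) : χ.leafOp Γ l (f + g) = χ.leafOp Γ l f + χ.leafOp Γ l g := by
  ext w
  simp only [Pi.add_apply, Cutoff.leafOp_eq, mul_add]
  rw [integral_add (hf.integrable_kernel χ hΓ l w) (hg.integrable_kernel χ hΓ l w), mul_add]

lemma leafOp_smul (χ : Cutoff) (Γ : Set (Space ds du)) (c : ℂ) (f : Space ds du → ℂ) (l : ℕ) :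
    χ.leafOp Γ l (c • f) = c • χ.leafOp Γ l f := by
  ext w
  simp only [Pi.smul_apply, Cutoff.leafOp_eq, smul_eq_mul]
  simp only [mul_left_comm _ c, integral_const_mul]

lemma isoNorm_add_le {P : Params ds du} {Γ : Set (Space ds du)}
    (hΓ : IsFakeStableLeaf P.r P.cones.plus P.CF Γ) {f g : Space ds du → ℂ} (hf : Decays f)
    (hg : Decays g) :
    isoNorm P.χ P.p P.s Γ (f + g) ≤ isoNorm P.χ P.p P.s Γ f + isoNorm P.χ P.p P.s Γ g := by
  refine iSup_le fun l => ?_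
  rw [leafOp_add P.χ hΓ hf hg]
  refine (mul_le_mul_right (eLpNorm_add_le
    (hf.continuous_leafOp P.χ hΓ l).aestronglyMeasurable
    (hg.continuous_leafOp P.χ hΓ l).aestronglyMeasurable P.one_le_p) _).trans ?_
  rw [mul_add]
  exact add_le_add (le_iSup (fun l : ℕ => ENNReal.ofReal ((2 : ℝ) ^ ((l : ℝ) * P.s)) *
      eLpNorm (P.χ.leafOp Γ l f) P.p (leafVolume Γ)) l)
    (le_iSup (fun l : ℕ => ENNReal.ofReal ((2 : ℝ) ^ ((l : ℝ) * P.s)) *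
      eLpNorm (P.χ.leafOp Γ l g) P.p (leafVolume Γ)) l)

lemma isoNorm_smul (χ : Cutoff) (p : ℝ≥0∞) (s : ℝ) (Γ : Set (Space ds du)) (c : ℂ)
    (f : Space ds du → ℂ) : isoNorm χ p s Γ (c • f) = ‖c‖ₑ * isoNorm χ p s Γ f := by
  simp only [isoNorm, leafOp_smul, eLpNorm_const_smul, ENNReal.mul_iSup]
  exact iSup_congr fun l => mul_left_comm _ _ _

/-! The operators `ψ_ℓ^{Op}` on smooth functions with compact support. -/

variable {K : TopologicalSpace.Compacts (Space ds du)}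

lemma integrable_fourierT (φ : 𝓓_{K}(Space ds du, ℂ)) (ξ : Space ds du) :
    Integrable fun y => Complex.exp (-Complex.I * (inner ℝ y ξ : ℝ)) * φ y := by
  refine Continuous.integrable_of_hasCompactSupport ?_ (φ.hasCompactSupport.mul_left)
  have := φ.continuous
  fun_prop

/-- The function `ψ_ℓ · 𝔽 φ` as a Schwartz function. -/
lemma exists_schwartz (χ : Cutoff) (l : ℕ) (φ : 𝓓_{K}(Space ds du, ℂ)) :
    ∃ g : SchwartzMap (Space ds du) ℂ,
      ∀ ξ, g ξ = (χ.dyadic l ξ : ℂ) * fourierT φ ξ := by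
  let Φ : SchwartzMap (Space ds du) ℂ := φ.hasCompactSupport.toSchwartzMap φ.contDiff
  have hF : ∀ ξ : Space ds du, fourierT φ ξ =
      FourierTransform.fourier Φ ((2 * Real.pi)⁻¹ • ξ) := by
    intro ξ
    rw [SchwartzMap.fourier_coe, Real.fourier_eq', fourierT]
    congr 1
    ext y
    rw [smul_eq_mul]
    congr 2
    rw [inner_smul_right]
    have : (Real.pi : ℂ) ≠ 0 := by exact_mod_cast Real.pi_ne_zero
    push_cast
    field_simp
  have hsmooth : ContDiff ℝ ∞ fun ξ : Space ds du => (χ.dyadic l ξ : ℂ) * fourierT φ ξ := by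
    simp only [hF]
    refine (Complex.ofRealCLM.contDiff.comp (χ.contDiff_dyadic l)).mul ?_
    exact ((FourierTransform.fourier Φ).smooth ⊤).comp (contDiff_id.const_smul _)
  have hsupp : HasCompactSupport fun ξ : Space ds du => (χ.dyadic l ξ : ℂ) * fourierT φ ξ :=
    ((χ.hasCompactSupport_dyadic l).comp_left (g := fun x : ℝ => (x : ℂ)) (by simp)).mul_right
  exact ⟨hsupp.toSchwartzMap hsmooth, fun ξ => rfl⟩

lemma integrable_op (χ : Cutoff) (l : ℕ) (φ : 𝓓_{K}(Space ds du, ℂ)) (x : Space ds du) :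
    Integrable fun ξ => Complex.exp (Complex.I * (inner ℝ x ξ : ℝ)) *
      ((χ.dyadic l ξ : ℂ) * fourierT φ ξ) := by
  obtain ⟨g, hg⟩ := exists_schwartz χ l φ
  simp only [← hg]
  refine g.integrable.bdd_mul (c := 1) ?_ ?_
  · exact Continuous.aestronglyMeasurable (by fun_prop)
  · exact .of_forall fun ξ => (norm_exp_I_mul _).le

lemma decays_op (χ : Cutoff) (l : ℕ) (φ : 𝓓_{K}(Space ds du, ℂ)) : Decays (χ.op l φ) := by
  obtain ⟨g, hg⟩ := exists_schwartz χ l φ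
  let h : SchwartzMap (Space ds du) ℂ := FourierTransformInv.fourierInv g
  let a : ℂ := ((2 * Real.pi : ℝ) ^ Fintype.card (Fin ds ⊕ Fin du) : ℂ)⁻¹
  have hop : χ.op l φ = fun x => a * h ((2 * Real.pi)⁻¹ • x) := by
    ext x
    simp only [Cutoff.op, fourierTInv, h, a, SchwartzMap.fourierInv_coe, Real.fourierInv_eq',
      ← hg, smul_eq_mul]
    congr 2
    ext ξ
    congr 2
    rw [inner_smul_right, real_inner_comm]
    have : (Real.pi : ℂ) ≠ 0 := by exact_mod_cast Real.pi_ne_zero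
    push_cast
    field_simp
  rw [hop]
  refine ⟨continuous_const.mul (h.continuous.comp (continuous_const_smul _)), ?_⟩
  obtain ⟨C, hC⟩ : ∃ C : ℝ, ∀ x, (1 + ‖x‖) ^ (ds + 1) * ‖h x‖ ≤ C :=
    ⟨_, fun x => by
      simpa using SchwartzMap.one_add_le_sup_seminorm_apply (𝕜 := ℂ) (m := (ds + 1, 0))
        (k := ds + 1) (n := 0) le_rfl le_rfl h x⟩
  refine ⟨‖a‖ * (C * (2 * Real.pi) ^ (ds + 1)), fun x => ?_⟩
  have hpi : 1 ≤ 2 * Real.pi := by linarith [Real.pi_gt_three]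
  have hpi0 : 0 < 2 * Real.pi := by linarith
  set y := (2 * Real.pi)⁻¹ • x with hy
  have hxy : 1 + ‖x‖ ≤ 2 * Real.pi * (1 + ‖y‖) := by
    have : ‖x‖ = 2 * Real.pi * ‖y‖ := by
      rw [hy, norm_smul, norm_inv, Real.norm_of_nonneg hpi0.le]
      field_simp
    rw [this]; linarith
  have hkey : ‖h y‖ ≤ C * (2 * Real.pi) ^ (ds + 1) * (1 + ‖x‖) ^ (-((ds : ℝ) + 1)) := by
    have hpos : (0 : ℝ) < 1 + ‖x‖ := by positivity
    have hr : (1 + ‖x‖) ^ (-((ds : ℝ) + 1)) = ((1 + ‖x‖) ^ (ds + 1))⁻¹ := by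
      rw [Real.rpow_neg hpos.le, ← Real.rpow_natCast]; push_cast; rfl
    rw [hr, ← div_eq_mul_inv, le_div_iff₀ (by positivity)]
    calc ‖h y‖ * (1 + ‖x‖) ^ (ds + 1)
        ≤ ‖h y‖ * (2 * Real.pi * (1 + ‖y‖)) ^ (ds + 1) := by gcongr
      _ = ((1 + ‖y‖) ^ (ds + 1) * ‖h y‖) * (2 * Real.pi) ^ (ds + 1) := by rw [mul_pow]; ring
      _ ≤ C * (2 * Real.pi) ^ (ds + 1) := by gcongr; exact hC y
  rw [norm_mul, mul_assoc]
  gcongr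

lemma op_add (χ : Cutoff) (l : ℕ) (φ ψ : 𝓓_{K}(Space ds du, ℂ)) :
    χ.op l (φ + ψ : 𝓓_{K}(Space ds du, ℂ)) = χ.op l φ + χ.op l ψ := by
  ext x
  have hF : ∀ ξ, fourierT (φ + ψ : 𝓓_{K}(Space ds du, ℂ)) ξ = fourierT φ ξ + fourierT ψ ξ := by
    intro ξ
    rw [fourierT, fourierT, fourierT,
      ← integral_add (integrable_fourierT φ ξ) (integrable_fourierT ψ ξ)]
    simp [mul_add]
  simp only [Cutoff.op, fourierTInv, Pi.add_apply, hF, mul_add]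
  rw [← mul_add, ← integral_add]
  · exact integrable_op χ l φ x
  · exact integrable_op χ l ψ x

lemma op_smul (χ : Cutoff) (l : ℕ) (c : ℂ) (φ : 𝓓_{K}(Space ds du, ℂ)) :
    χ.op l (c • φ : 𝓓_{K}(Space ds du, ℂ)) = c • χ.op l φ := by
  ext x
  have hF : ∀ ξ, fourierT (c • φ : 𝓓_{K}(Space ds du, ℂ)) ξ = c * fourierT φ ξ := by
    intro ξ
    rw [fourierT, fourierT, ← integral_const_mul]
    simp [mul_left_comm]
  simp only [Cutoff.op, fourierTInv, Pi.smul_apply, hF, smul_eq_mul]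
  simp only [mul_left_comm _ c, integral_const_mul]

lemma Params.uNorm_add_le (P : Params ds du) (φ ψ : 𝓓_{K}(Space ds du, ℂ)) :
    P.uNorm (φ + ψ : 𝓓_{K}(Space ds du, ℂ)) ≤ P.uNorm φ + P.uNorm ψ := by
  refine iSup_le fun Γ => iSup_le fun hΓ => iSup_le fun l => ?_
  rw [op_add]
  refine (mul_le_mul_right (isoNorm_add_le hΓ (decays_op P.χ l φ) (decays_op P.χ l ψ)) _).trans ?_
  rw [mul_add]
  refine add_le_add ?_ ?_
  · exact le_iSup_of_le Γ (le_iSup_of_le hΓ (le_iSup_of_le l le_rfl))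
  · exact le_iSup_of_le Γ (le_iSup_of_le hΓ (le_iSup_of_le l le_rfl))

lemma Params.uNorm_smul (P : Params ds du) (c : ℂ) (φ : 𝓓_{K}(Space ds du, ℂ)) :
    P.uNorm (c • φ : 𝓓_{K}(Space ds du, ℂ)) = ‖c‖ₑ * P.uNorm φ := by
  simp only [Params.uNorm, op_smul, isoNorm_smul, ENNReal.mul_iSup]
  exact iSup_congr fun Γ => iSup_congr fun hΓ => iSup_congr fun l => mul_left_comm _ _ _

/-! ### The space `U_p^{t,s}(K)` -/

variable (K) in
/-- The complex vector space of the `φ ∈ C^∞(K)` with `‖φ‖_U < ∞`. (When `s < -t < 0` it is all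
of `C^∞(K)`; this is part of what the theorem claims.) -/
def Params.finiteSubmodule (P : Params ds du) : Submodule ℂ 𝓓_{K}(Space ds du, ℂ) where
  carrier := {φ | P.uNorm φ < ⊤}
  zero_mem' := by
    have := P.uNorm_smul 0 (0 : 𝓓_{K}(Space ds du, ℂ))
    simp only [zero_smul, enorm_zero, zero_mul] at this
    change P.uNorm (0 : 𝓓_{K}(Space ds du, ℂ)) < ⊤
    rw [this]
    exact ENNReal.zero_lt_top
  add_mem' := fun {φ ψ} hφ hψ =>
    (P.uNorm_add_le φ ψ).trans_lt (ENNReal.add_lt_top.mpr ⟨hφ, hψ⟩)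
  smul_mem' := fun c φ hφ => by
    simp only [Set.mem_ofPred_eq, P.uNorm_smul]
    exact ENNReal.mul_lt_top enorm_lt_top hφ

variable (K) in
/-- `C^∞(K)`, to be endowed with the norm `‖·‖_U` instead of its usual topology. -/
def Params.SmoothSpace (P : Params ds du) : Type := P.finiteSubmodule K

instance (P : Params ds du) : AddCommGroup (P.SmoothSpace K) :=
  inferInstanceAs (AddCommGroup (P.finiteSubmodule K))

instance (P : Params ds du) : Module ℂ (P.SmoothSpace K) :=
  inferInstanceAs (Module ℂ (P.finiteSubmodule K))

/-- An element of `C^∞(K)` with finite norm as an element of the normed space. -/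
def Params.toSmooth (P : Params ds du) (φ : 𝓓_{K}(Space ds du, ℂ)) (hφ : P.uNorm φ < ⊤) :
    P.SmoothSpace K := ⟨φ, hφ⟩

variable (K) in
/-- The norm `‖·‖_U` on `C^∞(K)`. -/
def Params.uSeminorm (P : Params ds du) : Seminorm ℂ (P.SmoothSpace K) :=
  Seminorm.of (fun φ => (P.uNorm (φ.1 : 𝓓_{K}(Space ds du, ℂ))).toReal)
    (fun φ ψ => by
      refine (ENNReal.toReal_mono ?_ (P.uNorm_add_le φ.1 ψ.1)).trans ?_
      · exact (ENNReal.add_lt_top.mpr ⟨φ.2, ψ.2⟩).ne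
      · exact (ENNReal.toReal_add φ.2.ne ψ.2.ne).le)
    (fun c φ => by
      have := P.uNorm_smul c φ.1
      refine (congrArg ENNReal.toReal this).trans ?_
      rw [ENNReal.toReal_mul, toReal_enorm])

instance (P : Params ds du) : SeminormedAddCommGroup (P.SmoothSpace K) :=
  (P.uSeminorm K).toSeminormedAddCommGroup

instance (P : Params ds du) : NormedSpace ℂ (P.SmoothSpace K) where
  norm_smul_le c φ := (map_smul_eq_mul (P.uSeminorm K) c φ).le

variable (K) in
/-- The Banach space `U_p^{t,s}(K)`: the completion of `C^∞(K)` for `‖·‖_U`. -/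
abbrev Params.USpace (P : Params ds du) : Type := UniformSpace.Completion (P.SmoothSpace K)

/-! ### Distributions of real order -/

/-- A (complex) distribution `T` on `ℝ^d` is of order `u` (`u ≥ 0` real) if on test functions
supported in any fixed compact set it is bounded by a multiple of the `C^u` norm. -/
def HasOrder (u : ℝ) (T : 𝓓'((⊤ : TopologicalSpace.Opens (Space ds du)), ℂ)) : Prop :=
  ∀ L : TopologicalSpace.Compacts (Space ds du), ∃ C : ℝ≥0,
    ∀ v : 𝓓((⊤ : TopologicalSpace.Opens (Space ds du)), ℝ), tsupport v ⊆ L →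
      ‖T v‖ₑ ≤ C * cNorm u v

variable (K) in
/-- The distributions of order `u` on `ℝ^d` supported on `K`. -/
def distributionsOfOrder (u : ℝ) : Set 𝓓'((⊤ : TopologicalSpace.Opens (Space ds du)), ℂ) :=
  {T | HasOrder u T ∧ dsupport T ⊆ (K : Set (Space ds du))}

end AnisotropicLeaf

end

open MeasureTheory Distribution
open scoped ENNReal NNReal ContDiff Distributions

noncomputable section

set_option linter.unusedSectionVars false

namespace AnisotropicLeaf

open FourierTransform SchwartzMap

/-! Upper bound. The block `ψ_l^{Op} φ` is a convolution with a rescaled Schwartz kernel whose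
moments all vanish when `l ≥ 1`. Subtracting a Taylor polynomial of `φ` under the integral is
therefore free, and a `C^u` function has blocks of size `2^{-lu}`, with any polynomial decay in
space because `φ` lives on a fixed compact set (`norm_dilated_convolution_le`,
`norm_multiplier_weighted_le`). The cone condition on secants makes `π_Γ⁻¹` Lipschitz uniformly over
all leaves, so that leaf volumes project to measures dominated by a fixed multiple of Lebesgue
measure. The kernels of the leaf operators are uniformly integrable against polynomial weights, so
these operators preserve the decay (`Params.eLpNorm_leafOp_le`). As `s < 0`, the supremum over leaf
frequencies costs nothing, and `2^{lt} 2^{-lu} ≤ 1` ends the estimate.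

Pairing. Among the leaves are the affine subspaces normal to a fixed `du`-dimensional `W` in `C₊`
(`Params.isFakeStableLeaf_flatLeaf`). On them the leaf operators are true Fourier multipliers. A
block of ambient frequency `2^l` has leaf frequencies at most a constant times `2^l`, so summing the
leaf operators up to that level restores the block itself; as `s < 0` the sum of `2^{-lt - l's}` is
dominated by its last term, and the block has `L_p` norm at most a constant times `2^{-l(t+s)} ‖φ‖`
on every such leaf (`Params.eLpNorm_op_flatLeaf_le`). Averaging over parallel leaves turns this into
a bound on the integral over `ℝ^d` against a rapidly decaying function (`lintegral_mul_le_of_ball`).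
In the pairing with a test function, only the frequencies of the test function near `2^l` matter,
and these contribute `2^{-lu}`. The sum over `l` converges since `t + s + u > 0`
(`Params.norm_integral_mul_le`).

Embedding. The pairing extends by density to the completion. For injectivity, suppose that smooth
`φ_n` converge to an element with zero image. Each value `ψ_l^{Op} φ_n(y)` is a pairing with a
smooth kernel, hence tends to `0`; by dominated convergence so do the leaf operators applied to
these blocks. Fatou's lemma in `L_p`, applied to `φ_n - φ_m` as `m → ∞`, gives `‖φ_n‖ ≤ ε` from the
Cauchy property (`Params.norm_le_of_tendsto_zero`), so the limit is `0`. -/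

/-! ### Hölder bounds -/

section HolderBounds

variable {E F : Type*} [NormedAddCommGroup E] [NormedSpace ℝ E]
  [NormedAddCommGroup F] [NormedSpace ℝ F]

/-- `f` is smooth, its derivatives of order at most `m` are bounded by `M`, and the derivative of
order `m` is Hölder continuous of exponent `α` with constant `M`. -/
structure HolderBound (m : ℕ) (α M : ℝ) (f : E → F) : Prop where
  contDiff : ContDiff ℝ ∞ f
  norm_le : ∀ j ≤ m, ∀ x, ‖iteratedFDeriv ℝ j f x‖ ≤ M
  holder : ∀ x y, ‖iteratedFDeriv ℝ m f x - iteratedFDeriv ℝ m f y‖ ≤ M * ‖x - y‖ ^ α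

lemma HolderBound.nonneg {m : ℕ} {α M : ℝ} {f : E → F} (hf : HolderBound m α M f) : 0 ≤ M :=
  (norm_nonneg _).trans (hf.norm_le 0 (Nat.zero_le _) 0)

lemma HolderBound.norm_apply_le {m : ℕ} {α M : ℝ} {f : E → F} (hf : HolderBound m α M f) (x : E) :
    ‖f x‖ ≤ M := by
  simpa using hf.norm_le 0 (Nat.zero_le _) x

lemma norm_iteratedFDeriv_sub_le {f : E → F} (hf : ContDiff ℝ ∞ f) (j : ℕ) {B : ℝ}
    (hB : ∀ x, ‖iteratedFDeriv ℝ (j + 1) f x‖ ≤ B) (x y : E) :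
    ‖iteratedFDeriv ℝ j f x - iteratedFDeriv ℝ j f y‖ ≤ B * ‖x - y‖ := by
  refine convex_univ.norm_image_sub_le_of_norm_fderiv_le (𝕜 := ℝ) (f := iteratedFDeriv ℝ j f)
    (fun z _ => ?_) (fun z _ => ?_) (Set.mem_univ y) (Set.mem_univ x)
  · exact (hf.differentiable_iteratedFDeriv (by exact_mod_cast ENat.natCast_lt_top j)) z
  · rw [norm_fderiv_iteratedFDeriv]; exact hB z

/-- Interpolation: for `r ≤ 1` the Lipschitz bound suffices because `r ≤ r ^ α`, for `r ≥ 1` the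
crude bound does because `1 ≤ r ^ α`. -/
lemma le_two_mul_rpow {a B r α : ℝ} (hα : 0 < α) (hα1 : α ≤ 1) (hr : 0 ≤ r) (h1 : a ≤ 2 * B)
    (h2 : a ≤ B * r) (hB : 0 ≤ B) : a ≤ 2 * B * r ^ α := by
  rcases le_total r 1 with h | h
  · refine h2.trans ?_
    have : r ≤ r ^ α := by
      simpa using Real.rpow_le_rpow_of_exponent_ge_of_imp hr h hα1 (by intro _ h; linarith)
    nlinarith [mul_nonneg hB (Real.rpow_nonneg hr α), mul_le_mul_of_nonneg_left this hB]
  · refine h1.trans (le_mul_of_one_le_right (by linarith) (Real.one_le_rpow h hα.le))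

lemma holderBound_of_bounded {m : ℕ} {α B : ℝ} (hα : 0 < α) (hα1 : α ≤ 1) {f : E → F}
    (hf : ContDiff ℝ ∞ f) (hB : ∀ j ≤ m + 1, ∀ x, ‖iteratedFDeriv ℝ j f x‖ ≤ B) :
    HolderBound m α (2 * B) f := by
  have hB0 : 0 ≤ B := (norm_nonneg _).trans (hB 0 (Nat.zero_le _) 0)
  refine ⟨hf, fun j hj x => (hB j (by omega) x).trans (by linarith), fun x y => ?_⟩
  refine le_two_mul_rpow hα hα1 (norm_nonneg _) ?_
    (norm_iteratedFDeriv_sub_le hf m (hB (m + 1) le_rfl) x y) hB0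
  refine (norm_sub_le _ _).trans ?_
  linarith [hB m (by omega) x, hB m (by omega) y]

/-- Below the top order, boundedness of the next derivative replaces the Hölder condition. Leibniz's
rule for products needs the estimate at every order up to `m`. -/
lemma HolderBound.norm_sub_le {m : ℕ} {α M : ℝ} (hα : 0 < α) (hα1 : α ≤ 1) {f : E → F}
    (hf : HolderBound m α M f) {j : ℕ} (hj : j ≤ m) (x y : E) :
    ‖iteratedFDeriv ℝ j f x - iteratedFDeriv ℝ j f y‖ ≤ 2 * M * ‖x - y‖ ^ α := by
  have h0 := hf.nonneg
  rcases hj.eq_or_lt with rfl | hj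
  · refine (hf.holder x y).trans ?_
    nlinarith [mul_nonneg h0 (Real.rpow_nonneg (norm_nonneg (x - y)) α)]
  · refine le_two_mul_rpow hα hα1 (norm_nonneg _) ?_
      (norm_iteratedFDeriv_sub_le hf.contDiff j (hf.norm_le (j + 1) hj) x y) h0
    refine (_root_.norm_sub_le _ _).trans ?_
    linarith [hf.norm_le j hj.le x, hf.norm_le j hj.le y]

/-- Rewrites a difference of derivatives at two points as the derivative of a single function, to
which Leibniz's rule applies. -/
lemma iteratedFDeriv_sub_translate {f : E → F} (hf : ContDiff ℝ ∞ f) (j : ℕ) (a x : E) :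
    iteratedFDeriv ℝ j (fun z => f z - f (z + a)) x =
      iteratedFDeriv ℝ j f x - iteratedFDeriv ℝ j f (x + a) := by
  have h2 : ContDiff ℝ ∞ fun z => f (z + a) := hf.comp (contDiff_id.add contDiff_const)
  rw [← iteratedFDeriv_comp_add_right j a x]
  exact fun_iteratedFDeriv_sub_apply (hf.of_le (by exact_mod_cast le_top)).contDiffAt
    (h2.of_le (by exact_mod_cast le_top)).contDiffAt

lemma HolderBound.mul {m : ℕ} {α M B : ℝ} (hα : 0 < α) (hα1 : α ≤ 1) {f θ : E → ℂ}
    (hf : HolderBound m α M f) (hθ : ContDiff ℝ ∞ θ)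
    (hB : ∀ j ≤ m + 1, ∀ x, ‖iteratedFDeriv ℝ j θ x‖ ≤ B) :
    HolderBound m α (4 * 2 ^ m * B * M) fun x => θ x * f x := by
  have hB0 : 0 ≤ B := (norm_nonneg _).trans (hB 0 (Nat.zero_le _) 0)
  have hM0 := hf.nonneg
  have hθ' := holderBound_of_bounded hα hα1 hθ hB
  have hsum : ∀ (n : ℕ) (c : ℝ), ∑ i ∈ Finset.range (n + 1), (n.choose i : ℝ) * c = 2 ^ n * c := by
    intro n c
    rw [← Finset.sum_mul, ← Nat.cast_sum, Nat.sum_range_choose]; push_cast; rfl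
  have hmul : ∀ {g h : E → ℂ} (_ : ContDiff ℝ ∞ g) (_ : ContDiff ℝ ∞ h) (n : ℕ) (x : E) (a b : ℝ)
      (_ : 0 ≤ a) (_ : ∀ j ≤ n, ‖iteratedFDeriv ℝ j g x‖ ≤ a)
      (_ : ∀ j ≤ n, ‖iteratedFDeriv ℝ j h x‖ ≤ b),
      ‖iteratedFDeriv ℝ n (fun z => g z * h z) x‖ ≤ 2 ^ n * (a * b) := by
    intro g h hg hh n x a b ha h1 h2
    refine (norm_iteratedFDeriv_mul_le hg hh x (n := n) (by exact_mod_cast le_top)).trans ?_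
    rw [← hsum]
    refine Finset.sum_le_sum fun i hi => ?_
    have hi' : i ≤ n := by simpa [Nat.lt_succ_iff] using hi
    rw [mul_assoc]
    gcongr
    · exact h1 i hi'
    · exact h2 _ (by omega)
  refine ⟨hθ.mul hf.contDiff, fun j hj x => ?_, fun x y => ?_⟩
  · refine (hmul hθ hf.contDiff j x B M hB0 (fun i hi => hB i (by omega) x)
      (fun i hi => hf.norm_le i (by omega) x)).trans ?_
    have h2 : (2 : ℝ) ^ j ≤ 2 ^ m := pow_le_pow_right₀ (by norm_num) hj
    have h3 : 0 ≤ B * M := mul_nonneg hB0 hM0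
    have h4 : (0 : ℝ) ≤ 2 ^ m := by positivity
    nlinarith [mul_le_mul_of_nonneg_right h2 h3, mul_nonneg h4 h3]
  · have htr : ∀ {g : E → ℂ} (_ : ContDiff ℝ ∞ g) (a : E), ContDiff ℝ ∞ fun z => g (z + a) :=
      fun hg a => hg.comp (contDiff_id.add contDiff_const)
    set a := y - x with ha
    have hy : y = x + a := by rw [ha]; abel
    rw [hy, ← iteratedFDeriv_sub_translate (hθ.mul hf.contDiff)]
    -- Discrete product rule: in each of the two terms one factor is a difference and carries `‖a‖ ^
    -- α`. Each term contributes `2 ^ m * (2 * B * M)`, whence the constant `4 * 2 ^ m * B * M`.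
    have hsplit : (fun z => θ z * f z - θ (z + a) * f (z + a)) =
        fun z => (θ z - θ (z + a)) * f z + θ (z + a) * (f z - f (z + a)) := by
      ext z; ring
    rw [hsplit, fun_iteratedFDeriv_add_apply
      (((hθ.sub (htr hθ a)).mul hf.contDiff).of_le (by exact_mod_cast le_top)).contDiffAt
      (((htr hθ a).mul (hf.contDiff.sub (htr hf.contDiff a))).of_le
        (by exact_mod_cast le_top)).contDiffAt]
    have hra : ‖x - (x + a)‖ = ‖a‖ := by rw [← norm_neg]; congr 1; abel
    rw [hra]
    have hr : 0 ≤ ‖a‖ ^ α := Real.rpow_nonneg (norm_nonneg _) _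
    refine (norm_add_le _ _).trans ?_
    have h1 := hmul (hθ.sub (htr hθ a)) hf.contDiff m x (2 * B * ‖a‖ ^ α) M (by positivity)
      (fun j hj => by
        rw [iteratedFDeriv_sub_translate hθ]
        refine (le_two_mul_rpow hα hα1 (norm_nonneg _) ?_
          (norm_iteratedFDeriv_sub_le hθ j (hB (j + 1) (by omega)) x _) hB0).trans (by rw [hra])
        exact (_root_.norm_sub_le _ _).trans (by linarith [hB j (by omega) x, hB j (by omega) (x + a)]))
      (fun j hj => hf.norm_le j hj x)
    have h2 := hmul (htr hθ a) (hf.contDiff.sub (htr hf.contDiff a)) m x B (2 * M * ‖a‖ ^ α) hB0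
      (fun j hj => by rw [iteratedFDeriv_comp_add_right]; exact hB j (by omega) _)
      (fun j hj => by
        rw [iteratedFDeriv_sub_translate hf.contDiff]
        exact (hf.norm_sub_le hα hα1 hj x _).trans (by rw [hra]))
    refine (add_le_add h1 h2).trans (le_of_eq ?_)
    ring

/-! ### Comparison of the `C^u` norm with Hölder bounds -/

lemma enorm_iteratedFDeriv_le_cNorm {u : ℝ} (f : E → F) {j : ℕ} (hj : j ≤ ⌊u⌋₊) (x : E) :
    ‖iteratedFDeriv ℝ j f x‖ₑ ≤ cNorm u f := by
  unfold cNorm derivNorm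
  refine le_trans ?_ le_self_add
  refine le_trans ?_ (Finset.single_le_sum (f := fun k => ⨆ x ∈ Set.univ, ‖iteratedFDeriv ℝ k f x‖ₑ)
    (fun _ _ => zero_le) (Finset.mem_Icc.mpr ⟨Nat.zero_le j, hj⟩))
  exact le_iSup₂_of_le x (Set.mem_univ x) le_rfl

lemma norm_iteratedFDeriv_le_cNorm {u : ℝ} (f : E → F) (hf : cNorm u f ≠ ⊤) {j : ℕ}
    (hj : j ≤ ⌊u⌋₊) (x : E) : ‖iteratedFDeriv ℝ j f x‖ ≤ (cNorm u f).toReal := by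
  have := ENNReal.toReal_mono hf (enorm_iteratedFDeriv_le_cNorm f hj x)
  simpa using this

/-- Splits `u = m + α` with `m = ⌈u⌉ - 1` and `0 < α ≤ 1`. For integer `u` this means `α = 1`: the
bound on the derivative of order `u` is read as a Lipschitz condition one order lower, so integer
and fractional orders need no separate treatment later. -/
lemma holderBound_of_cNorm_ne_top {u : ℝ} (hu : 0 < u) {f : E → F} (hf : ContDiff ℝ ∞ f)
    (h : cNorm u f ≠ ⊤) :
    HolderBound (⌈u⌉₊ - 1) (u - (⌈u⌉₊ - 1 : ℕ)) (cNorm u f).toReal f := by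
  have hle : ⌈u⌉₊ - 1 ≤ ⌊u⌋₊ := by
    have := Nat.ceil_le_floor_add_one u
    omega
  refine ⟨hf, fun j hj x => norm_iteratedFDeriv_le_cNorm f h (hj.trans hle) x, fun x y => ?_⟩
  by_cases hint : (⌊u⌋₊ : ℝ) = u
  · have hc : ⌈u⌉₊ = ⌊u⌋₊ := by
      conv_lhs => rw [← hint]
      exact Nat.ceil_natCast _
    have h1 : 1 ≤ ⌊u⌋₊ := by
      have : (0 : ℝ) < ⌊u⌋₊ := by rw [hint]; exact hu
      exact_mod_cast this
    have h2 : u - (⌈u⌉₊ - 1 : ℕ) = 1 := by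
      rw [hc]
      push_cast [h1]
      linarith
    rw [h2, Real.rpow_one]
    refine norm_iteratedFDeriv_sub_le hf _ (fun z => norm_iteratedFDeriv_le_cNorm f h ?_ z) x y
    omega
  · have hc : ⌈u⌉₊ - 1 = ⌊u⌋₊ := by
      have h3 : ⌊u⌋₊ < ⌈u⌉₊ := by
        rw [Nat.lt_ceil]
        exact lt_of_le_of_ne (Nat.floor_le hu.le) hint
      omega
    rw [hc]
    rcases eq_or_ne x y with rfl | hxy
    · rw [sub_self, norm_zero]
      exact mul_nonneg ENNReal.toReal_nonneg (Real.rpow_nonneg (norm_nonneg _) _)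
    have hpos : 0 < ‖x - y‖ ^ (u - ⌊u⌋₊) :=
      Real.rpow_pos_of_pos (norm_pos_iff.mpr (sub_ne_zero.mpr hxy)) _
    have h4 : ‖iteratedFDeriv ℝ ⌊u⌋₊ f x - iteratedFDeriv ℝ ⌊u⌋₊ f y‖ₑ /
          ENNReal.ofReal (‖x - y‖ ^ (u - ⌊u⌋₊)) ≤ cNorm u f := by
      unfold cNorm derivNorm
      rw [if_neg hint]
      refine le_trans ?_ le_add_self
      exact le_iSup₂_of_le x (Set.mem_univ x) (le_iSup₂_of_le y (Set.mem_univ y)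
        (le_iSup_of_le hxy le_rfl))
    have h5 := ENNReal.toReal_mono h h4
    rw [ENNReal.toReal_div, ENNReal.toReal_ofReal hpos.le, toReal_enorm,
      div_le_iff₀ hpos] at h5
    exact h5

lemma cNorm_le_of_bounded {u B : ℝ} (hu : 0 ≤ u) {f : E → F} (hf : ContDiff ℝ ∞ f)
    (hB : ∀ j ≤ ⌊u⌋₊ + 1, ∀ x, ‖iteratedFDeriv ℝ j f x‖ ≤ B) :
    cNorm u f ≤ ENNReal.ofReal ((⌊u⌋₊ + 3) * B) := by
  have hB0 : 0 ≤ B := (norm_nonneg _).trans (hB 0 (Nat.zero_le _) 0)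
  -- There are `⌊u⌋ + 1` suprema, each at most `B`; the Hölder seminorm, bounded through one extra
  -- derivative, accounts for `2 * B`.
  have he : ((⌊u⌋₊ : ℝ) + 3) * B = (⌊u⌋₊ + 1) * B + 2 * B := by ring
  rw [he, ENNReal.ofReal_add (by positivity) (by positivity)]
  refine add_le_add ?_ ?_
  · calc _ ≤ ∑ k ∈ Finset.Icc 0 ⌊u⌋₊, ENNReal.ofReal B := by
          refine Finset.sum_le_sum fun k hk => iSup₂_le fun x _ => ?_
          rw [← ofReal_norm]
          exact ENNReal.ofReal_le_ofReal (hB k (by have := (Finset.mem_Icc.mp hk).2; omega) x)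
      _ = _ := by
          rw [Finset.sum_const, nsmul_eq_mul, ENNReal.ofReal_mul (by positivity)]
          congr 1
          rw [Nat.card_Icc, ← ENNReal.ofReal_natCast]
          push_cast; simp
  · split_ifs with hint
    · exact zero_le
    · refine iSup₂_le fun x _ => iSup₂_le fun y _ => iSup_le fun hxy => ?_
      have hpos : 0 < ‖x - y‖ ^ (u - ⌊u⌋₊) :=
        Real.rpow_pos_of_pos (norm_pos_iff.mpr (sub_ne_zero.mpr hxy)) _
      rw [← ofReal_norm, ← ENNReal.ofReal_div_of_pos hpos]
      refine ENNReal.ofReal_le_ofReal ?_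
      rw [div_le_iff₀ hpos]
      have hfl := Nat.floor_le hu
      have hfl' := Nat.lt_floor_add_one u
      exact (holderBound_of_bounded (m := ⌊u⌋₊) (α := u - ⌊u⌋₊)
        (by rcases hfl.lt_or_eq with h | h
            · linarith
            · exact absurd h hint) (by linarith) hf hB).holder x y

lemma exists_bound_iteratedFDeriv {f : E → F} (hf : ContDiff ℝ ∞ f) (hc : HasCompactSupport f)
    (n : ℕ) : ∃ B : ℝ, ∀ j ≤ n, ∀ x, ‖iteratedFDeriv ℝ j f x‖ ≤ B := by
  have h : ∀ j : ℕ, ∃ B : ℝ, ∀ x, ‖iteratedFDeriv ℝ j f x‖ ≤ B := fun j =>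
    (hf.continuous_iteratedFDeriv (by exact_mod_cast le_top)).bounded_above_of_compact_support
      (hc.iteratedFDeriv j)
  choose B hB using h
  refine ⟨∑ j ∈ Finset.range (n + 1), |B j|, fun j hj x => (hB j x).trans ((le_abs_self _).trans ?_)⟩
  exact Finset.single_le_sum (f := fun j => |B j|) (fun _ _ => abs_nonneg _)
    (Finset.mem_range.mpr (by omega))

lemma cNorm_ne_top {u : ℝ} (hu : 0 ≤ u) {f : E → F} (hf : ContDiff ℝ ∞ f)
    (hc : HasCompactSupport f) : cNorm u f ≠ ⊤ := by
  obtain ⟨B, hB⟩ := exists_bound_iteratedFDeriv hf hc (⌊u⌋₊ + 1)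
  exact ((cNorm_le_of_bounded hu hf hB).trans_lt ENNReal.ofReal_lt_top).ne

lemma ceil_sub_one_lt {u : ℝ} (hu : 0 < u) : ((⌈u⌉₊ - 1 : ℕ) : ℝ) < u := by
  have h1 : 1 ≤ ⌈u⌉₊ := Nat.one_le_iff_ne_zero.mpr (by simpa using hu)
  push_cast [h1]
  linarith [Nat.ceil_lt_add_one hu.le]

lemma sub_ceil_sub_one_le (u : ℝ) : u - (⌈u⌉₊ - 1 : ℕ) ≤ 1 := by
  have h1 : (⌈u⌉₊ : ℝ) ≤ ((⌈u⌉₊ - 1 : ℕ) : ℝ) + 1 := by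
    have : ⌈u⌉₊ ≤ ⌈u⌉₊ - 1 + 1 := by omega
    exact_mod_cast this
  linarith [Nat.le_ceil u]

end HolderBounds

/-! ### Taylor's formula with a Hölder remainder -/

section Taylor

variable {E F : Type*} [NormedAddCommGroup E] [NormedSpace ℝ E]
  [NormedAddCommGroup F] [NormedSpace ℝ F]

/-- Induction on `m`: the derivative of the remainder of `γ` is the remainder of `γ'` one order
lower, and the mean value inequality on `[0, 1]` keeps the bound `B`. Only the variation of the
derivative of order `m` enters, which is what a Hölder condition controls. -/
lemma norm_sub_taylor_le (m : ℕ) {γ : ℝ → F} (hγ : ContDiff ℝ ∞ γ) {B : ℝ}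
    (hB : ∀ τ ∈ Set.Icc (0 : ℝ) 1, ‖iteratedDeriv m γ τ - iteratedDeriv m γ 0‖ ≤ B) :
    ∀ τ ∈ Set.Icc (0 : ℝ) 1,
      ‖γ τ - ∑ j ∈ Finset.range (m + 1), (τ ^ j / j.factorial) • iteratedDeriv j γ 0‖ ≤ B := by
  induction m generalizing γ with
  | zero => simpa using hB
  | succ m ih =>
    have hγ' : ContDiff ℝ ∞ (deriv γ) := (contDiff_infty_iff_deriv.mp hγ).2
    have ih' := ih hγ' (by simpa only [iteratedDeriv_succ'] using hB)
    set r : ℝ → F := fun τ =>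
      γ τ - ∑ j ∈ Finset.range (m + 2), (τ ^ j / j.factorial) • iteratedDeriv j γ 0 with hr
    have hderiv : ∀ τ, HasDerivAt r (deriv γ τ - ∑ j ∈ Finset.range (m + 1),
        (τ ^ j / j.factorial) • iteratedDeriv j (deriv γ) 0) τ := by
      intro τ
      refine ((hγ.differentiable (by simp)) τ).hasDerivAt.sub ?_
      have hs : (∑ j ∈ Finset.range (m + 1), (τ ^ j / j.factorial) • iteratedDeriv j (deriv γ) 0) =
          ∑ j ∈ Finset.range (m + 2), ((j : ℝ) * τ ^ (j - 1) / j.factorial) •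
            iteratedDeriv j γ 0 := by
        rw [Finset.sum_range_succ' _ (m + 1)]
        simp only [CharP.cast_eq_zero, zero_mul, zero_div, zero_smul, add_zero]
        refine Finset.sum_congr rfl fun j _ => ?_
        rw [iteratedDeriv_succ', Nat.factorial_succ]
        congr 1
        push_cast
        field_simp
      rw [hs]
      refine HasDerivAt.fun_sum fun j _ => ?_
      exact ((hasDerivAt_pow j τ).div_const _).smul_const _
    intro τ hτ
    have hr0 : r 0 = 0 := by
      simp only [hr]
      rw [Finset.sum_eq_single 0]
      · simp
      · intro j _ hj; simp [hj]
      · simp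
    have hmv := norm_image_sub_le_of_norm_deriv_le_segment' (f := r) (a := 0) (b := 1) (C := B)
      (fun t _ => (hderiv t).hasDerivWithinAt)
      (fun t ht => ih' t ⟨ht.1, ht.2.le⟩) τ hτ
    rw [hr0, sub_zero, sub_zero] at hmv
    have hB0 : 0 ≤ B := (norm_nonneg _).trans (hB 0 ⟨le_rfl, zero_le_one⟩)
    exact hmv.trans (mul_le_of_le_one_right hB0 hτ.2)

lemma iteratedDeriv_comp_line {g : E → F} (hg : ContDiff ℝ ∞ g) (x h : E) (j : ℕ) (τ : ℝ) :
    iteratedDeriv j (fun τ : ℝ => g (x + τ • h)) τ =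
      iteratedFDeriv ℝ j g (x + τ • h) fun _ => h := by
  have h1 : (fun τ : ℝ => g (x + τ • h)) =
      (fun z => g (x + z)) ∘ (ContinuousLinearMap.toSpanSingleton ℝ h) := by
    ext; simp [ContinuousLinearMap.toSpanSingleton_apply]
  have hg' : ContDiff ℝ ∞ fun z => g (x + z) := hg.comp (contDiff_const.add contDiff_id)
  rw [iteratedDeriv_eq_iteratedFDeriv, h1,
    ContinuousLinearMap.iteratedFDeriv_comp_right _ hg' _ (by exact_mod_cast le_top)]
  simp [iteratedFDeriv_comp_add_left]

/-- The remainder of Taylor's formula of order `m` at `x`. -/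
def taylorRem (m : ℕ) (g : E → F) (x h : E) : F :=
  g (x + h) - ∑ j ∈ Finset.range (m + 1), ((j.factorial : ℝ)⁻¹) • iteratedFDeriv ℝ j g x fun _ => h

/-- Restrict to the segment from `x` to `x + h`: the derivative of order `m` in the direction `h`
varies there by at most `M * ‖h‖ ^ α * ‖h‖ ^ m`. -/
lemma HolderBound.norm_taylorRem_le {m : ℕ} {α M : ℝ} (hα : 0 < α) {g : E → F}
    (hg : HolderBound m α M g) (x h : E) : ‖taylorRem m g x h‖ ≤ M * ‖h‖ ^ (m + α) := by
  have hM := hg.nonneg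
  have key := norm_sub_taylor_le m (γ := fun τ : ℝ => g (x + τ • h)) (B := M * ‖h‖ ^ (m + α))
    (hg.contDiff.comp (by fun_prop)) ?_ 1 ⟨zero_le_one, le_rfl⟩
  · simpa [taylorRem, iteratedDeriv_comp_line hg.contDiff] using key
  · intro τ hτ
    rw [iteratedDeriv_comp_line hg.contDiff, iteratedDeriv_comp_line hg.contDiff, zero_smul,
      add_zero, ← sub_apply]
    refine (ContinuousMultilinearMap.le_opNorm _ _).trans ?_
    rw [Finset.prod_const, Finset.card_univ, Fintype.card_fin]
    have h1 := hg.holder (x + τ • h) x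
    rw [add_sub_cancel_left, norm_smul, Real.norm_of_nonneg hτ.1] at h1
    have h2 : (τ * ‖h‖) ^ α ≤ ‖h‖ ^ α :=
      Real.rpow_le_rpow (by have := hτ.1; positivity)
        (mul_le_of_le_one_left (norm_nonneg _) hτ.2) hα.le
    calc _ ≤ M * ‖h‖ ^ α * ‖h‖ ^ m := by
          gcongr
          exact h1.trans (by gcongr)
      _ = M * ‖h‖ ^ (m + α) := by
          rcases eq_or_ne h 0 with rfl | h0
          · rcases Nat.eq_zero_or_pos m with rfl | hm
            · simp
            · rw [norm_zero, Real.zero_rpow hα.ne', Real.zero_rpow (by positivity)]; simp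
          · rw [Real.rpow_add (norm_pos_iff.mpr h0), Real.rpow_natCast]; ring

/-- Both `x` and `x + h` lie outside the support. This is the source of the spatial decay of the
convolutions below. -/
lemma taylorRem_eq_zero {m : ℕ} {g : E → F} {ρ : ℝ}
    (hsupp : tsupport g ⊆ Metric.closedBall 0 ρ) {x h : E} (hx : ρ + ‖h‖ < ‖x‖) :
    taylorRem m g x h = 0 := by
  have h1 : ∀ z : E, ρ < ‖z‖ → z ∉ tsupport g := by
    intro z hz hmem
    have := hsupp hmem
    rw [mem_closedBall_zero_iff] at this
    linarith
  have h2 : g (x + h) = 0 := by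
    refine image_eq_zero_of_notMem_tsupport (h1 _ ?_)
    have := norm_sub_norm_le x (-h)
    rw [norm_neg, sub_neg_eq_add] at this
    linarith
  have h3 : ∀ j : ℕ, iteratedFDeriv ℝ j g x = 0 := fun j =>
    Function.notMem_support.mp fun hmem =>
      h1 x (by linarith [norm_nonneg h]) (support_iteratedFDeriv_subset j hmem)
  simp [taylorRem, h2, h3]

end Taylor

/-! ### Moments and weighted estimates -/

section Weighted

variable {V : Type*} [NormedAddCommGroup V] [InnerProductSpace ℝ V] [FiniteDimensional ℝ V]
  [MeasurableSpace V] [BorelSpace V]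

lemma integrable_one_add_pow_mul (k : 𝓢(V, ℂ)) (n : ℕ) :
    Integrable fun y => (1 + ‖y‖) ^ n * ‖k y‖ := by
  have h := ((k.integrable_pow_mul volume 0).add (k.integrable_pow_mul volume n)).const_mul
    ((2 : ℝ) ^ (n - 1))
  refine h.mono' (Continuous.aestronglyMeasurable (by fun_prop)) (.of_forall fun y => ?_)
  rw [Real.norm_of_nonneg (by positivity)]
  have := add_pow_le (zero_le_one' ℝ) (norm_nonneg y) n
  calc _ ≤ (2 ^ (n - 1) * (1 ^ n + ‖y‖ ^ n)) * ‖k y‖ := by gcongr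
    _ = _ := by simp; ring

lemma integrable_mul_multilinear (k : 𝓢(V, ℂ)) {n : ℕ}
    (Q : ContinuousMultilinearMap ℝ (fun _ : Fin n => V) ℂ) :
    Integrable fun y => k y * Q fun _ => y := by
  refine ((k.integrable_pow_mul volume n).const_mul ‖Q‖).mono'
    (Continuous.aestronglyMeasurable (by fun_prop)) (.of_forall fun y => ?_)
  rw [norm_mul]
  have := Q.le_opNorm fun _ => y
  simp only [Finset.prod_const, Finset.card_univ, Fintype.card_fin] at this
  calc _ ≤ ‖k y‖ * (‖Q‖ * ‖y‖ ^ n) := by gcongr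
    _ = _ := by ring

/-- The moments of `k` are, up to nonzero factors, the derivatives of its Fourier transform at `0`.
A multilinear form on the diagonal is a combination of products of coordinates in an orthonormal
basis, hence of such moments. -/
lemma integral_mul_multilinear_eq_zero {k : 𝓢(V, ℂ)} (hk : 𝓕 (k : V → ℂ) =ᶠ[nhds 0] 0) {n : ℕ}
    (Q : ContinuousMultilinearMap ℝ (fun _ : Fin n => V) ℂ) :
    ∫ y, k y * Q (fun _ => y) = 0 := by
  have hprod : ∀ w : Fin n → V, ∫ y, (∏ i, inner ℝ y (w i) : ℝ) • k y = 0 := by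
    intro w
    have h0 : iteratedFDeriv ℝ n (𝓕 (k : V → ℂ)) 0 = 0 := by
      rw [(Filter.EventuallyEq.iteratedFDeriv ℝ hk n).eq_of_nhds, Pi.zero_def,
        iteratedFDeriv_fun_zero]; rfl
    rw [Real.iteratedFDeriv_fourier (N := ⊤) (fun n _ => k.integrable_pow_mul volume n)
      k.continuous.aestronglyMeasurable (by exact_mod_cast le_top)] at h0
    have h1 := congrArg (fun T => T w) h0
    simp only [Real.fourier_eq, inner_zero_right, neg_zero, AddChar.map_zero_eq_one, one_smul,
      zero_apply] at h1
    rw [ContinuousMultilinearMap.integral_apply] at h1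
    · simp only [VectorFourier.fourierPowSMulRight_apply, integral_smul] at h1
      rw [smul_eq_zero] at h1
      refine h1.resolve_left (pow_ne_zero _ ?_)
      simp [Real.pi_ne_zero]
    · exact VectorFourier.integrable_fourierPowSMulRight (innerSL ℝ)
        (k.integrable_pow_mul volume n) k.continuous.aestronglyMeasurable
  let b := stdOrthonormalBasis ℝ V
  have hQ : ∀ y : V, k y * Q (fun _ => y) = ∑ r : Fin n → Fin (Module.finrank ℝ V),
      ((∏ i, inner ℝ y (b (r i)) : ℝ) • k y) * Q fun i => b (r i) := by
    intro y
    have hy : (fun _ : Fin n => y) = fun _ => ∑ j, inner ℝ y (b j) • b j := by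
      ext1 _
      conv_lhs => rw [← b.sum_repr' y]
      simp only [real_inner_comm]
    rw [hy, ContinuousMultilinearMap.map_sum, Finset.mul_sum]
    refine Finset.sum_congr rfl fun r _ => ?_
    rw [Q.map_smul_univ (fun i => inner ℝ y (b (r i))) (fun i => b (r i)), mul_smul_comm,
      smul_mul_assoc]
  simp only [hQ]
  rw [integral_finsetSum]
  · refine Finset.sum_eq_zero fun r _ => ?_
    rw [integral_mul_const, hprod, zero_mul]
  · intro r _
    refine Integrable.mul_const ?_ _
    refine (k.integrable_pow_mul volume n).mono'
      (Continuous.aestronglyMeasurable (by fun_prop)) (.of_forall fun y => ?_)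
    rw [norm_smul, norm_prod]
    gcongr
    refine (Finset.prod_le_prod (fun _ _ => norm_nonneg _) (g := fun _ => ‖y‖) fun i _ => ?_).trans
      (le_of_eq (by simp))
    refine (norm_inner_le_norm _ _).trans ?_
    simp

/-- The integrand vanishes unless `‖x‖ ≤ ρ + ‖y‖`, in which case `1 + ‖x‖ ≤ (1 + ρ) * (1 + ‖y‖)`:
the weight in `x` is traded for a weight in `y`, which the Schwartz function `k` absorbs. -/
lemma norm_integral_mul_weighted_le (k : 𝓢(V, ℂ)) {R : V → ℂ} {x : V} {b ρ : ℝ} {q : ℕ}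
    (hb : 0 ≤ b) (hρ : 0 ≤ ρ) (hR : ∀ y, ‖R y‖ ≤ b * (1 + ‖y‖) ^ q)
    (hzero : ∀ y, ρ + ‖y‖ < ‖x‖ → R y = 0) (N : ℕ) :
    ‖∫ y, k y * R y‖ * (1 + ‖x‖) ^ N ≤
      b * ((1 + ρ) ^ N * ∫ y, (1 + ‖y‖) ^ (q + N) * ‖k y‖) := by
  have hx : (0 : ℝ) < (1 + ‖x‖) ^ N := by positivity
  rw [← le_div_iff₀ hx, mul_div_assoc, mul_div_right_comm, ← integral_const_mul,
    ← integral_const_mul]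
  refine norm_integral_le_of_norm_le
    (((integrable_one_add_pow_mul k (q + N)).const_mul _).const_mul _) (.of_forall fun y => ?_)
  rw [norm_mul]
  by_cases h : ρ + ‖y‖ < ‖x‖
  · rw [hzero y h]
    simp only [norm_zero, mul_zero]
    positivity
  · have h1 : (1 + ‖x‖) ^ N ≤ (1 + ρ) ^ N * (1 + ‖y‖) ^ N := by
      rw [← mul_pow]
      gcongr
      nlinarith [norm_nonneg y, mul_nonneg hρ (norm_nonneg y)]
    have h2 : 1 ≤ (1 + ρ) ^ N / (1 + ‖x‖) ^ N * (1 + ‖y‖) ^ N := by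
      rw [div_mul_eq_mul_div, one_le_div hx]; exact h1
    calc ‖k y‖ * ‖R y‖ ≤ ‖k y‖ * (b * (1 + ‖y‖) ^ q) * 1 := by
          rw [mul_one]
          gcongr
          exact hR y
      _ ≤ ‖k y‖ * (b * (1 + ‖y‖) ^ q) * ((1 + ρ) ^ N / (1 + ‖x‖) ^ N * (1 + ‖y‖) ^ N) := by
          gcongr
      _ = _ := by rw [pow_add]; ring

/-- Convolution with a fixed Schwartz function, on compactly supported functions. -/
lemma norm_convolution_weighted_le (k : 𝓢(V, ℂ)) {ρ : ℝ} (hρ : 0 ≤ ρ) (N : ℕ) :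
    ∃ C : ℝ, 0 ≤ C ∧ ∀ (M : ℝ) (g : V → ℂ), (∀ x, ‖g x‖ ≤ M) →
      tsupport g ⊆ Metric.closedBall 0 ρ → ∀ x,
        ‖∫ y, k y * g (x - y)‖ * (1 + ‖x‖) ^ N ≤ C * M := by
  refine ⟨(1 + ρ) ^ N * ∫ y, (1 + ‖y‖) ^ (0 + N) * ‖k y‖, by positivity, fun M g hg hsupp x => ?_⟩
  rw [mul_comm _ M]
  refine norm_integral_mul_weighted_le k ((norm_nonneg _).trans (hg 0)) hρ
    (fun y => by simpa using hg _) (fun y hy => ?_) N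
  refine image_eq_zero_of_notMem_tsupport fun hmem => ?_
  have h1 := mem_closedBall_zero_iff.mp (hsupp hmem)
  have h2 := norm_sub_norm_le x y
  linarith

/-- Convolution with dilates of a Schwartz function whose Fourier transform vanishes near `0`. -/
lemma norm_dilated_convolution_le {k : 𝓢(V, ℂ)} (hk : 𝓕 (k : V → ℂ) =ᶠ[nhds 0] 0) (m : ℕ) {α : ℝ}
    (hα : 0 < α) (hα1 : α ≤ 1) {ρ : ℝ} (hρ : 0 ≤ ρ) (N : ℕ) :
    ∃ C : ℝ, 0 ≤ C ∧ ∀ (M : ℝ) (g : V → ℂ), HolderBound m α M g →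
      tsupport g ⊆ Metric.closedBall 0 ρ → ∀ ε : ℝ, 0 < ε → ε ≤ 1 → ∀ x,
        ‖∫ y, k y * g (x - ε • y)‖ * (1 + ‖x‖) ^ N ≤ C * M * ε ^ (m + α) := by
  refine ⟨(1 + ρ) ^ N * ∫ y, (1 + ‖y‖) ^ (m + 1 + N) * ‖k y‖, by positivity,
    fun M g hg hsupp ε hε hε1 x => ?_⟩
  have hM := hg.nonneg
  have hgc : Continuous g := hg.contDiff.continuous
  -- The homogeneous parts of the Taylor polynomial at the increment `-(ε • y)`, as forms in `y`.
  let Q : (j : ℕ) → ContinuousMultilinearMap ℝ (fun _ : Fin j => V) ℂ := fun j =>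
    ((j.factorial : ℝ)⁻¹ * (-ε) ^ j) • iteratedFDeriv ℝ j g x
  have hrem : ∀ y, taylorRem m g x (-(ε • y)) =
      g (x - ε • y) - ∑ j ∈ Finset.range (m + 1), Q j fun _ => y := by
    intro y
    simp only [taylorRem, Q, ← sub_eq_add_neg, smul_apply]
    congr 1
    refine Finset.sum_congr rfl fun j _ => ?_
    have : (fun _ : Fin j => -(ε • y)) = fun i => (fun _ : Fin j => -ε) i • (fun _ : Fin j => y) i := by
      ext1 _; simp
    rw [this, ContinuousMultilinearMap.map_smul_univ, smul_smul]
    simp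
  -- Since the moments of `k` vanish, the Taylor polynomial can be subtracted without changing the
  -- integral.
  have heq : ∫ y, k y * g (x - ε • y) = ∫ y, k y * taylorRem m g x (-(ε • y)) := by
    have hint : Integrable fun y => k y * g (x - ε • y) := by
      refine (k.integrable (μ := volume)).mul_bdd (c := M) (Continuous.aestronglyMeasurable (by fun_prop)) ?_
      exact .of_forall fun y => hg.norm_apply_le _
    have hs : ∀ y, k y * taylorRem m g x (-(ε • y)) = k y * g (x - ε • y) -
        ∑ j ∈ Finset.range (m + 1), k y * Q j fun _ => y := by
      intro y; rw [hrem, mul_sub, Finset.mul_sum]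
    simp only [hs]
    rw [integral_sub hint (integrable_finsetSum _ fun j _ => integrable_mul_multilinear k (Q j)),
      integral_finsetSum _ fun j _ => integrable_mul_multilinear k (Q j),
      Finset.sum_eq_zero fun j _ => integral_mul_multilinear_eq_zero hk (Q j), sub_zero]
  rw [heq]
  have hb : 0 ≤ M * ε ^ (m + α) := by positivity
  -- The remainder is at most `M * ε ^ (m + α) * ‖y‖ ^ (m + α)`; as `α ≤ 1`, the integer exponent `m
  -- + 1` dominates the growth in `y`.
  refine (norm_integral_mul_weighted_le k hb hρ (q := m + 1) (fun y => ?_) (fun y hy => ?_) N).trans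
    (le_of_eq (by ring))
  · refine (hg.norm_taylorRem_le hα _ _).trans ?_
    rw [norm_neg, norm_smul, Real.norm_of_nonneg hε.le, Real.mul_rpow hε.le (norm_nonneg _),
      ← mul_assoc]
    gcongr
    rw [← Real.rpow_natCast]
    calc ‖y‖ ^ (m + α) ≤ (1 + ‖y‖) ^ (m + α) :=
          Real.rpow_le_rpow (norm_nonneg _) (by linarith) (by positivity)
      _ ≤ _ := Real.rpow_le_rpow_of_exponent_le (by linarith [norm_nonneg y])
          (by push_cast; linarith)
  · refine taylorRem_eq_zero hsupp ?_
    rw [norm_neg, norm_smul, Real.norm_of_nonneg hε.le]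
    nlinarith [norm_nonneg y]

end Weighted

/-! ### Fourier multipliers on Schwartz functions -/

section Multiplier

variable {V : Type*} [NormedAddCommGroup V] [InnerProductSpace ℝ V] [FiniteDimensional ℝ V]
  [MeasurableSpace V] [BorelSpace V]
  {W : Type*} [NormedAddCommGroup W] [InnerProductSpace ℝ W] [FiniteDimensional ℝ W]
  [MeasurableSpace W] [BorelSpace W]

/-- The pointwise product of two Schwartz functions. -/
def schwartzMul (m f : 𝓢(V, ℂ)) : 𝓢(V, ℂ) := smulLeftCLM ℂ m f

@[simp] lemma schwartzMul_apply (m f : 𝓢(V, ℂ)) (x : V) : schwartzMul m f x = m x * f x := by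
  rw [schwartzMul, smulLeftCLM_apply_apply m.hasTemperateGrowth, smul_eq_mul]

/-- The Fourier multiplier with symbol `m`. -/
def multiplier (m f : 𝓢(V, ℂ)) : 𝓢(V, ℂ) := 𝓕⁻ (schwartzMul m (𝓕 f))

lemma fourier_fourierInv_apply (f : 𝓢(V, ℂ)) (ξ : V) : 𝓕 (𝓕⁻ (f : V → ℂ)) ξ = f ξ := by
  have h : 𝓕 (𝓕⁻ f) = f := FourierTransform.fourier_fourierInv_eq f
  rw [← fourierInv_coe, ← fourier_coe, h]

lemma fourier_multiplier (m f : 𝓢(V, ℂ)) : 𝓕 (multiplier m f) = schwartzMul m (𝓕 f) :=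
  FourierTransform.fourier_fourierInv_eq _

lemma fourierInv_apply' (F : 𝓢(V, ℂ)) (x : V) :
    (𝓕⁻ F) x = ∫ ξ, Complex.exp ((2 * Real.pi * inner ℝ ξ x : ℝ) * Complex.I) * F ξ := by
  rw [fourierInv_coe, Real.fourierInv_eq']; rfl

lemma norm_cexp_mul_I (a : ℝ) (z : ℂ) : ‖Complex.exp ((a : ℂ) * Complex.I) * z‖ = ‖z‖ := by
  rw [norm_mul, Complex.norm_exp_ofReal_mul_I, one_mul]

/-- Averaging an inverse Fourier transform along the range of a linear map. -/
lemma integral_mul_fourierInv_sub (A : W →L[ℝ] V) (k : 𝓢(W, ℂ)) (F : 𝓢(V, ℂ)) (x : V) :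
    ∫ z, k z * (𝓕⁻ F) (x - A z) =
      ∫ ξ, Complex.exp ((2 * Real.pi * inner ℝ ξ x : ℝ) * Complex.I) *
        (F ξ * 𝓕 (k : W → ℂ) (A.adjoint ξ)) := by
  have hsplit : ∀ (z : W) (ξ : V), k z * (Complex.exp
      ((2 * Real.pi * inner ℝ ξ (x - A z) : ℝ) * Complex.I) * F ξ) =
      Complex.exp ((2 * Real.pi * inner ℝ ξ x : ℝ) * Complex.I) * (F ξ *
        (Complex.exp ((-2 * Real.pi * inner ℝ z (A.adjoint ξ) : ℝ) * Complex.I) * k z)) := by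
    intro z ξ
    rw [ContinuousLinearMap.adjoint_inner_right, real_inner_comm ξ (A z), inner_sub_right]
    have : ((2 * Real.pi * (inner ℝ ξ x - inner ℝ ξ (A z)) : ℝ) : ℂ) * Complex.I =
        ((2 * Real.pi * inner ℝ ξ x : ℝ) : ℂ) * Complex.I +
          ((-2 * Real.pi * inner ℝ ξ (A z) : ℝ) : ℂ) * Complex.I := by
      push_cast; ring
    rw [this, Complex.exp_add]
    ring
  simp only [fourierInv_apply', ← integral_const_mul]
  rw [integral_integral_swap]
  · congr 1
    ext ξ
    simp only [hsplit, integral_const_mul]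
    rw [Real.fourier_eq']
    simp only [smul_eq_mul]
  · have hint : Integrable (fun p : W × V => k p.1 * F p.2) (volume.prod volume) :=
      (k.integrable (μ := volume)).mul_prod (F.integrable (μ := volume))
    refine hint.mono (Continuous.aestronglyMeasurable (by fun_prop)) (.of_forall fun p => ?_)
    simp only [Function.uncurry]
    rw [norm_mul, norm_cexp_mul_I, norm_mul]

/-- The preceding averaging formula for `A = ε • id`, which is its own adjoint. -/
lemma integral_mul_sub_smul {k m : 𝓢(V, ℂ)} {ε : ℝ} (hm : ∀ ξ, m ξ = 𝓕 (k : V → ℂ) (ε • ξ))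
    (f : 𝓢(V, ℂ)) (x : V) : ∫ y, k y * f (x - ε • y) = multiplier m f x := by
  have hf : 𝓕⁻ (𝓕 f) = f := FourierTransform.fourierInv_fourier_eq f
  have h := integral_mul_fourierInv_sub (ε • ContinuousLinearMap.id ℝ V) k (𝓕 f) x
  rw [hf] at h
  simp only [FunLike.coe_smul, Pi.smul_apply, ContinuousLinearMap.id_apply] at h
  rw [h, multiplier, fourierInv_apply']
  congr 1
  ext ξ
  rw [schwartzMul_apply, hm, mul_comm (𝓕 f ξ)]
  congr 2
  refine congrArg _ (ext_inner_right ℝ fun z => ?_)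
  rw [ContinuousLinearMap.adjoint_inner_left]
  simp [inner_smul_left, inner_smul_right]

/-- The pairing is bilinear, without conjugation, so moving the two transforms across replaces the
multiplier by its reflection `ξ ↦ -ξ`; evenness of the symbol makes it symmetric. -/
lemma integral_multiplier_mul {m : 𝓢(V, ℂ)} (hm : ∀ ξ, m (-ξ) = m ξ) (f g : 𝓢(V, ℂ)) :
    ∫ x, multiplier m f x * g x = ∫ x, f x * multiplier m g x := by
  have h1 : ∫ x, multiplier m f x * g x = ∫ x, 𝓕 f x * schwartzMul m (𝓕⁻ g) x := by
    rw [multiplier, integral_fourierInv_mul_eq]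
    congr 1
    ext x
    simp only [schwartzMul_apply]; ring
  rw [h1, integral_fourier_mul_eq]
  congr 1
  ext x
  congr 1
  rw [multiplier, fourier_coe, fourierInv_coe, Real.fourierInv_eq_fourier_neg, Real.fourier_eq',
    Real.fourier_eq', ← integral_neg_eq_self]
  congr 1
  ext ξ
  rw [schwartzMul_apply, schwartzMul_apply, hm, fourierInv_coe, Real.fourierInv_eq_fourier_neg,
    neg_neg, inner_neg_left, inner_neg_right, fourier_coe]

lemma multiplier_multiplier_of_mul_eq {m m' : 𝓢(V, ℂ)} (h : ∀ ξ, m' ξ * m ξ = m ξ)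
    (f : 𝓢(V, ℂ)) : multiplier m' (multiplier m f) = multiplier m f := by
  rw [multiplier, fourier_multiplier, multiplier]
  congr 1
  ext ξ
  simp only [schwartzMul_apply, ← mul_assoc, h]

/-- Lets the other function of a pairing be replaced by its part in a slightly wider frequency band;
the decay of that part makes the dyadic sum converge. -/
lemma integral_multiplier_mul_eq {m m' : 𝓢(V, ℂ)} (h : ∀ ξ, m' ξ * m ξ = m ξ)
    (hm' : ∀ ξ, m' (-ξ) = m' ξ) (f g : 𝓢(V, ℂ)) :
    ∫ x, multiplier m f x * g x = ∫ x, multiplier m f x * multiplier m' g x := by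
  rw [← integral_multiplier_mul hm', multiplier_multiplier_of_mul_eq h]

lemma multiplier_add (m m' f : 𝓢(V, ℂ)) :
    multiplier (m + m') f = multiplier m f + multiplier m' f := by
  have : schwartzMul (m + m') (𝓕 f) = schwartzMul m (𝓕 f) + schwartzMul m' (𝓕 f) := by
    ext ξ; simp [add_mul]
  rw [multiplier, this, FourierTransform.fourierInv_add]; rfl

end Multiplier

/-! ### Dyadic multipliers -/

namespace Cutoff

section Symbols

variable {V : Type*} [NormedAddCommGroup V] [InnerProductSpace ℝ V] [FiniteDimensional ℝ V]

lemma contDiff_low (χ : Cutoff) {c : ℝ} (hc : 0 < c) :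
    ContDiff ℝ ∞ fun η : V => (χ.toFun (‖(2 * Real.pi) • η‖ / c) : ℂ) :=
  Complex.ofRealCLM.contDiff.comp ((χ.contDiff_norm (V := V) hc).comp (contDiff_id.const_smul _))

lemma hasCompactSupport_low (χ : Cutoff) {c : ℝ} (hc : 0 < c) :
    HasCompactSupport fun η : V => (χ.toFun (‖(2 * Real.pi) • η‖ / c) : ℂ) := by
  refine HasCompactSupport.intro (isCompact_closedBall (0 : V) (2 * c)) fun η hη => ?_
  have h : 2 * c < ‖η‖ := by simpa using hη
  rw [χ.eq_zero, Complex.ofReal_zero]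
  rw [le_div_iff₀ hc, norm_smul, Real.norm_of_nonneg (by positivity)]
  nlinarith [Real.pi_gt_three, norm_nonneg η]

/-- The low-pass symbol `η ↦ χ(2π‖η‖/c)`, for `c > 0`. -/
def low (χ : Cutoff) (V : Type*) [NormedAddCommGroup V] [InnerProductSpace ℝ V]
    [FiniteDimensional ℝ V] {c : ℝ} (hc : 0 < c) : 𝓢(V, ℂ) :=
  (χ.hasCompactSupport_low hc).toSchwartzMap (χ.contDiff_low hc)

lemma low_apply (χ : Cutoff) {c : ℝ} (hc : 0 < c) (η : V) :
    χ.low V hc η = χ.toFun (2 * Real.pi * ‖η‖ / c) := by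
  have : χ.low V hc η = χ.toFun (‖(2 * Real.pi) • η‖ / c) := rfl
  rw [this, norm_smul, Real.norm_of_nonneg (by positivity)]

lemma low_neg (χ : Cutoff) {c : ℝ} (hc : 0 < c) (η : V) : χ.low V hc (-η) = χ.low V hc η := by
  rw [low_apply, low_apply, norm_neg]

lemma low_smul (χ : Cutoff) {c ε : ℝ} (hc : 0 < c) (hε : 0 < ε) (η : V) :
    χ.low V hc (ε • η) = χ.low V (div_pos hc hε) η := by
  rw [low_apply, low_apply, norm_smul, Real.norm_of_nonneg hε.le]
  congr 2
  field_simp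

lemma low_eq_one (χ : Cutoff) {c : ℝ} (hc : 0 < c) {η : V} (h : 2 * Real.pi * ‖η‖ ≤ c) :
    χ.low V hc η = 1 := by
  rw [low_apply, χ.eq_one, Complex.ofReal_one]
  rwa [div_le_one hc]

lemma low_eq_zero (χ : Cutoff) {c : ℝ} (hc : 0 < c) {η : V} (h : 2 * c ≤ 2 * Real.pi * ‖η‖) :
    χ.low V hc η = 0 := by
  rw [low_apply, χ.eq_zero, Complex.ofReal_zero]
  rwa [le_div_iff₀ hc]

/-- The symbol of `ψ_l^{Op}` for Mathlib's normalisation of the Fourier transform. -/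
def symbol (χ : Cutoff) (V : Type*) [NormedAddCommGroup V] [InnerProductSpace ℝ V]
    [FiniteDimensional ℝ V] : ℕ → 𝓢(V, ℂ)
  | 0 => χ.low V one_pos
  | n + 1 => χ.low V (c := 2 ^ (n + 1)) (by positivity) - χ.low V (c := 2 ^ n) (by positivity)

lemma symbol_apply (χ : Cutoff) (l : ℕ) (η : V) :
    χ.symbol V l η = χ.dyadic l ((2 * Real.pi) • η) := by
  have h : ‖(2 * Real.pi) • η‖ = 2 * Real.pi * ‖η‖ := by
    rw [norm_smul, Real.norm_of_nonneg (by positivity)]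
  cases l with
  | zero => simp only [symbol, low_apply, dyadic, h, div_one]
  | succ n => simp only [symbol, sub_apply, low_apply, dyadic, h, Complex.ofReal_sub]

/-- A symbol equal to `1` on the support of `χ.symbol V l`. -/
def wideSymbol (χ : Cutoff) (V : Type*) [NormedAddCommGroup V] [InnerProductSpace ℝ V]
    [FiniteDimensional ℝ V] : ℕ → 𝓢(V, ℂ)
  | 0 => χ.low V two_pos
  | n + 1 => χ.low V (c := 2 ^ (n + 2)) (by positivity) - χ.low V (c := 2 ^ n / 2) (by positivity)

lemma wideSymbol_neg (χ : Cutoff) (l : ℕ) (η : V) :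
    χ.wideSymbol V l (-η) = χ.wideSymbol V l η := by
  cases l with
  | zero => exact χ.low_neg two_pos η
  | succ n => simp only [wideSymbol, sub_apply, low_neg]

/-- For index `n + 1`, compare `2π‖η‖` with `2 ^ n` and `2 ^ (n + 2)`: below, the two low-pass terms
of the symbol are both `1` and cancel; in between, the wide symbol is `1`; above, the symbol
vanishes. -/
lemma wideSymbol_mul_symbol (χ : Cutoff) (l : ℕ) (η : V) :
    χ.wideSymbol V l η * χ.symbol V l η = χ.symbol V l η := by
  cases l with
  | zero =>
    simp only [wideSymbol, symbol]
    rcases le_total (2 * Real.pi * ‖η‖) 2 with h | h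
    · rw [χ.low_eq_one two_pos h, one_mul]
    · rw [χ.low_eq_zero one_pos (by linarith), mul_zero]
  | succ n =>
    simp only [wideSymbol, symbol, sub_apply]
    have h2 : (0 : ℝ) < 2 ^ n := by positivity
    have h3 : (2 : ℝ) ^ (n + 1) = 2 * 2 ^ n := by ring
    have h4 : (2 : ℝ) ^ (n + 2) = 4 * 2 ^ n := by ring
    rcases le_total (2 * Real.pi * ‖η‖) (2 ^ n) with h | h
    · rw [χ.low_eq_one (c := 2 ^ n) _ h, χ.low_eq_one (c := 2 ^ (n + 1)) _ (by linarith)]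
      simp
    rcases le_total (2 * Real.pi * ‖η‖) (2 ^ (n + 2)) with h' | h'
    · rw [χ.low_eq_one (c := 2 ^ (n + 2)) _ h', χ.low_eq_zero (c := 2 ^ n / 2) _ (by linarith)]
      simp
    · rw [χ.low_eq_zero (c := 2 ^ n) _ (by linarith),
        χ.low_eq_zero (c := 2 ^ (n + 1)) _ (by linarith)]
      simp

lemma symbol_eq_zero (χ : Cutoff) (l : ℕ) {η : V} (h : 2 * 2 ^ l ≤ 2 * Real.pi * ‖η‖) :
    χ.symbol V l η = 0 := by
  cases l with
  | zero => exact χ.low_eq_zero one_pos (by simpa using h)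
  | succ n =>
    have h2 : (0 : ℝ) < 2 ^ n := by positivity
    have h3 : (2 : ℝ) ^ (n + 1) = 2 * 2 ^ n := by ring
    simp only [symbol, sub_apply]
    rw [χ.low_eq_zero (c := 2 ^ n) _ (by linarith), χ.low_eq_zero (c := 2 ^ (n + 1)) _ h, sub_zero]

lemma sum_symbol (χ : Cutoff) (L : ℕ) :
    ∑ l ∈ Finset.range (L + 1), χ.symbol V l = χ.low V (c := 2 ^ L) (by positivity) := by
  induction L with
  | zero =>
    ext η
    simp [symbol, low_apply]
  | succ n ih => rw [Finset.sum_range_succ, ih]; simp [symbol]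

/-- All blocks of positive index are dilates of one band, so a single constant will serve for every
`l`. -/
lemma symbol_succ_apply (χ : Cutoff) (n : ℕ) (η : V) :
    χ.symbol V (n + 1) η = (χ.low V two_pos - χ.low V one_pos) (((2 : ℝ) ^ n)⁻¹ • η) := by
  have h2 : (0 : ℝ) < (2 ^ n)⁻¹ := by positivity
  simp only [symbol, sub_apply, low_smul _ _ h2, low_apply]
  congr 4 <;> field_simp
  ring

lemma wideSymbol_succ_apply (χ : Cutoff) (n : ℕ) (η : V) :
    χ.wideSymbol V (n + 1) η = (χ.low V four_pos - χ.low V (half_pos one_pos))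
      (((2 : ℝ) ^ n)⁻¹ • η) := by
  have h2 : (0 : ℝ) < (2 ^ n)⁻¹ := by positivity
  simp only [wideSymbol, sub_apply, low_smul _ _ h2, low_apply]
  congr 4 <;> field_simp
  ring

end Symbols

variable {V : Type*} [NormedAddCommGroup V] [InnerProductSpace ℝ V] [FiniteDimensional ℝ V]
  [MeasurableSpace V] [BorelSpace V]

/-- Both low-pass symbols are `1` near the origin. This is the hypothesis under which the kernel has
vanishing moments. -/
lemma fourier_fourierInv_band (χ : Cutoff) {a b : ℝ} (ha : 0 < a) (hb : 0 < b) (hab : a ≤ b) :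
    𝓕 ((𝓕⁻ (χ.low V hb - χ.low V ha) : 𝓢(V, ℂ)) : V → ℂ) =ᶠ[nhds 0] 0 := by
  have hr : 0 < a / (2 * Real.pi) := by positivity
  filter_upwards [Metric.ball_mem_nhds (0 : V) hr] with η hη
  have h := (mem_ball_zero_iff.mp hη)
  rw [lt_div_iff₀ (by positivity)] at h
  rw [fourierInv_coe, fourier_fourierInv_apply, sub_apply, χ.low_eq_one hb (by linarith),
    χ.low_eq_one ha (by linarith), sub_self]
  rfl

/-- The low-pass kernels form an approximate identity: they are dilates of one Schwartz function `k`
whose integral is the value `1` of its symbol at the origin. Dominated convergence is used twice, in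
the convolution and in the pairing. -/
lemma tendsto_integral_low (χ : Cutoff) (f g : 𝓢(V, ℂ)) :
    Filter.Tendsto (fun L : ℕ => ∫ x, multiplier (χ.low V (c := 2 ^ L) (by positivity)) f x * g x)
      Filter.atTop (nhds (∫ x, f x * g x)) := by
  set k : 𝓢(V, ℂ) := 𝓕⁻ (χ.low V one_pos) with hk
  have hkF : ∀ ξ, 𝓕 (k : V → ℂ) ξ = χ.low V one_pos ξ := fun ξ => by
    rw [hk, fourierInv_coe, fourier_fourierInv_apply]
  have hconv : ∀ (L : ℕ) (x : V), multiplier (χ.low V (c := 2 ^ L) (by positivity)) f x =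
      ∫ y, k y * f (x - ((2 : ℝ) ^ L)⁻¹ • y) := by
    intro L x
    rw [← integral_mul_sub_smul fun ξ => ?_]
    have h2 : (0 : ℝ) < (2 ^ L)⁻¹ := by positivity
    rw [hkF, low_smul _ _ h2, low_apply, low_apply]
    simp
  have hk1 : ∫ y, k y = 1 := by
    have h0 := hkF 0
    rw [χ.low_eq_one one_pos (by simp), Real.fourier_eq] at h0
    simpa using h0
  obtain ⟨B, hB⟩ : ∃ B : ℝ, ∀ x, ‖f x‖ ≤ B := ⟨_, fun x => f.norm_le_seminorm ℝ x⟩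
  have hbound : ∀ L x, ‖multiplier (χ.low V (c := 2 ^ L) (by positivity)) f x‖ ≤
      ∫ y, ‖k y‖ * B := by
    intro L x
    rw [hconv]
    refine norm_integral_le_of_norm_le (k.integrable.norm.mul_const B) (.of_forall fun y => ?_)
    rw [norm_mul]
    gcongr
    exact hB _
  refine tendsto_integral_of_dominated_convergence (fun x => (∫ y, ‖k y‖ * B) * ‖g x‖)
    (fun L => Continuous.aestronglyMeasurable (by fun_prop)) (g.integrable.norm.const_mul _)
    (fun L => .of_forall fun x => ?_) (.of_forall fun x => ?_)
  · rw [norm_mul]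
    gcongr
    exact hbound L x
  · refine Filter.Tendsto.mul_const _ ?_
    simp only [hconv]
    have hlim : ∫ y, k y * f x = f x := by rw [integral_mul_const, hk1, one_mul]
    conv => rhs; rw [← hlim]
    refine tendsto_integral_of_dominated_convergence (fun y => ‖k y‖ * B)
      (fun L => Continuous.aestronglyMeasurable (by fun_prop)) (k.integrable.norm.mul_const B)
      (fun L => .of_forall fun y => ?_) (.of_forall fun y => ?_)
    · rw [norm_mul]
      gcongr
      exact hB _
    · refine Filter.Tendsto.const_mul _ ?_
      have h0 : Filter.Tendsto (fun L : ℕ => ((2 : ℝ) ^ L)⁻¹) Filter.atTop (nhds 0) :=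
        (tendsto_pow_atTop_atTop_of_one_lt one_lt_two).inv_tendsto_atTop
      have h1 : Filter.Tendsto (fun L : ℕ => x - ((2 : ℝ) ^ L)⁻¹ • y) Filter.atTop (nhds x) := by
        simpa using tendsto_const_nhds.sub (h0.smul_const y)
      exact (f.continuous.tendsto x).comp h1

end Cutoff

/-! ### Relation with the operators `ψ_l^{Op}` and their kernels -/

section Normalisation

variable {ι : Type*} [Fintype ι]

lemma fourierT_eq (f : EuclideanSpace ℝ ι → ℂ) (ξ : EuclideanSpace ℝ ι) :
    fourierT f ((2 * Real.pi) • ξ) = 𝓕 f ξ := by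
  rw [Real.fourier_eq', fourierT]
  congr 1
  ext y
  rw [smul_eq_mul, inner_smul_right]
  congr 2
  push_cast; ring

/-- The substitution `ξ = 2πη` has a Jacobian that cancels the factor in front of the integral. -/
lemma fourierTInv_eq (g : EuclideanSpace ℝ ι → ℂ) (x : EuclideanSpace ℝ ι) :
    fourierTInv g x = 𝓕⁻ (fun η => g ((2 * Real.pi) • η)) x := by
  rw [Real.fourierInv_eq', fourierTInv]
  have h : ∀ η : EuclideanSpace ℝ ι,
      Complex.exp ((2 * Real.pi * inner ℝ η x : ℝ) * Complex.I) • g ((2 * Real.pi) • η) =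
      (fun ξ => Complex.exp (Complex.I * (inner ℝ x ξ : ℝ)) * g ξ) ((2 * Real.pi) • η) := by
    intro η
    simp only [smul_eq_mul]
    rw [inner_smul_right, real_inner_comm]
    congr 2
    push_cast; ring
  rw [integral_congr_ae (.of_forall h), Measure.integral_comp_smul volume
    (fun ξ => Complex.exp (Complex.I * (inner ℝ x ξ : ℝ)) * g ξ)]
  rw [finrank_euclideanSpace, abs_of_nonneg (by positivity), Complex.real_smul]
  push_cast
  rfl

lemma Cutoff.op_eq_multiplier (χ : Cutoff) (l : ℕ) (f : 𝓢(EuclideanSpace ℝ ι, ℂ)) :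
    χ.op l f = multiplier (χ.symbol _ l) f := by
  refine funext fun x => ?_
  rw [Cutoff.op, fourierTInv_eq, multiplier, fourierInv_coe]
  refine congrArg (fun F : EuclideanSpace ℝ ι → ℂ => 𝓕⁻ F x) (funext fun η => ?_)
  rw [fourierT_eq, schwartzMul_apply, Cutoff.symbol_apply, fourier_coe]

lemma Cutoff.kernel_eq (χ : Cutoff) {n : ℕ} (l : ℕ) (x : EuclideanSpace ℝ (Fin n)) :
    ((2 * Real.pi : ℝ) ^ n : ℂ)⁻¹ * χ.kernel l x =
      (𝓕⁻ (χ.symbol (EuclideanSpace ℝ (Fin n)) l)) x := by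
  have h := fourierTInv_eq (fun η : EuclideanSpace ℝ (Fin n) => (χ.dyadic l η : ℂ)) x
  rw [fourierTInv, Fintype.card_fin] at h
  rw [Cutoff.kernel, h, fourierInv_coe]
  refine congrArg (fun F : EuclideanSpace ℝ (Fin n) → ℂ => 𝓕⁻ F x) (funext fun η => ?_)
  rw [Cutoff.symbol_apply]

end Normalisation

/-! ### Littlewood–Paley decay -/

section Decay

variable {V : Type*} [NormedAddCommGroup V] [InnerProductSpace ℝ V] [FiniteDimensional ℝ V]
  [MeasurableSpace V] [BorelSpace V]

/-- Blocks of positive index are convolutions with dilates of a kernel with vanishing moments. The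
block of index `0` has no such cancellation, but needs no decay in `l` either. -/
lemma norm_multiplier_weighted_le {σ : ℕ → 𝓢(V, ℂ)} {β : 𝓢(V, ℂ)}
    (hσ : ∀ n ξ, σ (n + 1) ξ = β (((2 : ℝ) ^ n)⁻¹ • ξ))
    (hβ : 𝓕 ((𝓕⁻ β : 𝓢(V, ℂ)) : V → ℂ) =ᶠ[nhds 0] 0) (m : ℕ) {α : ℝ} (hα : 0 < α) (hα1 : α ≤ 1)
    {ρ : ℝ} (hρ : 0 ≤ ρ) (N : ℕ) :
    ∃ C : ℝ, 0 ≤ C ∧ ∀ (M : ℝ) (f : 𝓢(V, ℂ)), HolderBound m α M f →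
      tsupport f ⊆ Metric.closedBall 0 ρ → ∀ (l : ℕ) (x : V),
        ‖multiplier (σ l) f x‖ * (1 + ‖x‖) ^ N ≤ C * M * (2 : ℝ) ^ (-(l : ℝ) * (m + α)) := by
  obtain ⟨C₀, hC₀, h₀⟩ := norm_convolution_weighted_le (𝓕⁻ (σ 0)) hρ N
  obtain ⟨C₁, hC₁, h₁⟩ := norm_dilated_convolution_le hβ m hα hα1 hρ N
  -- Block `n + 1` uses the dilation `ε = 2 ^ (-n)`, one power of two off the target `2 ^ (-(n +
  -- 1))`; the factor `2 ^ (m + α)` pays for the shift.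
  refine ⟨max C₀ (C₁ * 2 ^ (m + α)), le_max_of_le_left hC₀, fun M f hf hsupp l x => ?_⟩
  have hM := hf.nonneg
  cases l with
  | zero =>
    have hconv : ∫ y, (𝓕⁻ (σ 0)) y * f (x - y) = multiplier (σ 0) f x := by
      have := integral_mul_sub_smul (k := 𝓕⁻ (σ 0)) (m := σ 0) (ε := 1)
        (fun ξ => by rw [one_smul, fourierInv_coe, fourier_fourierInv_apply]) f x
      simpa using this
    have := h₀ M f hf.norm_apply_le hsupp x
    rw [hconv] at this
    simp only [CharP.cast_eq_zero, neg_zero, zero_mul, Real.rpow_zero, mul_one]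
    exact this.trans (mul_le_mul_of_nonneg_right (le_max_left _ _) hM)
  | succ n =>
    have h2 : (0 : ℝ) < 2 ^ n := by positivity
    have hconv : ∫ y, (𝓕⁻ β) y * f (x - ((2 : ℝ) ^ n)⁻¹ • y) = multiplier (σ (n + 1)) f x :=
      integral_mul_sub_smul
        (fun ξ => by rw [hσ, fourierInv_coe, fourier_fourierInv_apply]) f x
    have := h₁ M f hf hsupp ((2 : ℝ) ^ n)⁻¹ (by positivity)
      (inv_le_one_of_one_le₀ (one_le_pow₀ one_le_two)) x
    rw [hconv] at this
    refine this.trans ?_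
    have hpow : (((2 : ℝ) ^ n)⁻¹) ^ (m + α) =
        2 ^ (m + α) * (2 : ℝ) ^ (-((n + 1 : ℕ) : ℝ) * (m + α)) := by
      rw [← Real.rpow_natCast, ← Real.rpow_neg zero_le_two, ← Real.rpow_mul zero_le_two,
        ← Real.rpow_add zero_lt_two]
      congr 1
      push_cast; ring
    rw [hpow]
    calc _ = (C₁ * 2 ^ (m + α)) * M * (2 : ℝ) ^ (-((n + 1 : ℕ) : ℝ) * (m + α)) := by ring
      _ ≤ _ := by gcongr; exact le_max_right _ _

lemma Cutoff.norm_symbol_multiplier_le (χ : Cutoff) (m : ℕ) {α : ℝ} (hα : 0 < α) (hα1 : α ≤ 1)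
    {ρ : ℝ} (hρ : 0 ≤ ρ) (N : ℕ) :
    ∃ C : ℝ, 0 ≤ C ∧ ∀ (M : ℝ) (f : 𝓢(V, ℂ)), HolderBound m α M f →
      tsupport f ⊆ Metric.closedBall 0 ρ → ∀ (l : ℕ) (x : V),
        ‖multiplier (χ.symbol V l) f x‖ * (1 + ‖x‖) ^ N ≤
          C * M * (2 : ℝ) ^ (-(l : ℝ) * (m + α)) :=
  norm_multiplier_weighted_le χ.symbol_succ_apply
    (χ.fourier_fourierInv_band one_pos two_pos one_le_two) m hα hα1 hρ N

lemma Cutoff.norm_wideSymbol_multiplier_le (χ : Cutoff) (m : ℕ) {α : ℝ} (hα : 0 < α) (hα1 : α ≤ 1)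
    {ρ : ℝ} (hρ : 0 ≤ ρ) (N : ℕ) :
    ∃ C : ℝ, 0 ≤ C ∧ ∀ (M : ℝ) (f : 𝓢(V, ℂ)), HolderBound m α M f →
      tsupport f ⊆ Metric.closedBall 0 ρ → ∀ (l : ℕ) (x : V),
        ‖multiplier (χ.wideSymbol V l) f x‖ * (1 + ‖x‖) ^ N ≤
          C * M * (2 : ℝ) ^ (-(l : ℝ) * (m + α)) :=
  norm_multiplier_weighted_le χ.wideSymbol_succ_apply
    (χ.fourier_fourierInv_band (half_pos one_pos) four_pos (by norm_num)) m hα hα1 hρ N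

lemma Cutoff.fourierInv_symbol_succ (χ : Cutoff) (n : ℕ) (y : V) :
    (𝓕⁻ (χ.symbol V (n + 1))) y = ((2 : ℝ) ^ n) ^ Module.finrank ℝ V •
      (𝓕⁻ (χ.low V two_pos - χ.low V one_pos)) ((2 : ℝ) ^ n • y) := by
  rw [fourierInv_apply', fourierInv_apply']
  have h : ∀ ξ : V, Complex.exp ((2 * Real.pi * inner ℝ ξ y : ℝ) * Complex.I) *
      χ.symbol V (n + 1) ξ = (fun ξ => Complex.exp
        ((2 * Real.pi * inner ℝ ξ ((2 : ℝ) ^ n • y) : ℝ) * Complex.I) *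
        (χ.low V two_pos - χ.low V one_pos) ξ) (((2 : ℝ) ^ n)⁻¹ • ξ) := by
    intro ξ
    simp only
    rw [χ.symbol_succ_apply, inner_smul_left, inner_smul_right]
    congr 5
    simp
  rw [integral_congr_ae (.of_forall h), Measure.integral_comp_inv_smul volume
    (fun ξ => Complex.exp ((2 * Real.pi * inner ℝ ξ ((2 : ℝ) ^ n • y) : ℝ) * Complex.I) *
        (χ.low V two_pos - χ.low V one_pos) ξ), abs_of_nonneg (by positivity)]

/-- The kernels of the dyadic multipliers are uniformly integrable against polynomial weights. -/
lemma Cutoff.integral_kernel_weight_le (χ : Cutoff) (N : ℕ) :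
    ∃ C : ℝ, 0 ≤ C ∧ ∀ l : ℕ, ∫ y : V, (1 + ‖y‖) ^ N * ‖(𝓕⁻ (χ.symbol V l)) y‖ ≤ C := by
  set k : 𝓢(V, ℂ) := 𝓕⁻ (χ.low V two_pos - χ.low V one_pos) with hk
  refine ⟨max (∫ y : V, (1 + ‖y‖) ^ N * ‖(𝓕⁻ (χ.symbol V 0)) y‖) (∫ y, (1 + ‖y‖) ^ N * ‖k y‖),
    le_max_of_le_left (by positivity), fun l => ?_⟩
  cases l with
  | zero => exact le_max_left _ _
  | succ n =>
    refine le_trans ?_ (le_max_right _ _)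
    have h2 : (1 : ℝ) ≤ 2 ^ n := one_le_pow₀ one_le_two
    -- As `2 ^ n ≥ 1`, replacing `y` by `2 ^ n • y` in the weight only increases it; the rescaled
    -- integral is then independent of `n`.
    calc ∫ y : V, (1 + ‖y‖) ^ N * ‖(𝓕⁻ (χ.symbol V (n + 1))) y‖
        ≤ ∫ y : V, ((2 : ℝ) ^ n) ^ Module.finrank ℝ V *
            (fun y => (1 + ‖y‖) ^ N * ‖k y‖) ((2 : ℝ) ^ n • y) := by
          refine integral_mono (integrable_one_add_pow_mul _ N) ?_ fun y => ?_
          · exact ((integrable_one_add_pow_mul k N).comp_smul (by positivity)).const_mul _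
          · simp only
            rw [χ.fourierInv_symbol_succ, norm_smul, Real.norm_of_nonneg (by positivity), ← hk,
              mul_left_comm]
            gcongr
            rw [norm_smul, Real.norm_of_nonneg (by positivity)]
            exact le_mul_of_one_le_left (norm_nonneg _) h2
      _ = ∫ y, (1 + ‖y‖) ^ N * ‖k y‖ := by
          rw [integral_const_mul, Measure.integral_comp_smul volume
            (fun y : V => (1 + ‖y‖) ^ N * ‖k y‖), abs_of_nonneg (by positivity), smul_eq_mul,
            ← mul_assoc, mul_inv_cancel₀ (by positivity), one_mul]

end Decay

/-! ### Geometry of the leaves -/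

section Geometry

/-- The orthogonal projection `ℝ^d → ℝ^{du}`. -/
def vert (x : Space ds du) : EuclideanSpace ℝ (Fin du) := WithLp.toLp 2 fun j => x (Sum.inr j)

lemma inner_eq_proj_add_vert (x y : Space ds du) :
    inner ℝ x y = inner ℝ (proj x) (proj y) + inner ℝ (vert x) (vert y) := by
  simp only [PiLp.inner_apply, Fintype.sum_sum_type]
  rfl

lemma norm_sq_eq_proj_add_vert (x : Space ds du) : ‖x‖ ^ 2 = ‖proj x‖ ^ 2 + ‖vert x‖ ^ 2 := by
  simp only [← real_inner_self_eq_norm_sq, ← inner_eq_proj_add_vert]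

lemma norm_le_proj_add_vert (x : Space ds du) : ‖x‖ ≤ ‖proj x‖ + ‖vert x‖ := by
  refine le_of_sq_le_sq ?_ (by positivity)
  rw [norm_sq_eq_proj_add_vert]
  nlinarith [mul_nonneg (norm_nonneg (proj x)) (norm_nonneg (vert x))]

/-- The projection `ℝ^d → ℝ^{ds}` as a linear map. -/
def projL (ds du : ℕ) : Space ds du →ₗ[ℝ] EuclideanSpace ℝ (Fin ds) where
  toFun := proj
  map_add' x y := by ext i; simp
  map_smul' c x := by ext i; simp

/-- The projection `ℝ^d → ℝ^{du}` as a linear map. -/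
def vertL (ds du : ℕ) : Space ds du →ₗ[ℝ] EuclideanSpace ℝ (Fin du) where
  toFun := vert
  map_add' x y := by ext i; simp [vert]
  map_smul' c x := by ext i; simp [vert]

@[simp] lemma projL_apply (x : Space ds du) : projL ds du x = proj x := rfl

lemma continuous_vert : Continuous (vert : Space ds du → _) := by
  unfold vert
  fun_prop

/-- On the compact set of unit vectors of `C₊` the vertical part never vanishes, since a vector
without vertical part lies in `ℝ^{ds} × {0} ⊆ C₋` and the cones meet only at `0`. Homogeneity does
the rest. -/
lemma Params.exists_vert_lower_bound (P : Params ds du) :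
    ∃ δ : ℝ, 0 < δ ∧ ∀ x ∈ P.cones.plus, δ * ‖x‖ ≤ ‖vert x‖ := by
  set S : Set (Space ds du) := P.cones.plus ∩ Metric.sphere 0 1
  have hS : IsCompact S := (isCompact_sphere _ _).inter_left P.cones.isClosed_plus
  have hhom : ∀ x ∈ P.cones.plus, x ≠ 0 → ‖x‖⁻¹ • x ∈ S := fun x hx h0 =>
    ⟨P.cones.smul_mem_plus _ x hx, by simp [norm_smul, h0]⟩
  have hvs : ∀ (c : ℝ) (x : Space ds du), vert (c • x) = c • vert x := (vertL ds du).map_smul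
  rcases S.eq_empty_or_nonempty with he | hne
  · refine ⟨1, one_pos, fun x hx => ?_⟩
    by_cases h0 : x = 0
    · simp [h0]
    · have := hhom x hx h0
      rw [he] at this
      exact absurd this (Set.notMem_empty _)
  · obtain ⟨x₀, hx₀, hmin⟩ := hS.exists_isMinOn hne continuous_vert.norm.continuousOn
    refine ⟨‖vert x₀‖, norm_pos_iff.mpr fun h => ?_, fun x hx => ?_⟩
    · have hh : x₀ ∈ P.cones.plus ∩ P.cones.minus :=
        ⟨hx₀.1, P.horizontal_subset fun j => congrArg (fun v => v j) h⟩
      rw [P.cones.inter_eq, Set.mem_singleton_iff] at hh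
      have := hx₀.2
      rw [hh] at this
      simp at this
    · by_cases h0 : x = 0
      · simp [h0]
      · have := hmin (hhom x hx h0)
        simp only [Set.mem_ofPred_eq, hvs, norm_smul, norm_inv, norm_norm] at this
        rwa [inv_mul_eq_div, le_div_iff₀ (norm_pos_iff.mpr h0)] at this

/-- Vectors normal to a `du`-dimensional subspace of `C₊` are controlled by their projection. -/
lemma Params.exists_norm_le_proj (P : Params ds du) :
    ∃ L : ℝ≥0, ∀ W : Submodule ℝ (Space ds du), (W : Set (Space ds du)) ⊆ P.cones.plus →
      Module.finrank ℝ W = du → ∀ v : Space ds du, (∀ w ∈ W, inner ℝ v w = 0) →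
        ‖v‖ ≤ L * ‖proj v‖ := by
  obtain ⟨δ, hδ, hbound⟩ := P.exists_vert_lower_bound
  refine ⟨⟨1 + δ⁻¹, by positivity⟩, fun W hW hdim v hv => ?_⟩
  have hinj : Function.Injective ((vertL ds du).comp W.subtype) := by
    rw [← LinearMap.ker_eq_bot, LinearMap.ker_eq_bot']
    intro w hw
    have h1 := hbound w (hW w.2)
    have h2 : vert (w : Space ds du) = 0 := hw
    rw [h2, norm_zero] at h1
    have : ‖(w : Space ds du)‖ ≤ 0 := by
      by_contra hc
      push Not at hc
      have := mul_pos hδ hc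
      linarith
    exact Subtype.ext (norm_le_zero_iff.mp this)
  have hsurj := (LinearMap.injective_iff_surjective_of_finrank_eq_finrank
    (by rw [hdim, finrank_euclideanSpace, Fintype.card_fin])).mp hinj
  -- Pick `w ∈ W` with the same vertical part as `v`: orthogonality then reads `‖vert v‖² = -⟪proj
  -- v, proj w⟫`, and the cone bound controls `‖w‖` by `‖vert v‖`.
  obtain ⟨w, hw⟩ := hsurj (vert v)
  have hw' : vert (w : Space ds du) = vert v := hw
  have h0 := hv w w.2
  rw [inner_eq_proj_add_vert, hw', real_inner_self_eq_norm_sq] at h0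
  have h1 : ‖vert v‖ ^ 2 ≤ ‖proj v‖ * ‖proj (w : Space ds du)‖ := by
    have := neg_le_of_abs_le (abs_real_inner_le_norm (proj v) (proj (w : Space ds du)))
    linarith
  have h2 := hbound w (hW w.2)
  rw [hw'] at h2
  have h3 := norm_proj_le (w : Space ds du)
  have h4 : δ * ‖vert v‖ ≤ ‖proj v‖ := by
    rcases (norm_nonneg (vert v)).eq_or_lt with h | h
    · rw [← h, mul_zero]; exact norm_nonneg _
    · have h5 : δ * ‖vert v‖ ^ 2 ≤ ‖proj v‖ * ‖vert v‖ := by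
        calc δ * ‖vert v‖ ^ 2 ≤ δ * (‖proj v‖ * ‖proj (w : Space ds du)‖) := by gcongr
          _ ≤ ‖proj v‖ * (δ * ‖(w : Space ds du)‖) := by
            rw [mul_left_comm]; gcongr
          _ ≤ _ := by gcongr
      exact le_of_mul_le_mul_right (by linarith [h5, sq (‖vert v‖)]) h
  have h6 : ‖vert v‖ ≤ δ⁻¹ * ‖proj v‖ := by
    rw [inv_mul_eq_div, le_div_iff₀ hδ]; linarith
  calc ‖v‖ ≤ ‖proj v‖ + ‖vert v‖ := norm_le_proj_add_vert v
    _ ≤ (1 + δ⁻¹) * ‖proj v‖ := by linarith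

/-- The inverse of `π₋` on a leaf is Lipschitz, uniformly in the leaf. -/
lemma Params.exists_lipschitzOnWith_leafInv (P : Params ds du) :
    ∃ L : ℝ≥0, ∀ Γ : Set (Space ds du), IsFakeStableLeaf P.r P.cones.plus P.CF Γ →
      LipschitzOnWith L (leafInv Γ) (proj '' Γ) := by
  obtain ⟨L, hL⟩ := P.exists_norm_le_proj
  refine ⟨L, fun Γ hΓ => LipschitzOnWith.of_dist_le_mul fun z hz z' hz' => ?_⟩
  rw [dist_eq_norm, dist_eq_norm]
  rcases eq_or_ne (leafInv Γ z) (leafInv Γ z') with h | h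
  · rw [h, sub_self, norm_zero]; positivity
  · obtain ⟨W, hW, hdim, horth⟩ := hΓ.secant _ (leafInv_mem hz) _ (leafInv_mem hz') h
    have := hL W hW hdim _ horth
    rwa [proj_sub, proj_leafInv hz, proj_leafInv hz'] at this

/-! ### Leaf volume against Lebesgue measure -/

lemma euclideanHausdorffMeasure_image_le {X Y : Type*} [EMetricSpace X] [EMetricSpace Y]
    [MeasurableSpace X] [BorelSpace X] [MeasurableSpace Y] [BorelSpace Y] {L : ℝ≥0} {f : X → Y}
    {s : Set X} (h : LipschitzOnWith L f s) (n : ℕ) :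
    (μHE[n] : Measure Y) (f '' s) ≤ (L : ℝ≥0∞) ^ n * (μHE[n] : Measure X) s := by
  rw [Measure.euclideanHausdorffMeasure_def, Measure.euclideanHausdorffMeasure_def,
    Measure.smul_apply, Measure.smul_apply, mul_smul_comm]
  refine smul_le_smul_of_nonneg_left ?_ zero_le
  simpa using h.hausdorffMeasure_image_le (Nat.cast_nonneg n)

lemma lipschitzWith_proj : LipschitzWith 1 (proj : Space ds du → _) :=
  LipschitzWith.of_dist_le_mul fun x y => by
    rw [dist_eq_norm, dist_eq_norm, ← proj_sub, NNReal.coe_one, one_mul]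
    exact norm_proj_le _

/-- The Riemannian volume of a leaf is at most a uniform multiple of Lebesgue measure. -/
lemma Params.exists_map_leafVolume_le (P : Params ds du) :
    ∃ C : ℝ≥0, ∀ Γ : Set (Space ds du), IsFakeStableLeaf P.r P.cones.plus P.CF Γ →
      (leafVolume Γ).map proj ≤ C • volume := by
  obtain ⟨L, hL⟩ := P.exists_lipschitzOnWith_leafInv
  refine ⟨L ^ ds, fun Γ hΓ => Measure.le_iff.mpr fun S hS => ?_⟩
  rw [Measure.map_apply continuous_proj.measurable hS, leafVolume,
    Measure.restrict_apply (continuous_proj.measurable hS)]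
  have hsub : proj ⁻¹' S ∩ Γ ⊆ leafInv Γ '' (proj '' Γ ∩ S) := by
    rintro x ⟨hxS, hx⟩
    refine ⟨proj x, ⟨⟨x, hx, rfl⟩, hxS⟩, ?_⟩
    exact injOn_proj P hΓ (leafInv_mem ⟨x, hx, rfl⟩) hx (proj_leafInv ⟨x, hx, rfl⟩)
  refine (measure_mono hsub).trans ((euclideanHausdorffMeasure_image_le
    ((hL Γ hΓ).mono Set.inter_subset_left) ds).trans ?_)
  rw [EuclideanSpace.euclideanHausdorffMeasure_eq_volume, Measure.smul_apply, ENNReal.smul_def,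
    smul_eq_mul]
  push_cast
  gcongr
  exact Set.inter_subset_right

/-- Lebesgue measure is at most the Riemannian volume of a leaf that projects onto `ℝ^{ds}`. -/
lemma volume_le_map_leafVolume {Γ : Set (Space ds du)} (hΓ : proj '' Γ = Set.univ) :
    volume ≤ (leafVolume Γ).map proj := by
  refine Measure.le_iff.mpr fun S hS => ?_
  rw [Measure.map_apply continuous_proj.measurable hS, leafVolume,
    Measure.restrict_apply (continuous_proj.measurable hS)]
  have hsub : S ⊆ proj '' (proj ⁻¹' S ∩ Γ) := by
    intro z hz
    obtain ⟨x, hx, rfl⟩ : z ∈ proj '' Γ := by rw [hΓ]; trivial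
    exact ⟨x, ⟨hz, hx⟩, rfl⟩
  have h := euclideanHausdorffMeasure_image_le
    (lipschitzWith_proj.lipschitzOnWith (s := proj ⁻¹' S ∩ Γ)) ds
  rw [EuclideanSpace.euclideanHausdorffMeasure_eq_volume] at h
  exact (measure_mono hsub).trans (by simpa using h)

/-! ### Flat leaves -/

/-- The derivative is a constant linear isometry: order one contributes at most `1`, higher orders
and the Hölder quotient vanish. Translations cost nothing because the order `0` is not counted. -/
lemma derivNorm_one_le_of_isometry {E : Type*} [NormedAddCommGroup E] [NormedSpace ℝ E] {r : ℝ}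
    (hr : 1 ≤ r) {f : E → E} {U : E →ₗᵢ[ℝ] E} (hf : ∀ x y, f x - f y = U (x - y)) (S : Set E) :
    derivNorm 1 r S f ≤ 1 := by
  have hderiv : fderiv ℝ f = fun _ => U.toContinuousLinearMap := by
    ext1 x
    have h1 : f = fun y => U.toContinuousLinearMap y + (f x - U x) := by
      ext1 y
      have := hf y x
      rw [map_sub] at this
      simp only [LinearIsometry.coe_toContinuousLinearMap]
      rw [add_sub_left_comm, ← this]; abel
    rw [h1, fderiv_add_const]
    exact ContinuousLinearMap.fderiv _
  have hhigh : ∀ k : ℕ, iteratedFDeriv ℝ (k + 2) f = 0 := by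
    intro k
    ext1 x
    rw [Pi.zero_apply, ← norm_eq_zero, ← norm_iteratedFDeriv_fderiv, hderiv,
      iteratedFDeriv_succ_const]
    simp
  have hone : ∀ x, ‖iteratedFDeriv ℝ 1 f x‖ ≤ 1 := by
    intro x
    rw [← norm_iteratedFDeriv_fderiv, hderiv, norm_iteratedFDeriv_zero]
    exact U.norm_toContinuousLinearMap_le
  have hconst : ∀ (k : ℕ) x y, 1 ≤ k → iteratedFDeriv ℝ k f x = iteratedFDeriv ℝ k f y := by
    intro k x y hk
    obtain ⟨k, rfl⟩ := Nat.exists_eq_add_of_le' hk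
    simp only [iteratedFDeriv_succ_eq_comp_right, Function.comp_apply, hderiv]
    cases k with
    | zero => congr 1
    | succ k => rw [iteratedFDeriv_succ_const]; rfl
  unfold derivNorm
  have hfl : 1 ≤ ⌊r⌋₊ := Nat.one_le_floor_iff r |>.mpr hr
  have hsum : ∑ k ∈ Finset.Icc 1 ⌊r⌋₊, ⨆ x ∈ S, ‖iteratedFDeriv ℝ k f x‖ₑ ≤ 1 := by
    calc _ ≤ ∑ k ∈ Finset.Icc 1 ⌊r⌋₊, if k = 1 then (1 : ℝ≥0∞) else 0 := by
          refine Finset.sum_le_sum fun k hk => iSup₂_le fun x _ => ?_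
          split_ifs with h
          · rw [h, ← ofReal_norm]
            exact ENNReal.ofReal_le_one.mpr (hone x)
          · obtain ⟨j, rfl⟩ : ∃ j, k = j + 2 :=
              ⟨k - 2, by have := (Finset.mem_Icc.mp hk).1; omega⟩
            rw [hhigh, Pi.zero_apply, ← ofReal_norm, norm_zero, ENNReal.ofReal_zero]
      _ ≤ 1 := by rw [Finset.sum_ite_eq']; split_ifs <;> simp
  have hhol : (open Classical in if (⌊r⌋₊ : ℝ) = r then (0 : ℝ≥0∞) else
      ⨆ x ∈ S, ⨆ y ∈ S, ⨆ _ : x ≠ y,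
        ‖iteratedFDeriv ℝ ⌊r⌋₊ f x - iteratedFDeriv ℝ ⌊r⌋₊ f y‖ₑ /
          ENNReal.ofReal (‖x - y‖ ^ (r - ⌊r⌋₊))) = 0 := by
    split_ifs
    · rfl
    · simp only [ENNReal.iSup_eq_zero]
      intro x _ y _ _
      rw [hconst _ x y hfl, sub_self, ← ofReal_norm, norm_zero, ENNReal.ofReal_zero,
        ENNReal.zero_div]
  rw [hhol, add_zero]
  exact hsum

/-- The affine subspace through `x` normal to `W`. -/
def flatLeaf (W : Submodule ℝ (Space ds du)) (x : Space ds du) : Set (Space ds du) :=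
  {y | y - x ∈ Wᗮ}

lemma finrank_orthogonal_eq {W : Submodule ℝ (Space ds du)} (hdim : Module.finrank ℝ W = du) :
    Module.finrank ℝ Wᗮ = ds := by
  have := W.finrank_add_finrank_orthogonal
  rw [hdim, finrank_euclideanSpace, Fintype.card_sum, Fintype.card_fin, Fintype.card_fin] at this
  omega

/-- Both subspaces have dimension `ds`, and a linear isometry between them extends to the whole
space. -/
lemma exists_isometry_orthogonal_horizontal {W : Submodule ℝ (Space ds du)}
    (hdim : Module.finrank ℝ W = du) :
    ∃ U : Space ds du ≃ₗᵢ[ℝ] Space ds du, ∀ x, x ∈ Wᗮ ↔ U x ∈ horizontal ds du := by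
  let b₁ := stdOrthonormalBasis ℝ Wᗮ
  let b₂ := stdOrthonormalBasis ℝ (horizontal ds du)
  let e : Wᗮ ≃ₗᵢ[ℝ] horizontal ds du := b₁.equiv b₂
    (finCongr (by rw [finrank_orthogonal_eq hdim, finrank_horizontal]))
  let U₀ : Wᗮ →ₗᵢ[ℝ] Space ds du := (horizontal ds du).subtypeₗᵢ.comp e.toLinearIsometry
  refine ⟨U₀.extend.toLinearIsometryEquiv rfl, fun x => ⟨fun hx => ?_, fun hx => ?_⟩⟩
  · have : U₀.extend x = U₀ ⟨x, hx⟩ := U₀.extend_apply ⟨x, hx⟩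
    rw [LinearIsometry.coe_toLinearIsometryEquiv, this]
    exact (e ⟨x, hx⟩).2
  · rw [LinearIsometry.coe_toLinearIsometryEquiv] at hx
    obtain ⟨y, hy⟩ := e.surjective ⟨_, hx⟩
    have h1 : U₀.extend y = U₀.extend x := by
      rw [U₀.extend_apply]
      exact congrArg Subtype.val hy
    have h2 := U₀.extend.injective h1
    rw [← h2]
    exact y.2

/-- One global chart, a translation followed by a linear isometry, serves at every point, and `1 ≤
C_F` bounds its norm. Secants lie in `Wᗮ`, so `W` itself is the required normal subspace. -/
lemma Params.isFakeStableLeaf_flatLeaf (P : Params ds du) {W : Submodule ℝ (Space ds du)}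
    (hW : (W : Set (Space ds du)) ⊆ P.cones.plus) (hdim : Module.finrank ℝ W = du)
    (x : Space ds du) : IsFakeStableLeaf P.r P.cones.plus P.CF (flatLeaf W x) := by
  obtain ⟨U, hU⟩ := exists_isometry_orthogonal_horizontal hdim
  refine ⟨fun w _ => ?_, fun y hy z hz _ => ⟨W, hW, hdim, fun w hw => ?_⟩⟩
  · have hCF : (1 : ℝ≥0∞) ≤ ENNReal.ofReal P.CF := by
      rw [← ENNReal.ofReal_one]; exact ENNReal.ofReal_le_ofReal P.one_le_CF
    refine ⟨((Homeomorph.subRight x).trans U.toHomeomorph).toOpenPartialHomeomorph, ?_, ?_, ?_,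
      ?_, ?_, ?_⟩
    · simp
    · exact (U.contDiff.comp (contDiff_id.sub contDiff_const)).contDiffOn
    · exact (U.symm.contDiff.add contDiff_const).contDiffOn
    · exact fun y _ => hU (y - x)
    · refine (derivNorm_one_le_of_isometry P.one_lt_r.le (U := U.toLinearIsometry)
        (fun y z => ?_) _).trans hCF
      change U (y - x) - U (z - x) = U (y - z)
      rw [← map_sub]; congr 1; abel
    · refine (derivNorm_one_le_of_isometry P.one_lt_r.le (U := U.symm.toLinearIsometry)
        (fun y z => ?_) _).trans hCF
      change (U.symm y + x) - (U.symm z + x) = U.symm (y - z)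
      rw [map_sub]; abel
  · have h : y - z ∈ Wᗮ := by
      have := Wᗮ.sub_mem hy hz
      simpa using this
    exact (Submodule.mem_orthogonal' W _).mp h w hw

/-- A linear parametrisation of `Wᗮ` by `ℝ^{ds}`, inverse to `π₋`. -/
lemma Params.exists_section (P : Params ds du) {W : Submodule ℝ (Space ds du)}
    (hW : (W : Set (Space ds du)) ⊆ P.cones.plus) (hdim : Module.finrank ℝ W = du) :
    ∃ A : EuclideanSpace ℝ (Fin ds) →L[ℝ] Space ds du,
      (∀ z, proj (A z) = z) ∧ ∀ z, A z ∈ Wᗮ := by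
  obtain ⟨L, hL⟩ := P.exists_norm_le_proj
  have hinj : Function.Injective ((projL ds du).comp Wᗮ.subtype) := by
    rw [← LinearMap.ker_eq_bot, LinearMap.ker_eq_bot']
    intro v hv
    have h1 := hL W hW hdim v ((Submodule.mem_orthogonal' W _).mp v.2)
    have h2 : proj (v : Space ds du) = 0 := hv
    rw [h2, norm_zero, mul_zero] at h1
    exact Subtype.ext (norm_le_zero_iff.mp h1)
  let e := LinearEquiv.ofInjectiveOfFinrankEq ((projL ds du).comp Wᗮ.subtype) hinj
    (by rw [finrank_orthogonal_eq hdim, finrank_euclideanSpace, Fintype.card_fin])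
  refine ⟨(Wᗮ.subtype.comp e.symm.toLinearMap).toContinuousLinearMap, fun z => ?_, fun z => ?_⟩
  · exact e.apply_symm_apply z
  · exact (e.symm z).2

lemma proj_image_flatLeaf {W : Submodule ℝ (Space ds du)}
    {A : EuclideanSpace ℝ (Fin ds) →L[ℝ] Space ds du} (hA : ∀ z, proj (A z) = z)
    (hAW : ∀ z, A z ∈ Wᗮ) (x : Space ds du) : proj '' flatLeaf W x = Set.univ := by
  refine Set.eq_univ_of_forall fun z => ⟨x + A (z - proj x), ?_, ?_⟩
  · change x + A (z - proj x) - x ∈ Wᗮ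
    rw [add_sub_cancel_left]; exact hAW _
  · have := (projL ds du).map_add x (A (z - proj x))
    simp only [projL_apply, hA] at this
    rw [this]; abel

/-- Expressed from a base point `w` of the leaf, this turns the leaf operator at `w` into an average
along the range of `A`. -/
lemma Params.leafInv_flatLeaf (P : Params ds du) {W : Submodule ℝ (Space ds du)}
    (hW : (W : Set (Space ds du)) ⊆ P.cones.plus) (hdim : Module.finrank ℝ W = du)
    {A : EuclideanSpace ℝ (Fin ds) →L[ℝ] Space ds du} (hA : ∀ z, proj (A z) = z)
    (hAW : ∀ z, A z ∈ Wᗮ) {x w : Space ds du} (hw : w ∈ flatLeaf W x)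
    (z : EuclideanSpace ℝ (Fin ds)) :
    leafInv (flatLeaf W x) z = w - A (proj w - z) := by
  have hΓ := P.isFakeStableLeaf_flatLeaf hW hdim x
  have hz : z ∈ proj '' flatLeaf W x := by rw [proj_image_flatLeaf hA hAW]; trivial
  refine injOn_proj P hΓ (leafInv_mem hz) ?_ ?_
  · change w - A (proj w - z) - x ∈ Wᗮ
    rw [sub_right_comm]
    exact Wᗮ.sub_mem hw (hAW _)
  · rw [proj_leafInv hz, proj_sub, hA]; abel

end Geometry

/-! ### The bound by the `C^u` norm -/

section UpperBound

/-- For values at most `1` one has `|f| ^ p ≤ |f|`, and the root `1 / p ≤ 1` does not increase a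
number at least `1`. All exponents are thus reduced to an integral. -/
lemma eLpNorm_le_max_of_enorm_le_one {α : Type*} [MeasurableSpace α] {μ : Measure α} {f : α → ℝ}
    (hf : ∀ x, ‖f x‖ₑ ≤ 1) {p : ℝ≥0∞} (hp : 1 ≤ p) :
    eLpNorm f p μ ≤ max 1 (∫⁻ x, ‖f x‖ₑ ∂μ) := by
  rcases eq_or_ne p ⊤ with rfl | hp'
  · refine le_max_of_le_left ?_
    rw [eLpNorm_exponent_top]
    exact essSup_le_of_ae_le _ (.of_forall hf)
  · have hp0 : p ≠ 0 := (zero_lt_one.trans_le hp).ne'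
    have hp1 : 1 ≤ p.toReal := by
      rw [← ENNReal.toReal_one]
      exact ENNReal.toReal_mono hp' hp
    rw [eLpNorm_eq_lintegral_rpow_enorm_toReal hp0 hp']
    calc (∫⁻ x, ‖f x‖ₑ ^ p.toReal ∂μ) ^ (1 / p.toReal)
        ≤ (max 1 (∫⁻ x, ‖f x‖ₑ ∂μ)) ^ (1 / p.toReal) := by
          gcongr
          refine le_max_of_le_right (lintegral_mono fun x => ?_)
          exact ENNReal.rpow_le_self_of_le_one (hf x) hp1
      _ ≤ _ := by
          refine (ENNReal.rpow_le_rpow_of_exponent_le (le_max_left _ _) ?_).trans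
            (ENNReal.rpow_one _).le
          rw [div_le_one (by linarith)]
          exact hp1

/-- The polynomial weight on `ℝ^{ds}` used for functions on leaves. -/
def leafWeight (z : EuclideanSpace ℝ (Fin ds)) : ℝ := ((1 + ‖z‖) ^ (ds + 1))⁻¹

lemma leafWeight_nonneg (z : EuclideanSpace ℝ (Fin ds)) : 0 ≤ leafWeight z := by
  unfold leafWeight; positivity

lemma leafWeight_le_one (z : EuclideanSpace ℝ (Fin ds)) : leafWeight z ≤ 1 :=
  inv_le_one_of_one_le₀ (one_le_pow₀ (by linarith [norm_nonneg z]))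

lemma continuous_leafWeight : Continuous (leafWeight : EuclideanSpace ℝ (Fin ds) → ℝ) := by
  unfold leafWeight
  refine Continuous.inv₀ (by fun_prop) fun z => by positivity

lemma integrable_inv_one_add_pow {V : Type*} [NormedAddCommGroup V] [NormedSpace ℝ V]
    [FiniteDimensional ℝ V] [MeasureSpace V] [BorelSpace V]
    [(volume : Measure V).IsAddHaarMeasure] :
    Integrable fun z : V => ((1 + ‖z‖) ^ (Module.finrank ℝ V + 1))⁻¹ := by
  have h := integrable_one_add_norm (E := V) (μ := volume) (r := (Module.finrank ℝ V : ℝ) + 1)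
    (by linarith)
  refine h.congr (.of_forall fun z => ?_)
  simp only
  rw [Real.rpow_neg (by positivity), ← Real.rpow_natCast]
  push_cast
  rfl

lemma integrable_leafWeight : Integrable (leafWeight : EuclideanSpace ℝ (Fin ds) → ℝ) := by
  have := integrable_inv_one_add_pow (V := EuclideanSpace ℝ (Fin ds))
  rw [finrank_euclideanSpace, Fintype.card_fin] at this
  exact this

lemma Cutoff.leafOp_eq_kernel (χ : Cutoff) (Γ : Set (Space ds du)) (l : ℕ) (f : Space ds du → ℂ)
    (w : Space ds du) : χ.leafOp Γ l f w =
      ∫ z in proj '' Γ, (𝓕⁻ (χ.symbol (EuclideanSpace ℝ (Fin ds)) l)) (proj w - z) *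
        f (leafInv Γ z) := by
  rw [χ.leafOp_eq, ← integral_const_mul]
  simp only [← mul_assoc, χ.kernel_eq]

/-- The weight is submultiplicative: `1 + ‖proj w‖ ≤ (1 + ‖proj w - z‖) * (1 + ‖z‖)`, and `‖z‖` is
at most the norm of the leaf point above `z`. The first factor is absorbed by the kernel, uniformly
in `l`, the second by the decay of `f`. -/
lemma Params.norm_leafOp_le (P : Params ds du) :
    ∃ C : ℝ, 0 ≤ C ∧ ∀ Γ : Set (Space ds du), IsFakeStableLeaf P.r P.cones.plus P.CF Γ →
      ∀ (B : ℝ) (f : Space ds du → ℂ), (∀ x, ‖f x‖ * (1 + ‖x‖) ^ (ds + 1) ≤ B) →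
        ∀ (l : ℕ) (w : Space ds du), ‖P.χ.leafOp Γ l f w‖ ≤ C * B * leafWeight (proj w) := by
  obtain ⟨C, hC, hker⟩ := P.χ.integral_kernel_weight_le (V := EuclideanSpace ℝ (Fin ds)) (ds + 1)
  refine ⟨C, hC, fun Γ hΓ B f hf l w => ?_⟩
  have hB : 0 ≤ B := le_trans (by positivity) (hf 0)
  rw [P.χ.leafOp_eq_kernel]
  have hint := (integrable_one_add_pow_mul
    (𝓕⁻ (P.χ.symbol (EuclideanSpace ℝ (Fin ds)) l)) (ds + 1)).comp_sub_left (proj w)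
  have hint' := hint.const_mul (B * leafWeight (proj w))
  refine (norm_integral_le_of_norm_le hint'.restrict
    ((ae_restrict_mem (measurableSet_image hΓ)).mono fun z hz => ?_)).trans
    ((setIntegral_le_integral hint' (.of_forall fun z => ?_)).trans ?_)
  · rw [norm_mul]
    have h1 : 1 + ‖proj w‖ ≤ (1 + ‖proj w - z‖) * (1 + ‖leafInv Γ z‖) := by
      have h2 : ‖z‖ ≤ ‖leafInv Γ z‖ := by
        conv_lhs => rw [← proj_leafInv hz]
        exact norm_proj_le _
      have h3 : ‖proj w‖ ≤ ‖proj w - z‖ + ‖z‖ := by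
        simpa using norm_add_le (proj w - z) z
      nlinarith [mul_nonneg (norm_nonneg (proj w - z)) (norm_nonneg (leafInv Γ z))]
    have h4 : ‖f (leafInv Γ z)‖ ≤ B * leafWeight (proj w) * (1 + ‖proj w - z‖) ^ (ds + 1) := by
      rw [leafWeight, ← div_eq_mul_inv, div_mul_eq_mul_div, le_div_iff₀ (by positivity)]
      calc _ ≤ ‖f (leafInv Γ z)‖ * ((1 + ‖proj w - z‖) * (1 + ‖leafInv Γ z‖)) ^ (ds + 1) := by
            gcongr
        _ = (‖f (leafInv Γ z)‖ * (1 + ‖leafInv Γ z‖) ^ (ds + 1)) *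
            (1 + ‖proj w - z‖) ^ (ds + 1) := by rw [mul_pow]; ring
        _ ≤ _ := by gcongr; exact hf _
    calc _ ≤ ‖(𝓕⁻ (P.χ.symbol (EuclideanSpace ℝ (Fin ds)) l)) (proj w - z)‖ *
          (B * leafWeight (proj w) * (1 + ‖proj w - z‖) ^ (ds + 1)) := by gcongr
      _ = _ := by ring
  · have := leafWeight_nonneg (proj w)
    simp only [Pi.zero_apply]
    positivity
  · have he := integral_sub_left_eq_self (fun y : EuclideanSpace ℝ (Fin ds) => (1 + ‖y‖) ^ (ds + 1) *
      ‖(𝓕⁻ (P.χ.symbol (EuclideanSpace ℝ (Fin ds)) l) : 𝓢(EuclideanSpace ℝ (Fin ds), ℂ)) y‖)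
      volume (proj w)
    rw [integral_const_mul, he]
    have := mul_le_mul_of_nonneg_left (hker l) (mul_nonneg hB (leafWeight_nonneg (proj w)))
    linarith

/-- The projected weight is at most `1` and integrable over every leaf with a common bound, because
leaf volumes project to measures below a fixed multiple of Lebesgue measure. -/
lemma Params.eLpNorm_leafOp_le (P : Params ds du) :
    ∃ C : ℝ, 0 ≤ C ∧ ∀ Γ : Set (Space ds du), IsFakeStableLeaf P.r P.cones.plus P.CF Γ →
      ∀ (B : ℝ) (f : Space ds du → ℂ), (∀ x, ‖f x‖ * (1 + ‖x‖) ^ (ds + 1) ≤ B) →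
        ∀ l : ℕ, eLpNorm (P.χ.leafOp Γ l f) P.p (leafVolume Γ) ≤ ENNReal.ofReal (C * B) := by
  obtain ⟨C, hC, hpt⟩ := P.norm_leafOp_le
  obtain ⟨D, hD⟩ := P.exists_map_leafVolume_le
  set I : ℝ≥0∞ := max 1 (D * ∫⁻ z : EuclideanSpace ℝ (Fin ds), ‖leafWeight z‖ₑ) with hI
  have hItop : I ≠ ⊤ := by
    refine (max_lt ENNReal.one_lt_top (ENNReal.mul_lt_top ENNReal.coe_lt_top ?_)).ne
    exact integrable_leafWeight.2
  refine ⟨C * I.toReal, by positivity, fun Γ hΓ B f hf l => ?_⟩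
  have hB : 0 ≤ B := le_trans (by positivity) (hf 0)
  have h1 : eLpNorm (fun w : Space ds du => leafWeight (proj w)) P.p (leafVolume Γ) ≤ I := by
    refine (eLpNorm_le_max_of_enorm_le_one (fun w => ?_) P.one_le_p).trans (max_le_max le_rfl ?_)
    · rw [← ofReal_norm, Real.norm_of_nonneg (leafWeight_nonneg _)]
      exact ENNReal.ofReal_le_one.mpr (leafWeight_le_one _)
    · have hm : Measurable fun z : EuclideanSpace ℝ (Fin ds) => ‖leafWeight z‖ₑ :=
        continuous_leafWeight.measurable.enorm
      rw [← lintegral_map hm continuous_proj.measurable]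
      refine (lintegral_mono' (hD Γ hΓ) le_rfl).trans ?_
      rw [lintegral_smul_measure]; rfl
  calc eLpNorm (P.χ.leafOp Γ l f) P.p (leafVolume Γ)
      ≤ ENNReal.ofReal (C * B) * eLpNorm (fun w : Space ds du => leafWeight (proj w)) P.p
          (leafVolume Γ) := by
        refine eLpNorm_le_mul_eLpNorm_of_ae_le_mul (.of_forall fun w => ?_) _
        rw [Real.norm_of_nonneg (leafWeight_nonneg _)]
        exact hpt Γ hΓ B f hf l w
    _ ≤ ENNReal.ofReal (C * B) * I := by gcongr
    _ = _ := by
        conv_lhs => rw [← ENNReal.ofReal_toReal hItop]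
        rw [← ENNReal.ofReal_mul (by positivity)]
        congr 1; ring

variable {K : TopologicalSpace.Compacts (Space ds du)}

/-- A function in `C^∞(K)` as a Schwartz function. -/
def toSchwartz (φ : 𝓓_{K}(Space ds du, ℂ)) : 𝓢(Space ds du, ℂ) :=
  φ.hasCompactSupport.toSchwartzMap φ.contDiff

@[simp] lemma coe_toSchwartz (φ : 𝓓_{K}(Space ds du, ℂ)) :
    (toSchwartz φ : Space ds du → ℂ) = φ := rfl

lemma op_eq_multiplier_toSchwartz (χ : Cutoff) (l : ℕ) (φ : 𝓓_{K}(Space ds du, ℂ)) :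
    χ.op l φ = multiplier (χ.symbol _ l) (toSchwartz φ) := by
  rw [← coe_toSchwartz, χ.op_eq_multiplier]

lemma exists_closedBall (K : TopologicalSpace.Compacts (Space ds du)) :
    ∃ ρ : ℝ, 0 ≤ ρ ∧ (K : Set (Space ds du)) ⊆ Metric.closedBall 0 ρ := by
  obtain ⟨ρ, hρ⟩ := K.isCompact.isBounded.subset_closedBall 0
  exact ⟨max ρ 0, le_max_right _ _, hρ.trans (Metric.closedBall_subset_closedBall (le_max_left _ _))⟩

/-- The Littlewood–Paley decay `2 ^ (-l * u)` beats `2 ^ (l * t)`, and the weights `2 ^ (l' * s)` of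
the leaf frequencies are at most `1`. -/
lemma Params.uNorm_le_cNorm (P : Params ds du) (K : TopologicalSpace.Compacts (Space ds du))
    (ht : 0 < P.t) (hs : P.s < 0) {u : ℝ} (hu : P.t < u) :
    ∃ C : ℝ≥0, ∀ φ : 𝓓_{K}(Space ds du, ℂ), P.uNorm φ ≤ C * cNorm u φ := by
  have hu0 : 0 < u := ht.trans hu
  obtain ⟨ρ, hρ, hK⟩ := exists_closedBall K
  obtain ⟨C₁, hC₁, hdecay⟩ := P.χ.norm_symbol_multiplier_le (V := Space ds du) (⌈u⌉₊ - 1)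
    (sub_pos.mpr (ceil_sub_one_lt hu0)) (sub_ceil_sub_one_le u) hρ (ds + 1)
  obtain ⟨C₂, hC₂, hleaf⟩ := P.eLpNorm_leafOp_le
  refine ⟨(C₂ * C₁).toNNReal, fun φ => ?_⟩
  have hfin : cNorm u φ ≠ ⊤ := cNorm_ne_top hu0.le φ.contDiff φ.hasCompactSupport
  set M := (cNorm u φ).toReal with hM
  have hM0 : 0 ≤ M := ENNReal.toReal_nonneg
  have hφ : HolderBound (⌈u⌉₊ - 1) (u - (⌈u⌉₊ - 1 : ℕ)) M (toSchwartz φ) :=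
    holderBound_of_cNorm_ne_top hu0 φ.contDiff hfin
  have hrhs : ((C₂ * C₁).toNNReal : ℝ≥0∞) * cNorm u φ = ENNReal.ofReal (C₂ * C₁ * M) := by
    rw [ENNReal.ofReal_mul (by positivity), hM, ENNReal.ofReal_toReal hfin]
    rfl
  rw [hrhs]
  refine iSup_le fun Γ => iSup_le fun hΓ => iSup_le fun l => ?_
  have hl : ∀ l' : ℕ, eLpNorm (P.χ.leafOp Γ l' (P.χ.op l φ)) P.p (leafVolume Γ) ≤
      ENNReal.ofReal (C₂ * (C₁ * M * (2 : ℝ) ^ (-(l : ℝ) * u))) := by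
    refine hleaf Γ hΓ _ _ fun x => ?_
    have := hdecay M _ hφ (φ.tsupport_subset.trans hK) l x
    rw [op_eq_multiplier_toSchwartz]
    simpa using this
  calc _ ≤ ENNReal.ofReal ((2 : ℝ) ^ ((l : ℝ) * P.t)) *
        ENNReal.ofReal (C₂ * (C₁ * M * (2 : ℝ) ^ (-(l : ℝ) * u))) := by
        gcongr
        refine iSup_le fun l' => ?_
        refine le_trans (mul_le_of_le_one_left zero_le ?_) (hl l')
        refine ENNReal.ofReal_le_one.mpr (Real.rpow_le_one_of_one_le_of_nonpos one_le_two ?_)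
        exact mul_nonpos_of_nonneg_of_nonpos (Nat.cast_nonneg _) hs.le
    _ ≤ _ := by
        rw [← ENNReal.ofReal_mul (by positivity)]
        refine ENNReal.ofReal_le_ofReal ?_
        have h1 : (2 : ℝ) ^ ((l : ℝ) * P.t) * (2 : ℝ) ^ (-(l : ℝ) * u) ≤ 1 := by
          rw [← Real.rpow_add zero_lt_two]
          refine Real.rpow_le_one_of_one_le_of_nonpos one_le_two ?_
          nlinarith [(Nat.cast_nonneg l : (0 : ℝ) ≤ l)]
        calc _ = C₂ * C₁ * M * ((2 : ℝ) ^ ((l : ℝ) * P.t) * (2 : ℝ) ^ (-(l : ℝ) * u)) := by ring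
          _ ≤ _ := mul_le_of_le_one_right (by positivity) h1

lemma Params.uNorm_lt_top (P : Params ds du) (ht : 0 < P.t) (hs : P.s < 0)
    (φ : 𝓓_{K}(Space ds du, ℂ)) : P.uNorm φ < ⊤ := by
  obtain ⟨C, hC⟩ := P.uNorm_le_cNorm K ht hs (lt_add_one P.t)
  refine (hC φ).trans_lt (ENNReal.mul_lt_top ENNReal.coe_lt_top ?_)
  exact (cNorm_ne_top (by linarith) φ.contDiff φ.hasCompactSupport).lt_top

end UpperBound

/-! ### Estimates on flat leaves -/

section FlatLeaf

variable {K : TopologicalSpace.Compacts (Space ds du)}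

/-- Along a flat leaf the operator averages over translates by `A z`, so on the Fourier side it
multiplies by the symbol evaluated at `A.adjoint ξ`, the leaf frequency of `ξ`. -/
lemma Params.leafOp_flatLeaf (P : Params ds du) {W : Submodule ℝ (Space ds du)}
    (hW : (W : Set (Space ds du)) ⊆ P.cones.plus) (hdim : Module.finrank ℝ W = du)
    {A : EuclideanSpace ℝ (Fin ds) →L[ℝ] Space ds du} (hA : ∀ z, proj (A z) = z)
    (hAW : ∀ z, A z ∈ Wᗮ) {x w : Space ds du} (hw : w ∈ flatLeaf W x) (F : 𝓢(Space ds du, ℂ))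
    (l : ℕ) : P.χ.leafOp (flatLeaf W x) l (𝓕⁻ F : 𝓢(Space ds du, ℂ)) w =
      ∫ ξ, Complex.exp ((2 * Real.pi * inner ℝ ξ w : ℝ) * Complex.I) *
        (F ξ * P.χ.symbol (EuclideanSpace ℝ (Fin ds)) l (A.adjoint ξ)) := by
  set k : 𝓢(EuclideanSpace ℝ (Fin ds), ℂ) := 𝓕⁻ (P.χ.symbol (EuclideanSpace ℝ (Fin ds)) l) with hk
  have hkF : ∀ ξ, 𝓕 (k : EuclideanSpace ℝ (Fin ds) → ℂ) ξ = P.χ.symbol _ l ξ := fun ξ => by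
    rw [hk, fourierInv_coe, fourier_fourierInv_apply]
  have h := integral_mul_fourierInv_sub A k F w
  simp only [hkF] at h
  rw [← h, P.χ.leafOp_eq_kernel, proj_image_flatLeaf hA hAW, Measure.restrict_univ]
  simp only [P.leafInv_flatLeaf hW hdim hA hAW hw, ← hk]
  exact integral_sub_left_eq_self (fun z => k z * (𝓕⁻ F : 𝓢(Space ds du, ℂ)) (w - A z)) volume
    (proj w)

/-- The symbols telescope to a low-pass symbol, which is `1` at all leaf frequencies that occur in
`F`. -/
lemma Params.sum_leafOp_flatLeaf (P : Params ds du) {W : Submodule ℝ (Space ds du)}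
    (hW : (W : Set (Space ds du)) ⊆ P.cones.plus) (hdim : Module.finrank ℝ W = du)
    {A : EuclideanSpace ℝ (Fin ds) →L[ℝ] Space ds du} (hA : ∀ z, proj (A z) = z)
    (hAW : ∀ z, A z ∈ Wᗮ) {x w : Space ds du} (hw : w ∈ flatLeaf W x) (F : 𝓢(Space ds du, ℂ))
    (L : ℕ) (hF : ∀ ξ, F ξ ≠ 0 → 2 * Real.pi * ‖A.adjoint ξ‖ ≤ 2 ^ L) :
    ∑ l ∈ Finset.range (L + 1), P.χ.leafOp (flatLeaf W x) l (𝓕⁻ F : 𝓢(Space ds du, ℂ)) w =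
      (𝓕⁻ F : 𝓢(Space ds du, ℂ)) w := by
  simp only [P.leafOp_flatLeaf hW hdim hA hAW hw]
  rw [← integral_finsetSum]
  · rw [fourierInv_apply']
    congr 1
    ext ξ
    rw [← Finset.mul_sum, ← Finset.mul_sum]
    congr 1
    have hs := congrArg (fun m => m (A.adjoint ξ))
      (P.χ.sum_symbol (V := EuclideanSpace ℝ (Fin ds)) L)
    simp only [sum_apply] at hs
    rw [hs]
    by_cases h0 : F ξ = 0
    · rw [h0, zero_mul]
    · rw [P.χ.low_eq_one _ (hF ξ h0), mul_one]
  · intro l _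
    refine Integrable.bdd_mul (c := 1) ?_ (Continuous.aestronglyMeasurable (by fun_prop)) ?_
    · exact (F.integrable (μ := volume)).mul_bdd
        (c := SchwartzMap.seminorm ℝ 0 0 (P.χ.symbol (EuclideanSpace ℝ (Fin ds)) l))
        (Continuous.aestronglyMeasurable (by fun_prop))
        (.of_forall fun ξ => SchwartzMap.norm_le_seminorm ℝ _ _)
    · exact .of_forall fun ξ => (Complex.norm_exp_ofReal_mul_I _).le

lemma Params.eLpNorm_leafOp_op_le (P : Params ds du) {Γ : Set (Space ds du)}
    (hΓ : IsFakeStableLeaf P.r P.cones.plus P.CF Γ) (f : Space ds du → ℂ) (l l' : ℕ) :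
    eLpNorm (P.χ.leafOp Γ l' (P.χ.op l f)) P.p (leafVolume Γ) ≤
      ENNReal.ofReal ((2 : ℝ) ^ (-(l : ℝ) * P.t) * (2 : ℝ) ^ (-(l' : ℝ) * P.s)) * P.uNorm f := by
  have h : ENNReal.ofReal ((2 : ℝ) ^ ((l : ℝ) * P.t)) * (ENNReal.ofReal ((2 : ℝ) ^ ((l' : ℝ) * P.s)) *
      eLpNorm (P.χ.leafOp Γ l' (P.χ.op l f)) P.p (leafVolume Γ)) ≤ P.uNorm f := by
    refine le_trans ?_ (le_iSup_of_le Γ (le_iSup_of_le hΓ (le_iSup_of_le l le_rfl)))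
    gcongr
    exact le_iSup (fun l' : ℕ => ENNReal.ofReal ((2 : ℝ) ^ ((l' : ℝ) * P.s)) *
      eLpNorm (P.χ.leafOp Γ l' (P.χ.op l f)) P.p (leafVolume Γ)) l'
  refine le_trans (le_of_eq ?_) (mul_le_mul_right h
    (ENNReal.ofReal ((2 : ℝ) ^ (-(l : ℝ) * P.t) * (2 : ℝ) ^ (-(l' : ℝ) * P.s))))
  rw [← mul_assoc, ← mul_assoc, ← ENNReal.ofReal_mul (by positivity),
    ← ENNReal.ofReal_mul (by positivity)]
  have : (2 : ℝ) ^ (-(l : ℝ) * P.t) * (2 : ℝ) ^ (-(l' : ℝ) * P.s) * (2 : ℝ) ^ ((l : ℝ) * P.t) *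
      (2 : ℝ) ^ ((l' : ℝ) * P.s) = 1 := by
    rw [← Real.rpow_add zero_lt_two, ← Real.rpow_add zero_lt_two, ← Real.rpow_add zero_lt_two]
    ring_nf
    exact Real.rpow_zero 2
  rw [this, ENNReal.ofReal_one, one_mul]

/-- For negative `s` the geometric ratio `2 ^ (-s)` exceeds `1`, so the last term dominates. -/
lemma sum_rpow_le {s : ℝ} (hs : s < 0) (L : ℕ) :
    ∑ l ∈ Finset.range (L + 1), (2 : ℝ) ^ (-(l : ℝ) * s) ≤
      (2 : ℝ) ^ (-s) / ((2 : ℝ) ^ (-s) - 1) * (2 : ℝ) ^ (-(L : ℝ) * s) := by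
  have hq : 1 < (2 : ℝ) ^ (-s) := Real.one_lt_rpow one_lt_two (by linarith)
  have hpow : ∀ l : ℕ, (2 : ℝ) ^ (-(l : ℝ) * s) = ((2 : ℝ) ^ (-s)) ^ l := by
    intro l
    rw [← Real.rpow_natCast, ← Real.rpow_mul zero_le_two]
    congr 1; ring
  simp only [hpow]
  rw [geom_sum_eq hq.ne', div_mul_eq_mul_div]
  have : 0 < (2 : ℝ) ^ (-s) - 1 := by linarith
  gcongr
  rw [pow_succ]
  linarith

/-- The restrictions of `ψ_l^{Op} φ` to flat leaves, in `L_p`. -/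
lemma Params.eLpNorm_op_flatLeaf_le (P : Params ds du) (hs : P.s < 0)
    {W : Submodule ℝ (Space ds du)} (hW : (W : Set (Space ds du)) ⊆ P.cones.plus)
    (hdim : Module.finrank ℝ W = du) {A : EuclideanSpace ℝ (Fin ds) →L[ℝ] Space ds du}
    (hA : ∀ z, proj (A z) = z) (hAW : ∀ z, A z ∈ Wᗮ) :
    ∃ C : ℝ, 0 ≤ C ∧ ∀ (K : TopologicalSpace.Compacts (Space ds du)) (φ : 𝓓_{K}(Space ds du, ℂ))
      (l : ℕ) (x : Space ds du),
      eLpNorm (P.χ.op l φ) P.p (leafVolume (flatLeaf W x)) ≤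
        ENNReal.ofReal (C * (2 : ℝ) ^ (-(l : ℝ) * (P.t + P.s))) * P.uNorm φ := by
  -- `k₀` measures how much the adjoint of `A` can raise frequencies: a block of index `l` lives
  -- below `2 ^ (l + 1)`, hence its leaf frequencies lie below `2 ^ (l + k₀)`. The shift reappears
  -- in the constant as `2 ^ (-k₀ * s)`.
  obtain ⟨k₀, hk₀⟩ := pow_unbounded_of_one_lt (2 * ‖A.adjoint‖) one_lt_two
  have hq : 1 < (2 : ℝ) ^ (-P.s) := Real.one_lt_rpow one_lt_two (by linarith)
  set D := (2 : ℝ) ^ (-P.s) / ((2 : ℝ) ^ (-P.s) - 1) with hD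
  have hD0 : 0 ≤ D := div_nonneg (by linarith) (by linarith)
  refine ⟨D * (2 : ℝ) ^ (-(k₀ : ℝ) * P.s), by positivity, fun K φ l x => ?_⟩
  have hΓ := P.isFakeStableLeaf_flatLeaf hW hdim x
  set F := schwartzMul (P.χ.symbol _ l) (𝓕 (toSchwartz φ)) with hF
  have hop : P.χ.op l φ = (𝓕⁻ F : 𝓢(Space ds du, ℂ)) := op_eq_multiplier_toSchwartz P.χ l φ
  have hfreq : ∀ ξ, F ξ ≠ 0 → 2 * Real.pi * ‖A.adjoint ξ‖ ≤ 2 ^ (l + k₀) := by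
    intro ξ hξ
    have h1 : 2 * Real.pi * ‖ξ‖ < 2 * 2 ^ l := by
      by_contra hc
      push Not at hc
      refine hξ ?_
      rw [hF, schwartzMul_apply, P.χ.symbol_eq_zero l hc, zero_mul]
    calc 2 * Real.pi * ‖A.adjoint ξ‖ ≤ 2 * Real.pi * (‖A.adjoint‖ * ‖ξ‖) := by
          gcongr; exact A.adjoint.le_opNorm ξ
      _ = ‖A.adjoint‖ * (2 * Real.pi * ‖ξ‖) := by ring
      _ ≤ ‖A.adjoint‖ * (2 * 2 ^ l) := by gcongr
      _ = 2 ^ l * (2 * ‖A.adjoint‖) := by ring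
      _ ≤ 2 ^ l * 2 ^ k₀ := by gcongr
      _ = _ := (pow_add _ _ _).symm
  have hsum : P.χ.op l φ =ᵐ[leafVolume (flatLeaf W x)]
      ∑ l' ∈ Finset.range (l + k₀ + 1), P.χ.leafOp (flatLeaf W x) l' (P.χ.op l φ) := by
    refine (ae_restrict_mem (measurableSet_leaf hΓ)).mono fun w hw => ?_
    rw [Finset.sum_apply, hop]
    exact (P.sum_leafOp_flatLeaf hW hdim hA hAW hw F _ hfreq).symm
  rw [eLpNorm_congr_ae hsum]
  refine (eLpNorm_sum_le (fun l' _ => ((decays_op P.χ l φ).continuous_leafOp P.χ hΓ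
    l').aestronglyMeasurable) P.one_le_p).trans ?_
  refine (Finset.sum_le_sum fun l' _ => P.eLpNorm_leafOp_op_le hΓ φ l l').trans ?_
  rw [← Finset.sum_mul, ← ENNReal.ofReal_sum_of_nonneg fun _ _ => by positivity]
  gcongr
  rw [← Finset.mul_sum]
  calc _ ≤ (2 : ℝ) ^ (-(l : ℝ) * P.t) * (D * (2 : ℝ) ^ (-((l + k₀ : ℕ) : ℝ) * P.s)) := by
        gcongr; exact sum_rpow_le hs _
    _ = D * ((2 : ℝ) ^ (-(l : ℝ) * P.t) * (2 : ℝ) ^ (-((l + k₀ : ℕ) : ℝ) * P.s)) := by ring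
    _ = _ := by
        rw [mul_assoc, ← Real.rpow_add zero_lt_two, ← Real.rpow_add zero_lt_two]
        congr 2
        push_cast; ring

/-- Local integrals over flat leaves are controlled by `L_p` norms. -/
lemma lintegral_ball_flatLeaf_le {W : Submodule ℝ (Space ds du)}
    {A : EuclideanSpace ℝ (Fin ds) →L[ℝ] Space ds du} (hA : ∀ z, proj (A z) = z)
    (hAW : ∀ z, A z ∈ Wᗮ) {p : ℝ≥0∞} (hp : 1 ≤ p) (x : Space ds du)
    (hmeas : MeasurableSet (flatLeaf W x)) (hinj : Set.InjOn proj (flatLeaf W x))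
    {f : Space ds du → ℂ} (hf : Continuous f) :
    ∫⁻ z in Metric.ball (0 : EuclideanSpace ℝ (Fin ds)) 1, ‖f (x + A z)‖ₑ ≤
      eLpNorm f p (leafVolume (flatLeaf W x)) *
        volume (Metric.ball (0 : EuclideanSpace ℝ (Fin ds)) 1) ^ (1 - 1 / p.toReal) := by
  -- The function `f` on the leaf, read in the coordinate given by the projection.
  set h : EuclideanSpace ℝ (Fin ds) → ℂ := fun z => f (x + A (z - proj x)) with hh
  have hc : Continuous h := by fun_prop
  have h1 : eLpNorm h p volume ≤ eLpNorm f p (leafVolume (flatLeaf W x)) := by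
    refine (eLpNorm_mono_measure h
      (volume_le_map_leafVolume (proj_image_flatLeaf hA hAW x))).trans (le_of_eq ?_)
    rw [eLpNorm_map_measure hc.aestronglyMeasurable continuous_proj.aemeasurable]
    refine eLpNorm_congr_ae ((ae_restrict_mem hmeas).mono fun w hw => ?_)
    have : x + A (proj w - proj x) = w := by
      refine hinj ?_ hw ?_
      · change x + A (proj w - proj x) - x ∈ Wᗮ
        rw [add_sub_cancel_left]; exact hAW _
      · have := (projL ds du).map_add x (A (proj w - proj x))
        simp only [projL_apply, hA] at this
        rw [this]; abel
    simp only [hh, Function.comp_apply, this]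
  have h2 : ∫⁻ z in Metric.ball (0 : EuclideanSpace ℝ (Fin ds)) 1, ‖f (x + A z)‖ₑ =
      ∫⁻ z in Metric.ball (0 : EuclideanSpace ℝ (Fin ds)) 1, ‖h (z + proj x)‖ₑ := by
    simp [hh]
  set h' : EuclideanSpace ℝ (Fin ds) → ℂ := fun z => h (z + proj x)
  have h3 : eLpNorm h' p volume = eLpNorm h p volume :=
    eLpNorm_comp_measurePreserving hc.aestronglyMeasurable
      (measurePreserving_add_right volume (proj x))
  rw [h2, ← eLpNorm_one_eq_lintegral_enorm]
  -- Hölder's inequality on the unit ball. For `p = ⊤` the conventions `⊤.toReal = 0` and `1 / 0 =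
  -- 0` give the correct exponent `1`.
  refine (eLpNorm_le_eLpNorm_mul_rpow_measure_univ hp
    (Continuous.aestronglyMeasurable (by fun_prop))).trans ?_
  rw [Measure.restrict_apply_univ, ENNReal.toReal_one, div_one]
  gcongr
  exact (eLpNorm_mono_measure h' Measure.restrict_le_self).trans (h3.trans_le h1)

/-- Averaging over translates of a ball in a linear subspace. -/
lemma lintegral_mul_le_of_ball {V E : Type*} [NormedAddCommGroup V] [NormedSpace ℝ V]
    [FiniteDimensional ℝ V] [MeasureSpace V] [BorelSpace V]
    [(volume : Measure V).IsAddHaarMeasure]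
    [NormedAddCommGroup E] [NormedSpace ℝ E] [FiniteDimensional ℝ E] [MeasureSpace E]
    [BorelSpace E] [(volume : Measure E).IsAddHaarMeasure] (A : E →L[ℝ] V) (N : ℕ) {f g : V → ℂ}
    (hf : Continuous f) (hg : Continuous g) {B : ℝ} (hgB : ∀ x, ‖g x‖ * (1 + ‖x‖) ^ N ≤ B)
    {S : ℝ≥0∞} (hS : ∀ x, ∫⁻ z in Metric.ball (0 : E) 1, ‖f (x + A z)‖ₑ ≤ S) :
    volume (Metric.ball (0 : E) 1) * ∫⁻ x, ‖f x‖ₑ * ‖g x‖ₑ ≤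
      ENNReal.ofReal (B * (1 + ‖A‖) ^ N) * (∫⁻ x : V, ENNReal.ofReal ((1 + ‖x‖) ^ N)⁻¹) * S := by
  have hB : 0 ≤ B := le_trans (by positivity) (hgB 0)
  -- The full integral is invariant under translation by `A z`; average it over `z` in the unit ball
  -- and exchange the integrals, so that the inner one runs along a leaf through `x`.
  calc volume (Metric.ball (0 : E) 1) * ∫⁻ x, ‖f x‖ₑ * ‖g x‖ₑ
      = ∫⁻ z in Metric.ball (0 : E) 1, ∫⁻ x, ‖f (x + A z)‖ₑ * ‖g (x + A z)‖ₑ := by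
        have : ∀ z : E, ∫⁻ x, ‖f (x + A z)‖ₑ * ‖g (x + A z)‖ₑ = ∫⁻ x, ‖f x‖ₑ * ‖g x‖ₑ := fun z =>
          lintegral_add_right_eq_self (fun x => ‖f x‖ₑ * ‖g x‖ₑ) (A z)
        simp only [this, lintegral_const, Measure.restrict_apply_univ]
        rw [mul_comm]
    _ = ∫⁻ x, ∫⁻ z in Metric.ball (0 : E) 1, ‖f (x + A z)‖ₑ * ‖g (x + A z)‖ₑ := by
        refine lintegral_lintegral_swap ?_
        have h1 : Continuous fun p : E × V => f (p.2 + A p.1) := by fun_prop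
        have h2 : Continuous fun p : E × V => g (p.2 + A p.1) := by fun_prop
        exact (h1.measurable.enorm.mul h2.measurable.enorm).aemeasurable
    _ ≤ ∫⁻ x, (ENNReal.ofReal (B * (1 + ‖A‖) ^ N) * ENNReal.ofReal ((1 + ‖x‖) ^ N)⁻¹) * S := by
        refine lintegral_mono fun x => ?_
        calc _ ≤ ∫⁻ z in Metric.ball (0 : E) 1, (ENNReal.ofReal (B * (1 + ‖A‖) ^ N) *
              ENNReal.ofReal ((1 + ‖x‖) ^ N)⁻¹) * ‖f (x + A z)‖ₑ := by
              refine setLIntegral_mono' measurableSet_ball fun z hz => ?_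
              rw [mul_comm]
              gcongr
              rw [← ENNReal.ofReal_mul (by positivity), ← ofReal_norm]
              refine ENNReal.ofReal_le_ofReal ?_
              rw [← div_eq_mul_inv, le_div_iff₀ (by positivity)]
              have hz1 : ‖z‖ ≤ 1 := (mem_ball_zero_iff.mp hz).le
              -- Within the unit ball `A z` has norm at most `‖A‖`, so the weights at `x` and `x + A
              -- z` are comparable and the weight leaves the inner integral.
              have h1 : 1 + ‖x‖ ≤ (1 + ‖x + A z‖) * (1 + ‖A‖) := by
                have h2 : ‖x‖ ≤ ‖x + A z‖ + ‖A z‖ := by simpa using norm_sub_le (x + A z) (A z)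
                have h3 : ‖A z‖ ≤ ‖A‖ := (A.le_opNorm z).trans
                  (mul_le_of_le_one_right (norm_nonneg _) hz1)
                nlinarith [mul_nonneg (norm_nonneg (x + A z)) (norm_nonneg A)]
              calc _ ≤ ‖g (x + A z)‖ * ((1 + ‖x + A z‖) * (1 + ‖A‖)) ^ N := by gcongr
                _ = ‖g (x + A z)‖ * (1 + ‖x + A z‖) ^ N * (1 + ‖A‖) ^ N := by
                    rw [mul_pow]; ring
                _ ≤ _ := by gcongr; exact hgB _
          _ ≤ _ := by
              rw [lintegral_const_mul]
              · gcongr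
                exact hS x
              · exact (Continuous.measurable (by fun_prop : Continuous fun z => f (x + A z))).enorm
    _ = _ := by
        have hm : Measurable fun x : V => ENNReal.ofReal ((1 + ‖x‖) ^ N)⁻¹ := by fun_prop
        rw [lintegral_mul_const _ (hm.const_mul _), lintegral_const_mul _ hm]

end FlatLeaf

/-! ### Pairing with Hölder functions -/

lemma multiplier_sum {V ι : Type*} [NormedAddCommGroup V] [InnerProductSpace ℝ V]
    [FiniteDimensional ℝ V] [MeasurableSpace V] [BorelSpace V] (m : ι → 𝓢(V, ℂ)) (s : Finset ι)
    (f : 𝓢(V, ℂ)) : multiplier (∑ i ∈ s, m i) f = ∑ i ∈ s, multiplier (m i) f := by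
  let T : 𝓢(V, ℂ) →+ 𝓢(V, ℂ) := AddMonoidHom.mk' (fun m => multiplier m f)
    fun m m' => multiplier_add m m' f
  exact map_sum T m s

/-- The pairing of one dyadic block with a Hölder function. -/
lemma Params.norm_integral_multiplier_mul_le (P : Params ds du) (hs : P.s < 0) (m : ℕ) {α : ℝ}
    (hα : 0 < α) (hα1 : α ≤ 1) {ρ : ℝ} (hρ : 0 ≤ ρ) :
    ∃ C : ℝ, 0 ≤ C ∧ ∀ (K : TopologicalSpace.Compacts (Space ds du)) (φ : 𝓓_{K}(Space ds du, ℂ)),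
      P.uNorm φ < ⊤ → ∀ (M : ℝ) (g : 𝓢(Space ds du, ℂ)), HolderBound m α M g →
        tsupport g ⊆ Metric.closedBall 0 ρ → ∀ l : ℕ,
          ‖∫ x, multiplier (P.χ.symbol _ l) (toSchwartz φ) x * g x‖ ≤
            C * (P.uNorm φ).toReal * M * ((2 : ℝ) ^ (-(P.t + P.s + (m + α)))) ^ l := by
  obtain ⟨W, hW, hdim⟩ := P.cones.dim_plus.1
  obtain ⟨A, hA, hAW⟩ := P.exists_section hW hdim
  obtain ⟨C₁, hC₁, hleaf⟩ := P.eLpNorm_op_flatLeaf_le hs hW hdim hA hAW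
  -- The smallest integer exponent that makes the weight integrable over `ℝ^d`.
  set N := Module.finrank ℝ (Space ds du) + 1 with hN
  obtain ⟨C₂, hC₂, hdecay⟩ := P.χ.norm_wideSymbol_multiplier_le (V := Space ds du) m hα hα1 hρ N
  set b := volume (Metric.ball (0 : EuclideanSpace ℝ (Fin ds)) 1) with hb
  have hb0 : b ≠ 0 := (Metric.measure_ball_pos volume _ one_pos).ne'
  have hbt : b ≠ ⊤ := measure_ball_lt_top.ne
  set e := b ^ (1 - 1 / P.p.toReal) with he
  have het : e ≠ ⊤ := ENNReal.rpow_ne_top_of_ne_zero hb0 hbt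
  set I := ∫⁻ x : Space ds du, ENNReal.ofReal ((1 + ‖x‖) ^ N)⁻¹ with hI
  have hIt : I ≠ ⊤ := (integrable_inv_one_add_pow (V := Space ds du)).lintegral_lt_top.ne
  refine ⟨b⁻¹.toReal * (C₂ * (1 + ‖A‖) ^ N * I.toReal * (C₁ * e.toReal)), by positivity,
    fun K φ hφ M g hg hsupp l => ?_⟩
  have hM := hg.nonneg
  set f := multiplier (P.χ.symbol _ l) (toSchwartz φ) with hf
  set g' := multiplier (P.χ.wideSymbol _ l) g with hg'
  have hop : P.χ.op l φ = f := op_eq_multiplier_toSchwartz P.χ l φ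
  rw [integral_multiplier_mul_eq (P.χ.wideSymbol_mul_symbol l) (P.χ.wideSymbol_neg l)
    (toSchwartz φ) g]
  have hS : ∀ x, ∫⁻ z in Metric.ball (0 : EuclideanSpace ℝ (Fin ds)) 1, ‖f (x + A z)‖ₑ ≤
      ENNReal.ofReal (C₁ * (2 : ℝ) ^ (-(l : ℝ) * (P.t + P.s))) * P.uNorm φ * e := by
    intro x
    have hΓ := P.isFakeStableLeaf_flatLeaf hW hdim x
    refine (lintegral_ball_flatLeaf_le hA hAW P.one_le_p x (measurableSet_leaf hΓ)
      (injOn_proj P hΓ) f.continuous).trans ?_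
    gcongr
    rw [← hop]
    exact hleaf K φ l x
  have key := lintegral_mul_le_of_ball A N f.continuous g'.continuous (hdecay M g hg hsupp l) hS
  have hmain : ENNReal.ofReal ‖∫ x, f x * g' x‖ ≤ b⁻¹ *
      (ENNReal.ofReal (C₂ * M * (2 : ℝ) ^ (-(l : ℝ) * (m + α)) * (1 + ‖A‖) ^ N) * I *
        (ENNReal.ofReal (C₁ * (2 : ℝ) ^ (-(l : ℝ) * (P.t + P.s))) * P.uNorm φ * e)) := by
    rw [ofReal_norm]
    refine (enorm_integral_le_lintegral_enorm _).trans ?_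
    simp only [enorm_mul]
    rw [← ENNReal.div_eq_inv_mul, ENNReal.le_div_iff_mul_le (.inl hb0) (.inl hbt), mul_comm]
    exact key
  have hmain' := ENNReal.toReal_mono (by
    refine ENNReal.mul_ne_top (ENNReal.inv_ne_top.mpr hb0) ?_
    refine ENNReal.mul_ne_top (ENNReal.mul_ne_top ENNReal.ofReal_ne_top hIt) ?_
    exact ENNReal.mul_ne_top (ENNReal.mul_ne_top ENNReal.ofReal_ne_top hφ.ne) het) hmain
  rw [ENNReal.toReal_ofReal (norm_nonneg _)] at hmain'
  refine hmain'.trans (le_of_eq ?_)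
  simp only [ENNReal.toReal_mul]
  rw [ENNReal.toReal_ofReal (by positivity), ENNReal.toReal_ofReal (by positivity)]
  have hpow : ((2 : ℝ) ^ (-(P.t + P.s + (m + α)))) ^ l =
      (2 : ℝ) ^ (-(l : ℝ) * (m + α)) * (2 : ℝ) ^ (-(l : ℝ) * (P.t + P.s)) := by
    rw [← Real.rpow_natCast, ← Real.rpow_mul zero_le_two, ← Real.rpow_add zero_lt_two]
    congr 1; ring
  rw [hpow]
  ring

/-- The norm `‖·‖_U` controls the pairing with Hölder functions of order more than `-(t + s)`. -/
lemma Params.norm_integral_mul_le (P : Params ds du) (hs : P.s < 0) (m : ℕ) {α : ℝ}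
    (hα : 0 < α) (hα1 : α ≤ 1) (hsum : 0 < P.t + P.s + (m + α)) {ρ : ℝ} (hρ : 0 ≤ ρ) :
    ∃ C : ℝ, 0 ≤ C ∧ ∀ (K : TopologicalSpace.Compacts (Space ds du)) (φ : 𝓓_{K}(Space ds du, ℂ)),
      P.uNorm φ < ⊤ → ∀ (M : ℝ) (g : 𝓢(Space ds du, ℂ)), HolderBound m α M g →
        tsupport g ⊆ Metric.closedBall 0 ρ →
          ‖∫ x, φ x * g x‖ ≤ C * (P.uNorm φ).toReal * M := by
  obtain ⟨C, hC, hblock⟩ := P.norm_integral_multiplier_mul_le hs m hα hα1 hρ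
  -- The ratio of the dyadic series; `q < 1` is exactly the condition that `m + α` exceed `-(t +
  -- s)`.
  set q := (2 : ℝ) ^ (-(P.t + P.s + (m + α))) with hq
  have hq0 : 0 ≤ q := by positivity
  have hq1 : q < 1 := Real.rpow_lt_one_of_one_lt_of_neg one_lt_two (by linarith)
  refine ⟨C * (1 - q)⁻¹, mul_nonneg hC (inv_nonneg.mpr (by linarith)),
    fun K φ hφ M g hg hsupp => ?_⟩
  have hM := hg.nonneg
  -- It suffices to bound the low-pass truncations uniformly; each is a finite sum of blocks.
  refine le_of_tendsto (P.χ.tendsto_integral_low (toSchwartz φ) g).norm (.of_forall fun L => ?_)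
  have hdec : ∫ x, multiplier (P.χ.low (Space ds du) (c := 2 ^ L) (by positivity))
      (toSchwartz φ) x * g x = ∑ l ∈ Finset.range (L + 1),
        ∫ x, multiplier (P.χ.symbol _ l) (toSchwartz φ) x * g x := by
    rw [← P.χ.sum_symbol, multiplier_sum, ← integral_finsetSum]
    · simp only [sum_apply, Finset.sum_mul]
    · intro l _
      exact g.integrable.bdd_mul (Continuous.aestronglyMeasurable (by fun_prop))
        (.of_forall fun x => SchwartzMap.norm_le_seminorm ℝ _ _)
  rw [hdec]
  refine (norm_sum_le _ _).trans ((Finset.sum_le_sum fun l _ => hblock K φ hφ M g hg hsupp l).trans ?_)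
  rw [← Finset.mul_sum]
  have hgeom : ∑ l ∈ Finset.range (L + 1), q ^ l ≤ (1 - q)⁻¹ := by
    rw [← tsum_geometric_of_lt_one hq0 hq1]
    exact (summable_geometric_of_lt_one hq0 hq1).sum_le_tsum _ fun _ _ => by positivity
  calc _ ≤ C * (P.uNorm φ).toReal * M * (1 - q)⁻¹ := by gcongr
    _ = _ := by ring

/-! ### The embedding into distributions -/

section Embedding

variable {K : TopologicalSpace.Compacts (Space ds du)}

lemma HolderBound.ofReal {E : Type*} [NormedAddCommGroup E] [NormedSpace ℝ E] {m : ℕ} {α M : ℝ}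
    {f : E → ℝ} (hf : HolderBound m α M f) : HolderBound m α M fun x => (f x : ℂ) := by
  have hcomp : (fun x => (f x : ℂ)) = Complex.ofRealLI ∘ f := rfl
  have hj : ∀ j : ℕ, ∀ x, iteratedFDeriv ℝ j (fun x => (f x : ℂ)) x =
      Complex.ofRealLI.toContinuousLinearMap.compContinuousMultilinearMap (iteratedFDeriv ℝ j f x) :=
    fun j x => Complex.ofRealLI.toContinuousLinearMap.iteratedFDeriv_comp_left hf.contDiff.contDiffAt
      (by exact_mod_cast le_top)
  refine ⟨Complex.ofRealCLM.contDiff.comp hf.contDiff, fun j hjm x => ?_, fun x y => ?_⟩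
  · rw [hj, LinearIsometry.norm_compContinuousMultilinearMap]
    exact hf.norm_le j hjm x
  · have : Complex.ofRealLI.toContinuousLinearMap.compContinuousMultilinearMap
        (iteratedFDeriv ℝ m f x - iteratedFDeriv ℝ m f y) =
        Complex.ofRealLI.toContinuousLinearMap.compContinuousMultilinearMap
          (iteratedFDeriv ℝ m f x) -
        Complex.ofRealLI.toContinuousLinearMap.compContinuousMultilinearMap
          (iteratedFDeriv ℝ m f y) := by
      ext v; simp
    rw [hj, hj, ← this, LinearIsometry.norm_compContinuousMultilinearMap]
    exact hf.holder x y

/-- A smooth function with compact support that is `1` on `K`. -/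
lemma exists_schwartz_eq_one (K : TopologicalSpace.Compacts (Space ds du)) :
    ∃ θ : 𝓢(Space ds du, ℂ), HasCompactSupport θ ∧ ∀ x ∈ K, θ x = 1 := by
  obtain ⟨ρ, hρ, hK⟩ := exists_closedBall K
  let b : ContDiffBump (0 : Space ds du) := ⟨ρ + 1, ρ + 2, by linarith, by linarith⟩
  have hc : HasCompactSupport fun x => (b x : ℂ) :=
    b.hasCompactSupport.comp_left (g := fun t : ℝ => (t : ℂ)) rfl
  refine ⟨hc.toSchwartzMap (Complex.ofRealCLM.contDiff.comp b.contDiff), hc, fun x hx => ?_⟩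
  change (b x : ℂ) = 1
  rw [b.one_of_mem_closedBall (Metric.closedBall_subset_closedBall (by linarith) (hK hx)),
    Complex.ofReal_one]

lemma integral_eq_integral_mul_of_eq_one {θ : Space ds du → ℂ} (hθ : ∀ x ∈ K, θ x = 1)
    (φ : 𝓓_{K}(Space ds du, ℂ)) (h : Space ds du → ℂ) :
    ∫ x, h x * φ x = ∫ x, φ x * (θ x * h x) := by
  congr 1
  ext x
  by_cases hx : x ∈ K
  · rw [hθ x hx, one_mul, mul_comm]
  · have : φ x = 0 := φ.zero_on_compl hx
    rw [this, mul_zero, zero_mul]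

/-- The pairing of `C^∞(K)` with smooth functions is controlled by `‖·‖_U` and `C^u` norms. -/
lemma Params.norm_integral_mul_le_of_holderBound (P : Params ds du)
    (K : TopologicalSpace.Compacts (Space ds du)) (hs : P.s < 0) (m : ℕ) {α : ℝ}
    (hα : 0 < α) (hα1 : α ≤ 1) (hsum : 0 < P.t + P.s + (m + α)) :
    ∃ C : ℝ, 0 ≤ C ∧ ∀ φ : 𝓓_{K}(Space ds du, ℂ), P.uNorm φ < ⊤ →
      ∀ (M : ℝ) (h : Space ds du → ℂ), HolderBound m α M h →
        ‖∫ x, h x * φ x‖ ≤ C * M * (P.uNorm φ).toReal := by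
  -- Inserting a cutoff equal to `1` on `K` confines `h` to a ball depending only on `K`. The
  -- constant is then independent of the support of `h`, which need not be compact.
  obtain ⟨θ, hθc, hθ⟩ := exists_schwartz_eq_one K
  obtain ⟨ρ, hρ, hθρ⟩ := exists_closedBall ⟨tsupport θ, hθc⟩
  obtain ⟨B, hB⟩ := exists_bound_iteratedFDeriv (θ.smooth ⊤) hθc (m + 1)
  have hB0 : 0 ≤ B := (norm_nonneg _).trans (hB 0 (Nat.zero_le _) 0)
  obtain ⟨C, hC, hpair⟩ := P.norm_integral_mul_le hs m hα hα1 hsum hρ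
  refine ⟨C * (4 * 2 ^ m * B), by positivity, fun φ hφ M h hh => ?_⟩
  have hmul := hh.mul hα hα1 (θ.smooth ⊤) hB
  have hc : HasCompactSupport fun x => θ x * h x := hθc.mul_right
  have := hpair K φ hφ _ (hc.toSchwartzMap hmul.contDiff) hmul
    ((closure_mono (Function.support_mul_subset_left _ _)).trans hθρ)
  rw [integral_eq_integral_mul_of_eq_one hθ φ h]
  refine this.trans (le_of_eq ?_)
  ring

/-- The pairing with a continuous function, as a linear form on `C^∞(K)`. -/
def Params.pairing (P : Params ds du) (K : TopologicalSpace.Compacts (Space ds du))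
    {h : Space ds du → ℂ} (hc : Continuous h) : P.SmoothSpace K →ₗ[ℂ] ℂ where
  toFun φ := ∫ x, h x * (φ.1 : 𝓓_{K}(Space ds du, ℂ)) x
  map_add' φ ψ := by
    have hint : ∀ φ : 𝓓_{K}(Space ds du, ℂ), Integrable fun x => h x * φ x := fun φ =>
      (hc.mul φ.continuous).integrable_of_hasCompactSupport φ.hasCompactSupport.mul_left
    rw [← integral_add (hint _) (hint _)]
    congr 1
    ext x
    exact mul_add _ _ _
  map_smul' c φ := by
    rw [RingHom.id_apply, smul_eq_mul, ← integral_const_mul]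
    congr 1
    ext x
    exact mul_left_comm _ _ _

lemma Params.norm_smoothSpace (P : Params ds du) (φ : P.SmoothSpace K) :
    ‖φ‖ = (P.uNorm (φ.1 : 𝓓_{K}(Space ds du, ℂ))).toReal := rfl

/-- The space `U_p^{t,s}(K)` maps to distributions. -/
lemma Params.exists_linearMap_distribution (P : Params ds du)
    (K : TopologicalSpace.Compacts (Space ds du)) (hs : P.s < 0) {u : ℝ} (hu : |P.t + P.s| < u) :
    ∃ J : P.USpace K →ₗ[ℂ] 𝓓'((⊤ : TopologicalSpace.Opens (Space ds du)), ℂ),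
      (∀ (φ : P.SmoothSpace K) (v : 𝓓((⊤ : TopologicalSpace.Opens (Space ds du)), ℝ)),
        J φ v = ∫ x, (v x : ℂ) * (φ.1 : 𝓓_{K}(Space ds du, ℂ)) x) ∧
      ∃ C : ℝ, 0 ≤ C ∧ ∀ (x : P.USpace K)
        (v : 𝓓((⊤ : TopologicalSpace.Opens (Space ds du)), ℝ)),
        ‖J x v‖ ≤ C * (cNorm u v).toReal * ‖x‖ := by
  have hu0 : 0 < u := (abs_nonneg _).trans_lt hu
  obtain ⟨C, hC, hpair⟩ := P.norm_integral_mul_le_of_holderBound K hs (⌈u⌉₊ - 1)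
    (sub_pos.mpr (ceil_sub_one_lt hu0)) (sub_ceil_sub_one_le u)
    (by linarith [neg_abs_le (P.t + P.s)])
  let e : P.SmoothSpace K →ₗ[ℂ] P.USpace K :=
    (UniformSpace.Completion.toComplₗᵢ (𝕜 := ℂ) (E := P.SmoothSpace K)).toLinearMap
  have he : DenseRange e := UniformSpace.Completion.denseRange_coe
  have hvc : ∀ v : 𝓓((⊤ : TopologicalSpace.Opens (Space ds du)), ℝ),
      Continuous fun x => (v x : ℂ) := fun v => Complex.continuous_ofReal.comp v.continuous
  have hbound : ∀ (v : 𝓓((⊤ : TopologicalSpace.Opens (Space ds du)), ℝ)) (φ : P.SmoothSpace K),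
      ‖P.pairing K (hvc v) φ‖ ≤ C * (cNorm u v).toReal * ‖e φ‖ := by
    intro v φ
    have hnorm : ‖e φ‖ = ‖φ‖ := UniformSpace.Completion.norm_coe φ
    rw [hnorm]
    exact hpair φ.1 φ.2 _ _ (holderBound_of_cNorm_ne_top hu0 v.contDiff
      (cNorm_ne_top hu0.le v.contDiff v.hasCompactSupport)).ofReal
  -- For each test function the pairing is extended separately in `x`; linearity in the test
  -- function is then recovered by density.
  let T : 𝓓((⊤ : TopologicalSpace.Opens (Space ds du)), ℝ) → P.USpace K →L[ℂ] ℂ := fun v =>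
    (P.pairing K (hvc v)).extendOfNorm e
  have hT : ∀ v (φ : P.SmoothSpace K), T v φ =
      ∫ x, (v x : ℂ) * (φ.1 : 𝓓_{K}(Space ds du, ℂ)) x := fun v φ =>
    LinearMap.extendOfNorm_eq he ⟨_, hbound v⟩ φ
  have hTle : ∀ v x, ‖T v x‖ ≤ C * (cNorm u v).toReal * ‖x‖ := fun v x =>
    LinearMap.norm_extendOfNorm_apply_le he _ (hbound v) x
  have hint : ∀ (v : 𝓓((⊤ : TopologicalSpace.Opens (Space ds du)), ℝ))
      (φ : 𝓓_{K}(Space ds du, ℂ)), Integrable fun x => (v x : ℂ) * φ x := fun v φ =>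
    ((hvc v).mul φ.continuous).integrable_of_hasCompactSupport φ.hasCompactSupport.mul_left
  have hadd : ∀ v w x, T (v + w) x = T v x + T w x := by
    intro v w x
    induction x using UniformSpace.Completion.induction_on with
    | hp => exact isClosed_eq (T (v + w)).continuous ((T v).continuous.add (T w).continuous)
    | ih φ =>
      rw [hT, hT, hT, ← integral_add (hint _ _) (hint _ _)]
      congr 1
      ext x
      rw [add_apply, Complex.ofReal_add, add_mul]
  have hsmul : ∀ (c : ℝ) v x, T (c • v) x = c • T v x := by
    intro c v x
    induction x using UniformSpace.Completion.induction_on with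
    | hp => exact isClosed_eq (T (c • v)).continuous ((T v).continuous.const_smul c)
    | ih φ =>
      rw [hT, hT, ← integral_smul]
      congr 1
      ext x
      rw [smul_apply, smul_eq_mul, Complex.ofReal_mul, Complex.real_smul, mul_assoc]
  have hcont : ∀ (x : P.USpace K) (K' : TopologicalSpace.Compacts (Space ds du))
      (hK' : (K' : Set (Space ds du)) ⊆ (⊤ : TopologicalSpace.Opens (Space ds du))),
      ∃ (s : Finset ℕ) (C' : ℝ), 0 ≤ C' ∧ ∀ f : 𝓓_{K'}(Space ds du, ℝ),
        ‖T (TestFunction.ofSupportedIn hK' f) x‖ ≤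
          C' * (s.sup fun i => ContDiffMapSupportedIn.seminorm ℝ (Space ds du) ℝ ⊤ K' i) f := by
    intro x K' hK'
    -- Derivatives up to order `⌊u⌋ + 1` control the `C^u` norm, the last one through its Hölder
    -- seminorm.
    refine ⟨Finset.range (⌊u⌋₊ + 2), C * (⌊u⌋₊ + 3) * ‖x‖, by positivity, fun f => ?_⟩
    set B := ((Finset.range (⌊u⌋₊ + 2)).sup fun i =>
      ContDiffMapSupportedIn.seminorm ℝ (Space ds du) ℝ ⊤ K' i) f with hB
    have hB0 : 0 ≤ B := apply_nonneg _ _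
    have hc : cNorm u f ≤ ENNReal.ofReal ((⌊u⌋₊ + 3) * B) := by
      refine cNorm_le_of_bounded hu0.le f.contDiff fun j hj y => ?_
      refine (ContDiffMapSupportedIn.norm_iteratedFDeriv_apply_le_seminorm_top ℝ).trans ?_
      exact (Finset.le_sup (f := fun i => ContDiffMapSupportedIn.seminorm ℝ (Space ds du) ℝ ⊤ K' i)
        (Finset.mem_range.mpr (by omega)) : _ ≤ _) f
    have hc' := ENNReal.toReal_mono ENNReal.ofReal_ne_top hc
    rw [ENNReal.toReal_ofReal (by positivity)] at hc'
    refine (hTle _ x).trans ?_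
    rw [TestFunction.coe_ofSupportedIn]
    calc C * (cNorm u f).toReal * ‖x‖ ≤ C * ((⌊u⌋₊ + 3) * B) * ‖x‖ := by gcongr
      _ = _ := by ring
  let J : P.USpace K →ₗ[ℂ] 𝓓'((⊤ : TopologicalSpace.Opens (Space ds du)), ℂ) :=
    { toFun := fun x => TestFunction.limitCLM ℝ (fun v => T v x)
        (fun K' hK' => ContDiffMapSupportedIn.mkCLMtoNormedSpace ℝ
          (fun f => T (TestFunction.ofSupportedIn hK' f) x)
          (fun f g => hadd (TestFunction.ofSupportedIn hK' f) (TestFunction.ofSupportedIn hK' g) x)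
          (fun c f => hsmul c (TestFunction.ofSupportedIn hK' f) x) (hcont x K' hK'))
        (fun _ _ _ => rfl)
      map_add' := fun x y => by
        ext v
        exact (T v).map_add x y
      map_smul' := fun c x => by
        ext v
        exact (T v).map_smul c x }
  exact ⟨J, fun φ v => hT v φ, C, hC, fun x v => hTle v x⟩

end Embedding

/-! ### Order, support and injectivity -/

section Injectivity

variable {K : TopologicalSpace.Compacts (Space ds du)}

/-- The distributions defined by elements of the completion of `C^∞(K)` are supported on `K`. -/
lemma Params.dsupport_subset (P : Params ds du)
    (J : P.USpace K →ₗ[ℂ] 𝓓'((⊤ : TopologicalSpace.Opens (Space ds du)), ℂ))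
    (hJ : ∀ (φ : P.SmoothSpace K) (v : 𝓓((⊤ : TopologicalSpace.Opens (Space ds du)), ℝ)),
      J φ v = ∫ x, (v x : ℂ) * (φ.1 : 𝓓_{K}(Space ds du, ℂ)) x)
    (hJc : ∀ v, Continuous fun x => J x v) (x : P.USpace K) :
    dsupport (J x) ⊆ (K : Set (Space ds du)) := by
  refine Set.sInter_subset_of_mem ⟨fun v hv => ?_, K.isCompact.isClosed⟩
  induction x using UniformSpace.Completion.induction_on with
  | hp => exact isClosed_eq (hJc v) continuous_const
  | ih φ =>
    rw [hJ]
    refine (integral_congr_ae (.of_forall fun y => ?_)).trans (integral_zero _ _)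
    by_cases hy : y ∈ (K : Set (Space ds du))
    · have : v y = 0 := by
        by_contra h0
        exact hv (subset_tsupport v h0) hy
      simp [this]
    · have : (φ.1 : 𝓓_{K}(Space ds du, ℂ)) y = 0 :=
        (φ.1 : 𝓓_{K}(Space ds du, ℂ)).zero_on_compl hy
      simp [this]

/-- Reflected translates of a Schwartz function satisfy uniform Hölder bounds. -/
lemma exists_holderBound_reflect {V : Type*} [NormedAddCommGroup V] [InnerProductSpace ℝ V]
    (k : 𝓢(V, ℂ)) (m : ℕ) {α : ℝ} (hα : 0 < α) (hα1 : α ≤ 1) :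
    ∃ M : ℝ, ∀ x : V, HolderBound m α M fun y => k (x - y) := by
  have hb : ∀ j : ℕ, ∃ B : ℝ, ∀ x, ‖iteratedFDeriv ℝ j k x‖ ≤ B := fun j =>
    ⟨_, fun x => by simpa using SchwartzMap.le_seminorm ℝ 0 j k x⟩
  choose B hB using hb
  refine ⟨2 * ∑ j ∈ Finset.range (m + 2), |B j|, fun x => holderBound_of_bounded hα hα1
    ((k.smooth ⊤).comp (contDiff_const.sub contDiff_id)) fun j hj y => ?_⟩
  have hcomp : (fun y => k (x - y)) = fun y => (k ∘ LinearIsometryEquiv.neg ℝ) (y - x) := by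
    ext y; simp
  rw [hcomp, iteratedFDeriv_comp_sub, LinearIsometryEquiv.norm_iteratedFDeriv_comp_right]
  refine (hB j _).trans ((le_abs_self _).trans ?_)
  exact Finset.single_le_sum (f := fun j => |B j|) (fun _ _ => abs_nonneg _)
    (Finset.mem_range.mpr (by omega))

/-- A smooth function acts on `C^∞(K)` as a combination of test functions. -/
lemma exists_testFunction_pairing (K : TopologicalSpace.Compacts (Space ds du))
    {h : Space ds du → ℂ} (hh : ContDiff ℝ ∞ h) :
    ∃ v w : 𝓓((⊤ : TopologicalSpace.Opens (Space ds du)), ℝ), ∀ φ : 𝓓_{K}(Space ds du, ℂ),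
      ∫ x, h x * φ x = (∫ x, (v x : ℂ) * φ x) + Complex.I * ∫ x, (w x : ℂ) * φ x := by
  obtain ⟨θ, hθc, hθ⟩ := exists_schwartz_eq_one K
  have hs : ContDiff ℝ ∞ fun x => θ x * h x := (θ.smooth ⊤).mul hh
  have hc : HasCompactSupport fun x => θ x * h x := hθc.mul_right
  -- Test functions are real-valued, so the complex function `θ * h` is split into its real and
  -- imaginary parts.
  let v : 𝓓((⊤ : TopologicalSpace.Opens (Space ds du)), ℝ) :=
    ⟨fun x => (θ x * h x).re, Complex.reCLM.contDiff.comp hs,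
      hc.comp_left (g := Complex.re) rfl, fun _ _ => trivial⟩
  let w : 𝓓((⊤ : TopologicalSpace.Opens (Space ds du)), ℝ) :=
    ⟨fun x => (θ x * h x).im, Complex.imCLM.contDiff.comp hs,
      hc.comp_left (g := Complex.im) rfl, fun _ _ => trivial⟩
  refine ⟨v, w, fun φ => ?_⟩
  have hint : ∀ v : 𝓓((⊤ : TopologicalSpace.Opens (Space ds du)), ℝ),
      Integrable fun x => (v x : ℂ) * φ x := fun v =>
    ((Complex.continuous_ofReal.comp v.continuous).mul φ.continuous).integrable_of_hasCompactSupport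
      φ.hasCompactSupport.mul_left
  rw [integral_eq_integral_mul_of_eq_one hθ φ h, ← integral_const_mul,
    ← integral_add (hint v) ((hint w).const_mul _)]
  congr 1
  ext x
  have : θ x * h x = (v x : ℂ) + (w x : ℂ) * Complex.I := (Complex.re_add_im _).symm
  rw [this]
  ring

/-- Exhibits each value of a block as a pairing of `φ` with a smooth function, to which the
continuity of the pairing applies. -/
lemma op_eq_integral (χ : Cutoff) (l : ℕ) (φ : 𝓓_{K}(Space ds du, ℂ)) (x : Space ds du) :
    χ.op l φ x = ∫ y, (𝓕⁻ (χ.symbol (Space ds du) l) : 𝓢(Space ds du, ℂ)) (x - y) * φ y := by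
  have h := integral_mul_sub_smul (k := 𝓕⁻ (χ.symbol (Space ds du) l)) (m := χ.symbol _ l) (ε := 1)
    (fun ξ => by rw [one_smul, fourierInv_coe, fourier_fourierInv_apply]) (toSchwartz φ) x
  rw [op_eq_multiplier_toSchwartz, ← h]
  simp only [one_smul, coe_toSchwartz]
  rw [← integral_sub_left_eq_self _ volume x]
  simp

/-- Uniform bound for the functions `ψ_l^{Op} φ`. -/
lemma Params.exists_norm_op_le (P : Params ds du) (K : TopologicalSpace.Compacts (Space ds du))
    (hs : P.s < 0) (l : ℕ) :
    ∃ C : ℝ, ∀ (φ : P.SmoothSpace K) (x : Space ds du),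
      ‖P.χ.op l (φ.1 : 𝓓_{K}(Space ds du, ℂ)) x‖ ≤ C * ‖φ‖ := by
  -- Any integer beyond `-(t + s)` will do, with `α = 1`: the bound may depend on `l`, since it only
  -- serves dominated convergence for a fixed block.
  obtain ⟨m, hm⟩ := exists_nat_gt (-(P.t + P.s))
  obtain ⟨C, hC, hpair⟩ := P.norm_integral_mul_le_of_holderBound K hs m one_pos le_rfl
    (by linarith)
  obtain ⟨M, hM⟩ := exists_holderBound_reflect
    (𝓕⁻ (P.χ.symbol (Space ds du) l) : 𝓢(Space ds du, ℂ)) m one_pos le_rfl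
  refine ⟨C * M, fun φ x => ?_⟩
  rw [op_eq_integral]
  exact hpair φ.1 φ.2 M _ (hM x)

/-- Pointwise bounded convergence of `f_n` to `0` implies that of their images by
`ψ_l^{Op(Γ)}`. -/
lemma Params.tendsto_leafOp_zero (P : Params ds du) {Γ : Set (Space ds du)}
    (hΓ : IsFakeStableLeaf P.r P.cones.plus P.CF Γ) {f : ℕ → Space ds du → ℂ}
    (hf : ∀ n, Continuous (f n)) {B : ℝ} (hB : ∀ n x, ‖f n x‖ ≤ B)
    (hlim : ∀ x, Filter.Tendsto (fun n => f n x) Filter.atTop (nhds 0)) (l : ℕ)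
    (w : Space ds du) :
    Filter.Tendsto (fun n => P.χ.leafOp Γ l (f n) w) Filter.atTop (nhds 0) := by
  simp only [P.χ.leafOp_eq_kernel]
  set k : 𝓢(EuclideanSpace ℝ (Fin ds), ℂ) := 𝓕⁻ (P.χ.symbol (EuclideanSpace ℝ (Fin ds)) l)
  have hkc : Continuous fun z => k (proj w - z) := by fun_prop
  rw [← integral_zero (EuclideanSpace ℝ (Fin ds)) ℂ (μ := volume.restrict (proj '' Γ))]
  refine tendsto_integral_of_dominated_convergence (fun z => ‖k (proj w - z)‖ * B) (fun n => ?_) ?_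
    (fun n => .of_forall fun z => ?_) (.of_forall fun z => ?_)
  · exact hkc.aestronglyMeasurable.mul
      ((hf n).measurable.comp_aemeasurable (aemeasurable_leafInv hΓ)).aestronglyMeasurable
  · exact ((k.integrable.comp_sub_left (proj w)).norm.mul_const B).restrict
  · rw [norm_mul]
    gcongr
    exact hB n _
  · simpa using (hlim (leafInv Γ z)).const_mul (k (proj w - z))

/-- A Cauchy sequence of `C^∞(K)` whose dyadic blocks tend to `0` pointwise tends to `0`. -/
lemma Params.norm_le_of_tendsto_zero (P : Params ds du) (hs : P.s < 0) {φ : ℕ → P.SmoothSpace K}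
    {ε : ℝ} (hε : 0 ≤ ε) {N : ℕ} (hN : ∀ n ≥ N, ∀ m ≥ N, ‖φ n - φ m‖ ≤ ε)
    (hlim : ∀ l x, Filter.Tendsto (fun n => P.χ.op l ((φ n).1 : 𝓓_{K}(Space ds du, ℂ)) x)
      Filter.atTop (nhds 0)) : ∀ n ≥ N, ‖φ n‖ ≤ ε := by
  intro n hn
  have huN : ∀ ψ : P.SmoothSpace K, P.uNorm (ψ.1 : 𝓓_{K}(Space ds du, ℂ)) = ENNReal.ofReal ‖ψ‖ :=
    fun ψ => (ENNReal.ofReal_toReal ψ.2.ne).symm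
  have hnorm : ∀ m, ‖φ (m + N)‖ ≤ ‖φ n‖ + ε := by
    intro m
    have h1 := norm_sub_norm_le (φ (m + N)) (φ n)
    have h2 := hN (m + N) (by omega) n hn
    linarith
  rw [P.norm_smoothSpace]
  refine ENNReal.toReal_le_of_le_ofReal hε ?_
  refine iSup_le fun Γ => iSup_le fun hΓ => iSup_le fun l => ?_
  rw [isoNorm, ENNReal.mul_iSup]
  refine iSup_le fun l' => ?_
  obtain ⟨C, hC⟩ := P.exists_norm_op_le K hs l
  have hcont : ∀ ψ : P.SmoothSpace K, Continuous (P.χ.op l (ψ.1 : 𝓓_{K}(Space ds du, ℂ))) :=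
    fun ψ => (decays_op P.χ l _).1
  have hleaf : ∀ ψ : P.SmoothSpace K, Continuous
      (P.χ.leafOp Γ l' (P.χ.op l (ψ.1 : 𝓓_{K}(Space ds du, ℂ)))) :=
    fun ψ => (decays_op P.χ l _).continuous_leafOp P.χ hΓ l'
  have hadd : ∀ (m : ℕ) (w : Space ds du),
      P.χ.leafOp Γ l' (P.χ.op l ((φ n - φ (m + N)).1 : 𝓓_{K}(Space ds du, ℂ))) w =
        P.χ.leafOp Γ l' (P.χ.op l ((φ n).1 : 𝓓_{K}(Space ds du, ℂ))) w -
          P.χ.leafOp Γ l' (P.χ.op l ((φ (m + N)).1 : 𝓓_{K}(Space ds du, ℂ))) w := by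
    intro m w
    have h1 : ((φ n).1 : 𝓓_{K}(Space ds du, ℂ)) = (φ n - φ (m + N)).1 + (φ (m + N)).1 :=
      (sub_add_cancel ((φ n).1 : 𝓓_{K}(Space ds du, ℂ)) (φ (m + N)).1).symm
    conv_rhs => rw [h1, op_add, leafOp_add P.χ hΓ (decays_op P.χ l _) (decays_op P.χ l _)]
    rw [Pi.add_apply, add_sub_cancel_right]
  -- The Cauchy property bounds the norms of the tail, hence its blocks uniformly in the point;
  -- pointwise convergence of the blocks then passes through the leaf operator.
  have hzero : ∀ w, Filter.Tendsto (fun m =>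
      P.χ.leafOp Γ l' (P.χ.op l ((φ (m + N)).1 : 𝓓_{K}(Space ds du, ℂ))) w)
      Filter.atTop (nhds 0) := by
    refine P.tendsto_leafOp_zero hΓ (fun m => hcont _) (B := |C| * (‖φ n‖ + ε)) (fun m x => ?_)
      (fun x => (hlim l x).comp (Filter.tendsto_add_atTop_nat N)) l'
    refine (hC _ x).trans ?_
    gcongr
    · exact le_abs_self C
    · exact hnorm m
  have hconv : ∀ w, Filter.Tendsto (fun m =>
      P.χ.leafOp Γ l' (P.χ.op l ((φ n - φ (m + N)).1 : 𝓓_{K}(Space ds du, ℂ))) w) Filter.atTop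
      (nhds (P.χ.leafOp Γ l' (P.χ.op l ((φ n).1 : 𝓓_{K}(Space ds du, ℂ))) w)) := by
    intro w
    simp only [hadd]
    simpa using (hzero w).const_sub
      (P.χ.leafOp Γ l' (P.χ.op l ((φ n).1 : 𝓓_{K}(Space ds du, ℂ))) w)
  -- With `n` fixed, the images of `φ n - φ (m + N)` converge pointwise to that of `φ n`, while
  -- their norms stay controlled by `ε`; Fatou's lemma transfers the bound.
  have hfatou := Lp.eLpNorm_lim_le_liminf_eLpNorm (p := P.p) (μ := leafVolume Γ)
    (f := fun m => P.χ.leafOp Γ l' (P.χ.op l ((φ n - φ (m + N)).1 : 𝓓_{K}(Space ds du, ℂ))))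
    (fun m => (hleaf _).aestronglyMeasurable)
    (P.χ.leafOp Γ l' (P.χ.op l ((φ n).1 : 𝓓_{K}(Space ds du, ℂ))))
    (.of_forall hconv)
  set c := (2 : ℝ) ^ (-(l : ℝ) * P.t) * (2 : ℝ) ^ (-(l' : ℝ) * P.s) with hc
  have hbound : eLpNorm (P.χ.leafOp Γ l' (P.χ.op l ((φ n).1 : 𝓓_{K}(Space ds du, ℂ)))) P.p
      (leafVolume Γ) ≤ ENNReal.ofReal c * ENNReal.ofReal ε := by
    refine hfatou.trans (Filter.liminf_le_of_frequently_le' (Filter.Frequently.of_forall fun m => ?_))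
    refine (P.eLpNorm_leafOp_op_le hΓ _ l l').trans ?_
    rw [huN]
    gcongr
    exact hN n hn (m + N) (by omega)
  refine (mul_le_mul_right (mul_le_mul_right hbound _) _).trans (le_of_eq ?_)
  rw [← mul_assoc, ← mul_assoc, ← ENNReal.ofReal_mul (by positivity),
    ← ENNReal.ofReal_mul (by positivity)]
  have : (2 : ℝ) ^ ((l : ℝ) * P.t) * (2 : ℝ) ^ ((l' : ℝ) * P.s) * c = 1 := by
    rw [hc, ← Real.rpow_add zero_lt_two, ← Real.rpow_add zero_lt_two, ← Real.rpow_add zero_lt_two]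
    ring_nf
    exact Real.rpow_zero 2
  rw [this, ENNReal.ofReal_one, one_mul]

/-- An element of the kernel is approximated by smooth functions whose blocks tend to `0` at every
point, by continuity of the pairing. Their norms are then eventually at most any `ε`, which forces
the limit to vanish. -/
lemma Params.injective_of_eq_integral (P : Params ds du) (hs : P.s < 0)
    (J : P.USpace K →ₗ[ℂ] 𝓓'((⊤ : TopologicalSpace.Opens (Space ds du)), ℂ))
    (hJ : ∀ (φ : P.SmoothSpace K) (v : 𝓓((⊤ : TopologicalSpace.Opens (Space ds du)), ℝ)),
      J φ v = ∫ x, (v x : ℂ) * (φ.1 : 𝓓_{K}(Space ds du, ℂ)) x)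
    (hJc : ∀ v, Continuous fun x => J x v) : Function.Injective J := by
  refine (injective_iff_map_eq_zero J).mpr fun x hx => ?_
  obtain ⟨φ', hφ', hφx⟩ := mem_closure_iff_seq_limit.mp
    (UniformSpace.Completion.denseRange_coe (α := P.SmoothSpace K) x)
  choose φ hφ using hφ'
  obtain rfl : (fun n => (φ n : P.USpace K)) = φ' := funext hφ
  have hlim : ∀ l y, Filter.Tendsto (fun n => P.χ.op l ((φ n).1 : 𝓓_{K}(Space ds du, ℂ)) y)
      Filter.atTop (nhds 0) := by
    intro l y
    obtain ⟨v, w, hvw⟩ := exists_testFunction_pairing K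
      (h := fun z => (𝓕⁻ (P.χ.symbol (Space ds du) l) : 𝓢(Space ds du, ℂ)) (y - z))
      (((𝓕⁻ (P.χ.symbol (Space ds du) l) : 𝓢(Space ds du, ℂ)).smooth ⊤).comp
        (contDiff_const.sub contDiff_id))
    simp only [op_eq_integral, hvw, ← hJ]
    have h0 : ∀ v, Filter.Tendsto (fun n => J (φ n) v) Filter.atTop (nhds 0) := by
      intro v
      have := ((hJc v).tendsto x).comp hφx
      simpa [hx, Function.comp_def] using this
    simpa using (h0 v).add ((h0 w).const_mul Complex.I)
  have hsmall : ∀ ε > 0, ‖x‖ ≤ ε := by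
    intro ε hε
    obtain ⟨N, hN⟩ := Metric.cauchySeq_iff.mp hφx.cauchySeq ε hε
    have hN' : ∀ n ≥ N, ∀ m ≥ N, ‖φ n - φ m‖ ≤ ε := by
      intro n hn m hm
      have := (hN n hn m hm).le
      rwa [dist_eq_norm, ← UniformSpace.Completion.coe_sub, UniformSpace.Completion.norm_coe] at this
    refine le_of_tendsto hφx.norm (Filter.eventually_atTop.mpr ⟨N, fun n hn => ?_⟩)
    rw [UniformSpace.Completion.norm_coe]
    exact P.norm_le_of_tendsto_zero hs hε.le hN' hlim n hn
  exact norm_le_zero_iff.mp (le_of_forall_pos_le_add fun ε hε => by simpa using hsmall ε hε)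

end Injectivity

end AnisotropicLeaf

end

/-! ### The norm bound and the embedding into distributions -/

theorem lemma3p6 {ds du : ℕ} (hds : 1 ≤ ds) (hdu : 1 ≤ du)
    (P : AnisotropicLeaf.Params ds du)
    (K : TopologicalSpace.Compacts (AnisotropicLeaf.Space ds du))
    (hst : P.s < -P.t) (ht : -P.t < 0) :
    -- the bound by the `C^u` norm
    (∀ u : ℝ, P.t < u → ∃ C : ℝ≥0, ∀ φ : 𝓓_{K}(AnisotropicLeaf.Space ds du, ℂ),
      P.uNorm φ ≤ C * AnisotropicLeaf.cNorm u φ) ∧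
    -- every function in `C^∞(K)` has finite norm, so the completion is that of all of `C^∞(K)`
    (∀ φ : 𝓓_{K}(AnisotropicLeaf.Space ds du, ℂ), P.uNorm φ < ⊤) ∧
    -- the embedding into distributions, extending the usual one on `C^∞(K)`
    (∀ u : ℝ, |P.t + P.s| < u →
      ∃ J : P.USpace K →ₗ[ℂ]
          𝓓'((⊤ : TopologicalSpace.Opens (AnisotropicLeaf.Space ds du)), ℂ),
        (∀ (φ : 𝓓_{K}(AnisotropicLeaf.Space ds du, ℂ)) (hφ : P.uNorm φ < ⊤)
          (v : 𝓓((⊤ : TopologicalSpace.Opens (AnisotropicLeaf.Space ds du)), ℝ)),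
          J (P.toSmooth φ hφ : P.USpace K) v = ∫ x, (v x : ℂ) * φ x) ∧
        Function.Injective J ∧
        (∀ x, J x ∈ AnisotropicLeaf.distributionsOfOrder K u) ∧
        ∃ C : ℝ≥0, ∀ (x : P.USpace K)
          (v : 𝓓((⊤ : TopologicalSpace.Opens (AnisotropicLeaf.Space ds du)), ℝ)),
          ‖J x v‖ₑ ≤ C * ‖x‖ₑ * AnisotropicLeaf.cNorm u v) := by
  have ht' : 0 < P.t := by linarith
  have hs : P.s < 0 := by linarith
  refine ⟨fun u hu => P.uNorm_le_cNorm K ht' hs hu, fun φ => P.uNorm_lt_top ht' hs φ,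
    fun u hu => ?_⟩
  have hu0 : 0 ≤ u := (abs_nonneg _).trans hu.le
  obtain ⟨J, hJ, C, hC, hJle⟩ := P.exists_linearMap_distribution K hs hu
  have hJc : ∀ v, Continuous fun x => J x v := fun v =>
    continuous_of_linear_of_bound (𝕜 := ℂ) (C := C * (AnisotropicLeaf.cNorm u v).toReal)
      (fun x y => by rw [map_add]; rfl) (fun c x => by rw [map_smul]; rfl) (fun x => hJle x v)
  have hbound : ∀ (x : P.USpace K)
      (v : 𝓓((⊤ : TopologicalSpace.Opens (AnisotropicLeaf.Space ds du)), ℝ)),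
      ‖J x v‖ₑ ≤ C.toNNReal * ‖x‖ₑ * AnisotropicLeaf.cNorm u v := by
    intro x v
    have hfin : AnisotropicLeaf.cNorm u v ≠ ⊤ :=
      AnisotropicLeaf.cNorm_ne_top hu0 v.contDiff v.hasCompactSupport
    have h : ENNReal.ofReal ‖J x v‖ ≤
        ENNReal.ofReal (C * (AnisotropicLeaf.cNorm u v).toReal * ‖x‖) :=
      ENNReal.ofReal_le_ofReal (hJle x v)
    rw [ENNReal.ofReal_mul (by positivity), ENNReal.ofReal_mul hC, ENNReal.ofReal_toReal hfin,
      ofReal_norm, ofReal_norm] at h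
    refine h.trans (le_of_eq ?_)
    rw [mul_right_comm]
    rfl
  refine ⟨J, fun φ hφ v => hJ (P.toSmooth φ hφ) v, P.injective_of_eq_integral hs J hJ hJc,
    -- The order constant is the same for every compact set `L`, since the pairing bound does not
    -- depend on the support of the test function.
    fun x => ⟨fun L => ⟨C.toNNReal * ‖x‖₊, fun v _ => ?_⟩, P.dsupport_subset J hJ hJc x⟩,
    C.toNNReal, hbound⟩
  rw [ENNReal.coe_mul]
  exact hbound x v
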